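/- **Nanophrases.** Let $\alpha_v=\{a_+,a_-,b_+,b_-\}$. An $n$-component nanophrase over $\alpha_v$ is a finite alphabet $\mathcal A$ with a map $\mathcal A\to\alpha_v$, $A\mapsto|A|$, together with a sequence $p=w_1|w_2|\cdots|w_n$ of words on $\mathcal A$ such that every letter of $\mathcal A$ occurs exactly twice in $w_1w_2\cdots w_n$. Let $\tau_v,\nu_v,\sigma_v$ be the involutions of $\alpha_v$ with $\tau_v: a_+\leftrightarrow b_-,\ a_-\leftrightarrow b_+$; $\nu_v: a_\pm\leftrightarrow b_\pm$; $\sigma_v: a_+\leftrightarrow a_-,\ b_+\leftrightarrow b_-$, and let $$S_v=\{(x_s,x_s,x_s),\,(x_s,x_s,x_{-s}),\,(x_s,x_{-s},x_{-s}) : x\in\{a,b\},\ s\in\{+,-\}\}.$$ **$M$-homotopy** is the equivalence relation on $n$-component nanophrases over $\alpha_v$ generated by isomorphisms (bijections of alphabets preserving $|\cdot|$ and carrying the $i$th component to the $i$th component for all $i$) and the following moves, where $x,y,z,t$ in H1–H3 are sequences of letters that may contain bars: - H1: $(\mathcal A, xAAy)\leftrightarrow(\mathcal A\setminus\{A\},xy)$;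 - H2: $(\mathcal A,xAByBAz)\leftrightarrow(\mathcal A\setminus\{A,B\},xyz)$ if $\tau_v(|A|)=|B|$; - H3: $(\mathcal A,xAByACzBCt)\leftrightarrow(\mathcal A,xBAyCAzCBt)$ if $(|A|,|B|,|C|)\in S_v$; - shift move: one component $Ax$ is replaced by $xA$, and $|A|$ is replaced by $\nu_v(|A|)$ if $A$ occurs in $x$ (and is kept otherwise); - self-crossing move: for a letter $A$ that occurs twice in one component, $|A|$ is replaced by $\sigma_v(|A|)$. **The numbers $\mu$.** Let $p=w_1|\cdots|w_n$ be a nanophrase over $\alpha_v$. To an occurrence of a letter $A$ in $w_i$ whose other occurrence lies in $w_k$ assign the sign $\varepsilon=1$ if ($i<k$ and $|A|=b_+$) or ($i>k$ and $|A|=a_+$); $\varepsilon=-1$ if ($i<k$ and $|A|=a_-$) or ($i>k$ and $|A|=b_-$); $\varepsilon=0$ otherwise. Let $w_i^\varepsilon$ be the word on $\mathcal A\cup\mathcal A^{-1}$ obtained from $w_i$ by replacing each letter $A$ by $A^{\varepsilon}$, with $A^0=\emptyset$. For a letter $A$ having an occurrence of non-zero sign, let $k(A)$ be the index of the component that contains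 the other occurrence of $A$, and let $x_A$ be the part of $w_{k(A)}^\varepsilon$ that precedes this other occurrence. On words in the letters of non-zero sign and their formal inverses define letter by letter, without cancellation, $$\rho^2(A^{\pm1})=A^{\pm1},\qquad \rho^q(A^{\pm1})=\rho^{q-1}(x_A^{-1})\,A^{\pm1}\,\rho^{q-1}(x_A)\quad(q\ge3),$$ put $\eta(A^{\pm1})=a_{k(A)}^{\pm1}$, and let $\varphi$ be the multiplicative map from words in $a_1^{\pm1},\dots,a_n^{\pm1}$ to the ring $\mathbb Z[[\kappa_1,\dots,\kappa_n]]$ of formal power series in non-commuting variables with $\varphi(a_h)=1+\kappa_h$ and $\varphi(a_h^{-1})=1-\kappa_h+\kappa_h^2-\cdots$. The coefficient of each monomial in $\varphi(\eta(\rho^q(w_i^\varepsilon)))$ is eventually constant in $q$; define $\mu(p;c_1,\dots,c_u,i)$, for $u\ge1$ and indices between $1$ and $n$, as the limit for $q\to\infty$ of the coefficient of $\kappa_{c_1}\cdots\kappa_{c_u}$. **The residue classes $\bar\mu$.** Let $\Delta(p;c_1,\dots,c_u,i)\ge0$ be the greatest common divisor of all $\mu(p;d_1,\dots,d_t)$ with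 $2\le t\le u$, where $d_1,\dots,d_t$ is obtained from $c_1,\dots,c_u,i$ by eliminating at least one term and permuting the remaining ones cyclically ($\Delta(p;c_1,i)=0$), and let $\bar\mu(p;c_1,\dots,c_u,i)$ be the residue class of $\mu(p;c_1,\dots,c_u,i)$ modulo $\Delta(p;c_1,\dots,c_u,i)$. **Theorem.** Let $p$ and $p'$ be $M$-homotopic $n$-component nanophrases over $\alpha_v$, and let $c_1,\dots,c_u,i$ be pairwise distinct integers between $1$ and $n$. Then $\Delta(p;c_1,\dots,c_u,i)=\Delta(p';c_1,\dots,c_u,i)$ and $\bar\mu(p;c_1,\dots,c_u,i)=\bar\mu(p';c_1,\dots,c_u,i)$. -/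

import Mathlib

open Filter Topology

/-! ### Formal power series in non-commuting variables -/

/-- The formal power series over `ℤ` in the non-commuting variables `κ_h`, `h : σ`. A monomial
`κ_{c₁} ⋯ κ_{c_u}` is the list `[c₁, …, c_u]`; a series is the function that gives the coefficient
of every monomial. -/
def NCSeries (σ : Type*) : Type _ := List σ → ℤ

namespace NCSeries

variable {σ : Type*}

instance : AddCommGroup (NCSeries σ) := inferInstanceAs (AddCommGroup (List σ → ℤ))

/-- The coefficient of a monomial. -/
def coeff (f : NCSeries σ) (c : List σ) : ℤ := f c

@[ext] theorem ext {f g : NCSeries σ} (h : ∀ c, f.coeff c = g.coeff c) : f = g := funext h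

instance : One (NCSeries σ) := ⟨fun c => if c.isEmpty then 1 else 0⟩

/-- The Cauchy product: the monomial `c` is split in all ways as a product of two monomials. -/
instance : Mul (NCSeries σ) :=
  ⟨fun f g c => ∑ k ∈ Finset.range (c.length + 1), f.coeff (c.take k) * g.coeff (c.drop k)⟩

theorem coeff_zero (c : List σ) : (0 : NCSeries σ).coeff c = 0 := rfl
theorem coeff_add (f g : NCSeries σ) (c : List σ) :
    (f + g).coeff c = f.coeff c + g.coeff c := rfl
theorem coeff_one (c : List σ) : (1 : NCSeries σ).coeff c = if c.isEmpty then 1 else 0 := rfl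
theorem coeff_mul (f g : NCSeries σ) (c : List σ) :
    (f * g).coeff c =
      ∑ k ∈ Finset.range (c.length + 1), f.coeff (c.take k) * g.coeff (c.drop k) := rfl

/-- The series whose coefficients are those of the monomials starting with `a`. -/
def shift (a : σ) (f : NCSeries σ) : NCSeries σ := fun c => f.coeff (a :: c)

theorem coeff_mul_nil (f g : NCSeries σ) : (f * g).coeff [] = f.coeff [] * g.coeff [] := by
  simp [coeff_mul]

theorem coeff_mul_cons (f g : NCSeries σ) (a : σ) (c : List σ) :
    (f * g).coeff (a :: c) = f.coeff [] * g.coeff (a :: c) + (shift a f * g).coeff c := by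
  rw [coeff_mul, coeff_mul, List.length_cons, Finset.sum_range_succ']
  simp [shift, coeff, add_comm]

protected theorem add_mul' (f g h : NCSeries σ) : (f + g) * h = f * h + g * h := by
  ext c
  simp only [coeff_add, coeff_mul, add_mul, Finset.sum_add_distrib]

protected theorem mul_add' (f g h : NCSeries σ) : f * (g + h) = f * g + f * h := by
  ext c
  simp only [coeff_add, coeff_mul, mul_add, Finset.sum_add_distrib]

protected theorem mul_assoc' (f g h : NCSeries σ) : f * g * h = f * (g * h) := by
  ext c
  induction c generalizing f g with
  | nil => simp only [coeff_mul_nil, mul_assoc]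
  | cons a c ih =>
    have e : ((shift a (f * g)) * h).coeff c =
        f.coeff [] * (shift a g * h).coeff c + (shift a f * g * h).coeff c := by
      simp only [coeff_mul (shift a (f * g)) h, coeff_mul (shift a g) h,
        coeff_mul (shift a f * g) h, Finset.mul_sum, ← Finset.sum_add_distrib]
      refine Finset.sum_congr rfl fun k _ => ?_
      have : (shift a (f * g)).coeff (c.take k) =
          f.coeff [] * (shift a g).coeff (c.take k) + (shift a f * g).coeff (c.take k) :=
        coeff_mul_cons f g a _
      rw [this]; ring
    rw [coeff_mul_cons, coeff_mul_nil, e, ih, coeff_mul_cons f, coeff_mul_cons g]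
    ring

protected theorem one_mul' (f : NCSeries σ) : 1 * f = f := by
  ext c
  rw [coeff_mul, Finset.sum_eq_single 0]
  · simp [coeff_one]
  · intro k hk hk0
    rw [Finset.mem_range] at hk
    cases c with
    | nil => simp at hk; omega
    | cons a c =>
      cases k with
      | zero => exact absurd rfl hk0
      | succ k => simp [coeff_one]
  · simp

protected theorem mul_one' (f : NCSeries σ) : f * 1 = f := by
  ext c
  rw [coeff_mul, Finset.sum_eq_single c.length]
  · simp [coeff_one]
  · intro k hk hk0
    rw [Finset.mem_range] at hk
    have : (c.drop k).isEmpty = false := by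
      rw [List.isEmpty_eq_false_iff]; intro h; rw [List.drop_eq_nil_iff] at h; omega
    simp [coeff_one, this]
  · simp

instance : Ring (NCSeries σ) :=
  { (inferInstance : AddCommGroup (NCSeries σ)) with
    mul_assoc := NCSeries.mul_assoc'
    one_mul := NCSeries.one_mul'
    mul_one := NCSeries.mul_one'
    left_distrib := NCSeries.mul_add'
    right_distrib := NCSeries.add_mul'
    zero_mul := fun f => by ext c; simp [coeff_mul, coeff_zero]
    mul_zero := fun f => by ext c; simp [coeff_mul, coeff_zero]
    zsmul := fun m f => m • f
    zsmul_zero' := fun f => zero_zsmul f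
    zsmul_succ' := fun m f => by
      simpa using SubNegMonoid.zsmul_succ' m f
    zsmul_neg' := fun m f => by
      simpa using SubNegMonoid.zsmul_neg' m f
    neg_add_cancel := fun f => neg_add_cancel f }

/-- The variable `κ_h`. -/
noncomputable def X (h : σ) : NCSeries σ := open Classical in fun c => if c = [h] then 1 else 0

/-- The geometric series `1 - κ_h + κ_h² - κ_h³ + ⋯`. -/
noncomputable def altGeom (h : σ) : NCSeries σ :=
  open Classical in fun c => if ∀ a ∈ c, a = h then (-1) ^ c.length else 0

end NCSeries

/-! ### Nanophrases -/

/-- Each letter of the alphabet occurs exactly twice in the concatenation of the components. -/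
def IsGaussPhrase {L : Type} {n : ℕ} (w : Fin n → List L) : Prop :=
  open Classical in ∀ A : L, (List.ofFn w).flatten.count A = 2

/-- An `n`-component nanophrase over `α`: a finite alphabet with a projection to `α`, and a Gauss
phrase on this alphabet with the components `word 0 | word 1 | ⋯ | word (n-1)`. -/
structure Nanophrase (α : Type) (n : ℕ) where
  /-- the alphabet -/
  Letter : Type
  finite : Finite Letter
  /-- the projection `A ↦ |A|` -/
  proj : Letter → α
  /-- the components -/
  word : Fin n → List Letter
  gauss : IsGaussPhrase word

/-- A phrase written as one sequence, where the symbol `none` stands for the bar that ends a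
component. -/
def flatPhrase {L : Type} {n : ℕ} (w : Fin n → List L) : List (Option L) :=
  (List.ofFn w).flatMap fun v => v.map some ++ [none]

/-- Homotopy data `(α, τ, S)` with the involutions `ν` (for shift moves) and `σ` (for self crossing
moves). -/
structure MHomotopyData (α : Type) where
  tau : α → α
  tau_invol : Function.Involutive tau
  S : Set (α × α × α)
  nu : α → α
  nu_invol : Function.Involutive nu
  sigma : α → α
  sigma_invol : Function.Involutive sigma

/-- The isomorphisms and the moves that generate `M`-homotopy. In H1, H2, H3 the sequences
`x, y, z, t` may contain bars. -/
inductive MMove {α : Type} (D : MHomotopyData α) {n : ℕ} :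
    Nanophrase α n → Nanophrase α n → Prop
  | iso (p q : Nanophrase α n) (f : p.Letter ≃ q.Letter)
      (hproj : ∀ A, q.proj (f A) = p.proj A)
      (hword : ∀ i, q.word i = (p.word i).map f) : MMove D p q
  /-- `xAAy ⟷ xy` -/
  | h1 {L : Type} (hL : Finite L) (proj : L → α) (w : Fin n → List L) (hw : IsGaussPhrase w)
      (A : L) (hL' : Finite {C : L // C ≠ A})
      (w' : Fin n → List {C : L // C ≠ A}) (hw' : IsGaussPhrase w')
      (x y : List (Option L))
      (h : flatPhrase w = x ++ [some A, some A] ++ y)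
      (h' : (flatPhrase w').map (Option.map Subtype.val) = x ++ y) :
      MMove D ⟨L, hL, proj, w, hw⟩ ⟨{C : L // C ≠ A}, hL', fun C => proj C, w', hw'⟩
  /-- `xAByBAz ⟷ xyz` if `τ(|A|) = |B|` -/
  | h2 {L : Type} (hL : Finite L) (proj : L → α) (w : Fin n → List L) (hw : IsGaussPhrase w)
      (A B : L) (hL' : Finite {C : L // C ≠ A ∧ C ≠ B})
      (w' : Fin n → List {C : L // C ≠ A ∧ C ≠ B}) (hw' : IsGaussPhrase w')
      (x y z : List (Option L))
      (hAB : D.tau (proj A) = proj B)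
      (h : flatPhrase w = x ++ [some A, some B] ++ y ++ [some B, some A] ++ z)
      (h' : (flatPhrase w').map (Option.map Subtype.val) = x ++ y ++ z) :
      MMove D ⟨L, hL, proj, w, hw⟩ ⟨{C : L // C ≠ A ∧ C ≠ B}, hL', fun C => proj C, w', hw'⟩
  /-- `xAByACzBCt ⟷ xBAyCAzCBt` if `(|A|, |B|, |C|) ∈ S` -/
  | h3 {L : Type} (hL : Finite L) (proj : L → α) (w w' : Fin n → List L)
      (hw : IsGaussPhrase w) (hw' : IsGaussPhrase w')
      (A B C : L) (x y z t : List (Option L))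
      (hS : (proj A, proj B, proj C) ∈ D.S)
      (h : flatPhrase w =
        x ++ [some A, some B] ++ y ++ [some A, some C] ++ z ++ [some B, some C] ++ t)
      (h' : flatPhrase w' =
        x ++ [some B, some A] ++ y ++ [some C, some A] ++ z ++ [some C, some B] ++ t) :
      MMove D ⟨L, hL, proj, w, hw⟩ ⟨L, hL, proj, w', hw'⟩
  /-- The `i`th component `Ax` becomes `xA`; `|A|` becomes `ν(|A|)` if `A` occurs in `x`, and
  nothing else changes. (On a component with a single letter this is the identity.) -/
  | shift {L : Type} (hL : Finite L) (proj proj' : L → α) (w w' : Fin n → List L)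
      (hw : IsGaussPhrase w) (hw' : IsGaussPhrase w')
      (i : Fin n) (A : L) (x : List L)
      (h : w i = A :: x) (h' : w' i = x ++ [A]) (hne : ∀ j, j ≠ i → w' j = w j)
      (hA : A ∈ x → proj' A = D.nu (proj A)) (hA' : A ∉ x → proj' A = proj A)
      (hproj : ∀ B, B ≠ A → proj' B = proj B) :
      MMove D ⟨L, hL, proj, w, hw⟩ ⟨L, hL, proj', w', hw'⟩
  /-- The letter `A` occurs twice in the `k`th component, and `|A|` becomes `σ(|A|)`. -/
  | selfCrossing {L : Type} (hL : Finite L) (proj proj' : L → α) (w : Fin n → List L)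
      (hw : IsGaussPhrase w)
      (k : Fin n) (A : L) (x y z : List L)
      (h : w k = x ++ [A] ++ y ++ [A] ++ z)
      (hA : proj' A = D.sigma (proj A)) (hproj : ∀ B, B ≠ A → proj' B = proj B) :
      MMove D ⟨L, hL, proj, w, hw⟩ ⟨L, hL, proj', w, hw⟩

/-- `M`-homotopy of nanophrases. -/
def MHomotopic {α : Type} (D : MHomotopyData α) {n : ℕ} (p q : Nanophrase α n) : Prop :=
  Relation.EqvGen (MMove D) p q

/-! ### The homotopy data of virtual links -/

/-- `α_v = {a₊, a₋, b₊, b₋}` -/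
inductive AlphaV : Type
  | aPlus | aMinus | bPlus | bMinus

namespace AlphaV

/-- `τ_v : a₊ ↔ b₋, a₋ ↔ b₊` -/
def tau : AlphaV → AlphaV
  | aPlus => bMinus
  | bMinus => aPlus
  | aMinus => bPlus
  | bPlus => aMinus

/-- `ν_v : a₊ ↔ b₊, a₋ ↔ b₋` -/
def nu : AlphaV → AlphaV
  | aPlus => bPlus
  | bPlus => aPlus
  | aMinus => bMinus
  | bMinus => aMinus

/-- `σ_v : a₊ ↔ a₋, b₊ ↔ b₋` -/
def sigma : AlphaV → AlphaV
  | aPlus => aMinus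
  | aMinus => aPlus
  | bPlus => bMinus
  | bMinus => bPlus

/-- The set `S_v`. -/
def S : Set (AlphaV × AlphaV × AlphaV) :=
  {(aPlus, aPlus, aPlus), (aPlus, aPlus, aMinus), (aPlus, aMinus, aMinus),
   (aMinus, aMinus, aMinus), (aMinus, aMinus, aPlus), (aMinus, aPlus, aPlus),
   (bPlus, bPlus, bPlus), (bPlus, bPlus, bMinus), (bPlus, bMinus, bMinus),
   (bMinus, bMinus, bMinus), (bMinus, bMinus, bPlus), (bMinus, bPlus, bPlus)}

end AlphaV

/-- `(α_v, τ_v, S_v)` with `ν_v` and `σ_v`. -/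
def virtualData : MHomotopyData AlphaV where
  tau := AlphaV.tau
  tau_invol := fun a => by cases a <;> rfl
  S := AlphaV.S
  nu := AlphaV.nu
  nu_invol := fun a => by cases a <;> rfl
  sigma := AlphaV.sigma
  sigma_invol := fun a => by cases a <;> rfl

/-! ### The numbers `μ` and the residue classes `μ̄` -/

namespace Nanophrase

section Components

variable {α : Type} {n : ℕ} (p : Nanophrase α n)

/-- The components in which the letter `A` occurs. -/
noncomputable def comps (A : p.Letter) : Finset (Fin n) :=
  open Classical in Finset.univ.filter fun i => A ∈ p.word i

theorem comps_nonempty (A : p.Letter) : (p.comps A).Nonempty := by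
  classical
  have h := p.gauss A
  have hm : A ∈ (List.ofFn p.word).flatten := by
    rw [← List.count_pos_iff, h]; norm_num
  rw [List.mem_flatten] at hm
  obtain ⟨l, hl, hA⟩ := hm
  rw [List.mem_ofFn] at hl
  obtain ⟨i, rfl⟩ := hl
  exact ⟨i, by simp [comps, hA]⟩

/-- The component in which the first `A` of the phrase occurs. -/
noncomputable def firstComp (A : p.Letter) : Fin n := (p.comps A).min' (p.comps_nonempty A)

/-- The component in which the second `A` of the phrase occurs. -/
noncomputable def secondComp (A : p.Letter) : Fin n := (p.comps A).max' (p.comps_nonempty A)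

end Components

variable {n : ℕ} (p : Nanophrase AlphaV n)

/-- The sign of the letter `A` of the `i`th component, as a list: `[(A, true)]` is `A`,
`[(A, false)]` is `A⁻¹`, and `[]` is `A⁰ = ∅`. If `A` occurs in the `i`th component and in the `k`th
component, `k ≠ i`, then the other occurrence of `A` is the one in the `k`th component. -/
noncomputable def signedLetter (i : Fin n) (A : p.Letter) : List (p.Letter × Bool) :=
  open Classical in
  if ((∃ k, i < k ∧ A ∈ p.word k) ∧ p.proj A = AlphaV.bPlus) ∨
      ((∃ k, k < i ∧ A ∈ p.word k) ∧ p.proj A = AlphaV.aPlus) then [(A, true)]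
  else if ((∃ k, i < k ∧ A ∈ p.word k) ∧ p.proj A = AlphaV.aMinus) ∨
      ((∃ k, k < i ∧ A ∈ p.word k) ∧ p.proj A = AlphaV.bMinus) then [(A, false)]
  else []

/-- The signed `i`th component `w_i^ε`, a word on the letters and their formal inverses. -/
noncomputable def signedWord (i : Fin n) : List (p.Letter × Bool) :=
  (p.word i).flatMap (p.signedLetter i)

/-- The index `k` with `η(A) = a_k`: the component of the second `A` if `|A|` is `b₊` or `a₋`, the
component of the first `A` if `|A|` is `a₊` or `b₋`. -/
noncomputable def etaIndex (A : p.Letter) : Fin n :=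
  match p.proj A with
  | AlphaV.bPlus => p.secondComp A
  | AlphaV.aMinus => p.secondComp A
  | AlphaV.aPlus => p.firstComp A
  | AlphaV.bMinus => p.firstComp A

/-- The signed word obtained by truncating `w_k^ε` at the letter `A`, where `η(A) = a_k`. For a
letter that appears in a signed component, the `k`th component contains the other occurrence (the
one with sign `0`), and `A` occurs only once in it. -/
noncomputable def truncWord (A : p.Letter) : List (p.Letter × Bool) :=
  open Classical in
  ((p.word (p.etaIndex A)).takeWhile fun B => decide (B ≠ A)).flatMap
    (p.signedLetter (p.etaIndex A))

/-- `p.rho d` is the map `ρ^{d+2}` on words on the letters and their formal inverses: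
`ρ²(A^±) = A^±` and `ρ^{q}(A^±) = ρ^{q-1}(x⁻¹) A^± ρ^{q-1}(x)` with `x = p.truncWord A`. Here
`FreeGroup.invRev` is the formal inverse of a word; nothing is cancelled. -/
noncomputable def rho : ℕ → List (p.Letter × Bool) → List (p.Letter × Bool)
  | 0, l => l
  | d + 1, l => l.flatMap fun a =>
      rho d (FreeGroup.invRev (p.truncWord a.1)) ++ [a] ++ rho d (p.truncWord a.1)

/-- `η`, from words on the letters and their inverses to words on `a_1, …, a_n` and their
inverses. -/
noncomputable def eta (l : List (p.Letter × Bool)) : List (Fin n × Bool) :=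
  l.map fun a => (p.etaIndex a.1, a.2)

end Nanophrase

/-- `φ`, with `φ(a_h) = 1 + κ_h` and `φ(a_h⁻¹) = 1 - κ_h + κ_h² - ⋯`. -/
noncomputable def magnusPhi {n : ℕ} (l : List (Fin n × Bool)) : NCSeries (Fin n) :=
  (l.map fun a => if a.2 then 1 + NCSeries.X a.1 else NCSeries.altGeom a.1).prod

namespace Nanophrase

variable {n : ℕ} (p : Nanophrase AlphaV n)

/-- `μ(p; c₁, …, c_u, i)`, the limit for `q → ∞` of the coefficient of `κ_{c₁} ⋯ κ_{c_u}` in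
`φ(η(ρ^q(w_i^ε)))`. -/
noncomputable def mu (c : List (Fin n)) (i : Fin n) : ℤ :=
  limUnder atTop fun d : ℕ => (magnusPhi (p.eta (p.rho d (p.signedWord i)))).coeff c

/-- `μ(p; d₁, …, d_t)` for a sequence whose last term plays the role of `i`. -/
noncomputable def muSeq (d : List (Fin n)) : ℤ :=
  match d.getLast? with
  | some i => p.mu d.dropLast i
  | none => 0

/-- The sequences of at least two terms that are obtained from `s` by eliminating at least one term
and permuting the remaining ones cyclically. -/
def lowerSeqs (s : List (Fin n)) : Finset (List (Fin n)) :=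
  (s.sublists.toFinset.filter fun d => 2 ≤ d.length ∧ d.length < s.length).biUnion
    fun d => d.cyclicPermutations.toFinset

/-- `Δ(p; c₁, …, c_u, i)`; it is `0` for `u = 1`, as the greatest common divisor of no numbers. -/
noncomputable def Delta (c : List (Fin n)) (i : Fin n) : ℕ :=
  ((lowerSeqs (c ++ [i])).gcd p.muSeq).natAbs

/-- `μ̄(p; c₁, …, c_u, i)`: the residue class of `μ` modulo `Δ`, together with its modulus (two
values are equal iff the moduli agree and the classes agree). -/
noncomputable def muBar (c : List (Fin n)) (i : Fin n) : Σ m : ℕ, ZMod m :=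
  ⟨p.Delta c i, (p.mu c i : ZMod (p.Delta c i))⟩

end Nanophrase

namespace NCSeries

variable {σ : Type*}

theorem coeff_neg (f : NCSeries σ) (c : List σ) : (-f).coeff c = -f.coeff c := rfl
theorem coeff_sub (f g : NCSeries σ) (c : List σ) :
    (f - g).coeff c = f.coeff c - g.coeff c := rfl
theorem coeff_shift (a : σ) (f : NCSeries σ) (c : List σ) :
    (shift a f).coeff c = f.coeff (a :: c) := rfl
theorem coeff_X (h : σ) (c : List σ) :
    (X h).coeff c = open Classical in if c = [h] then 1 else 0 := rfl
theorem coeff_altGeom (h : σ) (c : List σ) :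
    (altGeom h).coeff c = open Classical in if ∀ a ∈ c, a = h then (-1) ^ c.length else 0 := rfl

theorem coeff_X_mul (h : σ) (g : NCSeries σ) (a : σ) (c : List σ) :
    (X h * g).coeff (a :: c) = open Classical in if a = h then g.coeff c else 0 := by
  classical
  have e : shift a (X h) = if a = h then 1 else 0 := by
    ext c
    by_cases hah : a = h <;> simp [coeff_shift, coeff_X, hah, coeff_one, coeff_zero]
  rw [coeff_mul_cons, e]
  by_cases hah : a = h <;> simp [hah, coeff_X, coeff_zero]

theorem altGeom_nil (h : σ) : (altGeom h).coeff [] = 1 := by simp [coeff_altGeom]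

theorem shift_altGeom (h a : σ) :
    shift a (altGeom h) = open Classical in if a = h then -altGeom h else 0 := by
  classical
  ext c
  by_cases hah : a = h
  · by_cases hc : ∀ b ∈ c, b = h
    · simp [coeff_shift, coeff_neg, coeff_altGeom, hah, pow_succ, if_pos hc]
    · simp [coeff_shift, coeff_neg, coeff_altGeom, hah, if_neg hc]
  · simp [coeff_shift, coeff_altGeom, coeff_zero, hah]

theorem one_add_X_mul_altGeom (h : σ) : (1 + X h) * altGeom h = 1 := by
  classical
  ext c
  rw [add_mul, one_mul, coeff_add]
  cases c with
  | nil => simp [coeff_mul_nil, altGeom_nil, coeff_X, coeff_one]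
  | cons a c =>
    rw [coeff_X_mul, ← coeff_shift, shift_altGeom]
    by_cases hah : a = h <;> simp [hah, coeff_one, coeff_neg, coeff_zero]

theorem altGeom_mul_one_add_X (h : σ) : altGeom h * (1 + X h) = 1 := by
  classical
  ext c
  induction c with
  | nil => simp [coeff_mul_nil, altGeom_nil, coeff_add, coeff_X, coeff_one]
  | cons a c ih =>
    rw [coeff_mul_cons, altGeom_nil, shift_altGeom, coeff_add]
    by_cases hah : a = h
    · rw [if_pos hah, neg_mul, coeff_neg, ih]
      cases c <;> simp [coeff_one, coeff_X, hah]
    · simp [hah, coeff_one, coeff_zero, coeff_X]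

/-- `f` and `g` have the same coefficients up to degree `d`. -/
def AgreeUpTo (d : ℕ) (f g : NCSeries σ) : Prop := ∀ c : List σ, c.length ≤ d → f.coeff c = g.coeff c

theorem AgreeUpTo.mul {d : ℕ} {f f' g g' : NCSeries σ} (hf : AgreeUpTo d f f')
    (hg : AgreeUpTo d g g') : AgreeUpTo d (f * g) (f' * g') := by
  intro c hc
  rw [coeff_mul, coeff_mul]
  refine Finset.sum_congr rfl fun k _ => ?_
  rw [hf _ (by simp; omega), hg _ (by simp; omega)]

theorem AgreeUpTo.conj {d : ℕ} {f f' g g' y : NCSeries σ} (hf : AgreeUpTo d f f')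
    (hg : AgreeUpTo d g g') (hy : y.coeff [] = 0) :
    AgreeUpTo (d + 1) (f * y * g) (f' * y * g') := by
  have h1 : AgreeUpTo (d + 1) (f * y) (f' * y) := by
    intro c hc
    rw [coeff_mul, coeff_mul]
    refine Finset.sum_congr rfl fun k hk => ?_
    rw [Finset.mem_range] at hk
    by_cases hkc : k = c.length
    · simp [hkc, hy]
    · rw [hf _ (by simp; omega)]
  have h0 : (f * y).coeff [] = 0 := by rw [coeff_mul_nil, hy, mul_zero]
  have h0' : (f' * y).coeff [] = 0 := by rw [coeff_mul_nil, hy, mul_zero]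
  intro c hc
  rw [coeff_mul, coeff_mul]
  refine Finset.sum_congr rfl fun k hk => ?_
  rcases Nat.eq_zero_or_pos k with rfl | hk0
  · simp [h0, h0']
  · rw [h1 _ (by simp; omega), hg _ (by simp; omega)]

end NCSeries

theorem magnusPhi_append {n : ℕ} (l m : List (Fin n × Bool)) :
    magnusPhi (l ++ m) = magnusPhi l * magnusPhi m := by
  simp [magnusPhi]

theorem magnusPhi_invRev {n : ℕ} (l : List (Fin n × Bool)) :
    magnusPhi (FreeGroup.invRev l) * magnusPhi l = 1 := by
  induction l with
  | nil => simp [magnusPhi, FreeGroup.invRev]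
  | cons a l ih =>
    have e : FreeGroup.invRev (a :: l) = FreeGroup.invRev l ++ [(a.1, !a.2)] := by
      simp [FreeGroup.invRev]
    have e2 : magnusPhi [(a.1, !a.2)] * magnusPhi [a] = 1 := by
      obtain ⟨h, b⟩ := a
      cases b
      · simpa [magnusPhi] using NCSeries.one_add_X_mul_altGeom h
      · simpa [magnusPhi] using NCSeries.altGeom_mul_one_add_X h
    have e3 : magnusPhi (a :: l) = magnusPhi [a] * magnusPhi l := magnusPhi_append [a] l
    rw [e, e3, magnusPhi_append, mul_assoc, ← mul_assoc (magnusPhi [(a.1, !a.2)]), e2, one_mul, ih]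

namespace Nanophrase

variable {n : ℕ} (p : Nanophrase AlphaV n)

theorem rho_append (d : ℕ) (l m : List (p.Letter × Bool)) :
    p.rho d (l ++ m) = p.rho d l ++ p.rho d m := by
  cases d <;> simp [rho]

theorem rho_nil (d : ℕ) : p.rho d [] = [] := by cases d <;> simp [rho]

theorem invRev_append' {L : Type*} (l m : List (L × Bool)) :
    FreeGroup.invRev (l ++ m) = FreeGroup.invRev m ++ FreeGroup.invRev l := by
  simp [FreeGroup.invRev]

theorem rho_invRev (d : ℕ) (l : List (p.Letter × Bool)) :
    p.rho d (FreeGroup.invRev l) = FreeGroup.invRev (p.rho d l) := by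
  induction d generalizing l with
  | zero => rfl
  | succ d ih =>
    induction l with
    | nil => simp [FreeGroup.invRev, rho]
    | cons a l ihl =>
      have e : a :: l = [a] ++ l := rfl
      rw [e, invRev_append', rho_append, ihl, rho_append, invRev_append']
      congr 1
      have : FreeGroup.invRev [a] = [(a.1, !a.2)] := by simp [FreeGroup.invRev]
      simp only [this, rho, List.flatMap_cons, List.flatMap_nil, List.append_nil, invRev_append',
        ih, FreeGroup.invRev_invRev, List.append_assoc]

theorem eta_append (l m : List (p.Letter × Bool)) : p.eta (l ++ m) = p.eta l ++ p.eta m := by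
  simp [eta]

theorem eta_invRev (l : List (p.Letter × Bool)) :
    p.eta (FreeGroup.invRev l) = FreeGroup.invRev (p.eta l) := by
  simp [eta, FreeGroup.invRev, Function.comp_def]

/-- The expansion given by `rho d` agrees with the next one up to degree `d`. -/
theorem expansion_agree (d : ℕ) (l : List (p.Letter × Bool)) :
    NCSeries.AgreeUpTo d (magnusPhi (p.eta (p.rho d l)))
      (magnusPhi (p.eta (p.rho (d + 1) l))) := by
  have hone : ∀ l : List (Fin n × Bool), (magnusPhi l).coeff [] = 1 := by
    intro l
    induction l with
    | nil => simp [magnusPhi, NCSeries.coeff_one]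
    | cons a l ih =>
      have e3 : magnusPhi (a :: l) = magnusPhi [a] * magnusPhi l := magnusPhi_append [a] l
      rw [e3, NCSeries.coeff_mul_nil, ih, mul_one]
      obtain ⟨h, b⟩ := a
      cases b
      · simpa [magnusPhi] using NCSeries.altGeom_nil h
      · simp [magnusPhi, NCSeries.coeff_add, NCSeries.coeff_one, NCSeries.coeff_X]
  induction d generalizing l with
  | zero =>
    intro c hc
    have : c = [] := List.length_eq_zero_iff.mp (by omega)
    rw [this, hone, hone]
  | succ d ih =>
    induction l with
    | nil => intro c _; simp [rho_nil]
    | cons a l ihl =>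
      have e : a :: l = [a] ++ l := rfl
      rw [e, rho_append, rho_append, eta_append, eta_append, magnusPhi_append, magnusPhi_append]
      refine NCSeries.AgreeUpTo.mul ?_ ihl
      have key : ∀ m : ℕ, magnusPhi (p.eta (p.rho (m + 1) [a])) =
          1 + magnusPhi (p.eta (p.rho m (FreeGroup.invRev (p.truncWord a.1)))) *
            (magnusPhi (p.eta [a]) - 1) * magnusPhi (p.eta (p.rho m (p.truncWord a.1))) := by
        intro m
        have h := magnusPhi_invRev (p.eta (p.rho m (p.truncWord a.1)))
        rw [← eta_invRev, ← rho_invRev] at h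
        simp only [rho, List.flatMap_cons, List.flatMap_nil, List.append_nil, eta_append,
          magnusPhi_append]
        rw [mul_sub, sub_mul, mul_one, h]
        abel
      rw [key, key]
      have hc := NCSeries.AgreeUpTo.conj (y := magnusPhi (p.eta [a]) - 1)
        (ih (FreeGroup.invRev (p.truncWord a.1))) (ih (p.truncWord a.1))
        (by rw [NCSeries.coeff_sub, hone, NCSeries.coeff_one]; simp)
      intro c hcl
      rw [NCSeries.coeff_add, NCSeries.coeff_add, hc c hcl]

/-- The sequence that defines `μ` is constant from the index `u` on. -/
theorem mu_eq (c : List (Fin n)) (i : Fin n) {d : ℕ} (hd : c.length ≤ d) :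
    (magnusPhi (p.eta (p.rho d (p.signedWord i)))).coeff c = p.mu c i := by
  have hc : ∀ e : ℕ, c.length ≤ e →
      (magnusPhi (p.eta (p.rho e (p.signedWord i)))).coeff c =
        (magnusPhi (p.eta (p.rho c.length (p.signedWord i)))).coeff c := by
    intro e he
    induction e, he using Nat.le_induction with
    | base => rfl
    | succ e he ih => rw [← ih, p.expansion_agree e (p.signedWord i) c he]
  have ht : Tendsto (fun e : ℕ => (magnusPhi (p.eta (p.rho e (p.signedWord i)))).coeff c) atTop
      (𝓝 ((magnusPhi (p.eta (p.rho c.length (p.signedWord i)))).coeff c)) :=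
    tendsto_const_nhds.congr' (by
      filter_upwards [eventually_ge_atTop c.length] with e he
      exact (hc e he).symm)
  rw [hc d hd, mu, ht.limUnder_eq]

end Nanophrase

/-! The argument follows Milnor's treatment of link homotopy, with a quotient of the unit group of
the power series ring in the role of the link group. Letters with both occurrences in one component
carry no sign and are discarded. Every other letter `D` receives a value `E D` in a group `G`. The
product of the signed values along a component is its partial longitude. Where `D` occurs with sign
zero in component `k`, its value must be the meridian `m k` conjugated by the partial longitude, and
the complete longitude must be `lam k` modulo a normal subgroup `N k`. This is `Nanophrase.Solves`.
If `N k` is abelian and contains `m k`, partial longitudes matter only modulo `N k`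
(`conj_eq_of_cong`). This freedom absorbs what happens when an H3 move involves a discarded letter.
If moreover `m k` commutes with `lam k`, every move carries a solution to a solution, at the cost of
conjugating one meridian and its longitude by the same element (`Nanophrase.Solves.of_mMove`).

For the sequence `s = c ++ [i]` let `W` consist of the cyclic permutations of the proper
subsequences of `s`, and let `M` divide all lower numbers μ of `p`. The group `G` is the group of
units modulo those congruent to 1 modulo `M` on `W`. The subgroup `N k` is given by congruence to 1
on the monomials of `W` without κ_k. It is abelian because the indices are distinct: a product of
two terms containing κ_k never lies in `W`. The meridian is 1 + κ_k and the longitude λ_k is the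
expansion of the signed word of `p`. They commute in `G` because the coefficients of (λ_k − 1)κ_k
and of κ_k(λ_k − 1) on `W` are, up to a cyclic permutation, lower numbers of `p`
(`meridian_longitude_comm`). This is where the cyclic permutations in Δ are needed.

The words ρ^q of `p` give a solution in `G`, and a move turns it into a solution for `q`. Any
solution is determined by its meridians: a conjugate of a meridian depends on the conjugating
element only up to one degree less, so iteration recovers the words ρ^q (`Solves.approx`). Hence the
conjugated longitude of `p` agrees, away from κ_i, with the signed word of `q` evaluated at
conjugates of the 1 + κ_h. Since the lower coefficients vanish modulo `M`, neither conjugating the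
longitude (`coeff_conj_unit`) nor substituting conjugated meridians (`coeff_eq_of_wordVal`) affects
the coefficient at `c`. So the two numbers μ agree modulo `M` (`mu_of_mMove`). Induction on the
length gives the equality of the moduli Δ. It uses each move in one direction only. -/

/-! ### Crossing sequences with values in a group -/

/-- The symbols of a phrase from which the letters with both occurrences in one component have been
removed: the bar that ends a component, the occurrence of sign zero of a letter, and its occurrence
of non-zero sign. -/
inductive Crossing (L : Type) : Type
  | bar
  | above (D : L)
  | below (D : L) (b : Bool)

namespace Crossing

/-- The letters of a symbol. -/
def letters {L : Type} : Crossing L → List L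
  | bar => []
  | above D => [D]
  | below D _ => [D]

/-- Renaming of letters. -/
def map {L L' : Type} (f : L → L') : Crossing L → Crossing L'
  | bar => bar
  | above D => above (f D)
  | below D b => below (f D) b

end Crossing

/-- `g` or `g⁻¹`, according to a sign. -/
def signPow {G : Type*} [Group G] (g : G) (b : Bool) : G := if b then g else g⁻¹

section Group

variable {G : Type*} [Group G] {L : Type}

@[simp] theorem signPow_true (g : G) : signPow g true = g := rfl
@[simp] theorem signPow_false (g : G) : signPow g false = g⁻¹ := rfl

theorem signPow_mem {N : Subgroup G} {g : G} (h : g ∈ N) (b : Bool) : signPow g b ∈ N := by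
  cases b
  · exact N.inv_mem h
  · exact h

/-- Reading a symbol: the index of the current component and the product of the values of the
signed letters read so far in this component. -/
def crossingStep (E : L → G) (s : ℕ × G) : Crossing L → ℕ × G
  | .bar => (s.1 + 1, 1)
  | .above _ => s
  | .below D b => (s.1, s.2 * signPow (E D) b)

/-- Reading a sequence of symbols. -/
def crossingRun (E : L → G) : ℕ × G → List (Crossing L) → ℕ × G
  | s, [] => s
  | s, t :: l => crossingRun E (crossingStep E s t) l

/-- The condition on the values `E` at one symbol: at an over-occurrence in the `k`th component
the value of the letter is the conjugate of the meridian `m k` by the partial longitude, and at the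
end of the `k`th component the longitude is `lam k` modulo `N k`. -/
def CrossingOkAt (N : ℕ → Subgroup G) (m lam : ℕ → G) (E : L → G) (s : ℕ × G) :
    Crossing L → Prop
  | .bar => s.2⁻¹ * lam s.1 ∈ N s.1
  | .above D => E D = s.2⁻¹ * m s.1 * s.2
  | .below _ _ => True

/-- The values `E` of the letters satisfy the condition at all symbols of a sequence. -/
def CrossingOk (N : ℕ → Subgroup G) (m lam : ℕ → G) (E : L → G) :
    ℕ × G → List (Crossing L) → Prop
  | _, [] => True
  | s, t :: l => CrossingOkAt N m lam E s t ∧ CrossingOk N m lam E (crossingStep E s t) l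

/-- Two states of the reading agree modulo the subgroup of the current component. -/
def StateCong (N : ℕ → Subgroup G) (s s' : ℕ × G) : Prop :=
  s'.1 = s.1 ∧ s.2⁻¹ * s'.2 ∈ N s.1

/-- The number of bars. -/
def barCount : List (Crossing L) → ℕ
  | [] => 0
  | .bar :: l => barCount l + 1
  | .above _ :: l => barCount l
  | .below _ _ :: l => barCount l

theorem crossingRun_append (E : L → G) (s : ℕ × G) (x y : List (Crossing L)) :
    crossingRun E s (x ++ y) = crossingRun E (crossingRun E s x) y := by
  induction x generalizing s with
  | nil => rfl
  | cons t x ih => exact ih _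

theorem crossingRun_fst (E : L → G) (s : ℕ × G) (x : List (Crossing L)) :
    (crossingRun E s x).1 = s.1 + barCount x := by
  induction x generalizing s with
  | nil => rfl
  | cons t x ih =>
    rw [crossingRun, ih]
    cases t <;> (simp [crossingStep, barCount]; try omega)

theorem barCount_append (x y : List (Crossing L)) :
    barCount (x ++ y) = barCount x + barCount y := by
  induction x with
  | nil => simp [barCount]
  | cons t x ih => cases t <;> (simp [barCount, ih]; try omega)

theorem crossingOk_append {N : ℕ → Subgroup G} {m lam : ℕ → G} {E : L → G} {s : ℕ × G}
    {x y : List (Crossing L)} :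
    CrossingOk N m lam E s (x ++ y) ↔
      CrossingOk N m lam E s x ∧ CrossingOk N m lam E (crossingRun E s x) y := by
  induction x generalizing s with
  | nil => simp [CrossingOk, crossingRun]
  | cons t x ih => simp [CrossingOk, crossingRun, ih, and_assoc]

theorem crossingOk_map {L' : Type} {N : ℕ → Subgroup G} {m lam : ℕ → G} {E : L → G} (f : L' → L)
    {s : ℕ × G} {x : List (Crossing L')} :
    CrossingOk N m lam E s (x.map (Crossing.map f)) ↔ CrossingOk N m lam (E ∘ f) s x := by
  induction x generalizing s with
  | nil => rfl
  | cons t x ih =>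
    rw [List.map_cons, CrossingOk, CrossingOk, ih]
    cases t <;> rfl

theorem StateCong.refl (N : ℕ → Subgroup G) (s : ℕ × G) : StateCong N s s :=
  ⟨rfl, by simp⟩

theorem StateCong.trans {N : ℕ → Subgroup G} {s s' s'' : ℕ × G} (h : StateCong N s s') (h' : StateCong N s' s'') :
    StateCong N s s'' := by
  refine ⟨h'.1.trans h.1, ?_⟩
  have h2 := h'.2
  rw [h.1] at h2
  simpa [mul_assoc] using (N s.1).mul_mem h.2 h2

/-- Conjugates of an element of a normal commutative subgroup by congruent elements are equal. -/
theorem conj_eq_of_cong {N : Subgroup G} [hN : N.Normal] (hc : ∀ a ∈ N, ∀ b ∈ N, a * b = b * a)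
    {m g h : G} (hm : m ∈ N) (hgh : g⁻¹ * h ∈ N) : g⁻¹ * m * g = h⁻¹ * m * h := by
  have h1 : g⁻¹ * m * g ∈ N := by simpa using hN.conj_mem m hm g⁻¹
  have h2 := hc _ h1 _ hgh
  have : h⁻¹ * m * h = (g⁻¹ * h)⁻¹ * ((g⁻¹ * m * g) * (g⁻¹ * h)) := by group
  rw [this, h2]; group

variable {N : ℕ → Subgroup G} [∀ j, (N j).Normal] {m lam : ℕ → G}

/-- If the values of the letters that occur are kept, the conditions hold from a congruent
state on. -/
theorem CrossingOk.transport (hc : ∀ j, ∀ a ∈ N j, ∀ b ∈ N j, a * b = b * a)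
    (hm : ∀ j, m j ∈ N j) {E E' : L → G} {s s' : ℕ × G} {x : List (Crossing L)}
    (hE : ∀ t ∈ x, ∀ D ∈ t.letters, E' D = E D) (hs : StateCong N s s')
    (h : CrossingOk N m lam E s x) :
    CrossingOk N m lam E' s' x ∧ StateCong N (crossingRun E s x) (crossingRun E' s' x) := by
  induction x generalizing s s' with
  | nil => exact ⟨trivial, hs⟩
  | cons t x ih =>
    obtain ⟨k, g⟩ := s
    obtain ⟨k', g'⟩ := s'
    obtain ⟨hk, hg⟩ := hs
    simp only at hk hg
    subst hk
    have hEx : ∀ u ∈ x, ∀ D ∈ u.letters, E' D = E D := fun u hu => hE u (by simp [hu])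
    obtain ⟨h1, h2⟩ := h
    cases t with
    | bar =>
      obtain ⟨h3, h4⟩ := ih (s := (k' + 1, 1)) (s' := (k' + 1, 1)) hEx (StateCong.refl N _) h2
      refine ⟨⟨?_, h3⟩, h4⟩
      change g'⁻¹ * lam k' ∈ N k'
      have h5 : g⁻¹ * lam k' ∈ N k' := h1
      simpa [mul_assoc] using (N k').mul_mem ((N k').inv_mem hg) h5
    | above D =>
      obtain ⟨h3, h4⟩ := ih (s := (k', g)) (s' := (k', g')) hEx ⟨rfl, hg⟩ h2
      refine ⟨⟨?_, h3⟩, h4⟩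
      have h5 : E D = g⁻¹ * m k' * g := h1
      change E' D = g'⁻¹ * m k' * g'
      rw [hE (.above D) (by simp) D (by simp [Crossing.letters]), h5]
      exact conj_eq_of_cong (hc k') (hm k') hg
    | below D b =>
      have hD := hE (.below D b) (by simp) D (by simp [Crossing.letters])
      -- Both partial longitudes gain the same factor on the right, which conjugates their quotient;
      -- `N k'` is normal.
      obtain ⟨h3, h4⟩ := ih (s := (k', g * signPow (E D) b)) (s' := (k', g' * signPow (E' D) b)) hEx
        ⟨rfl, by
          rw [hD]
          have := (inferInstance : (N k').Normal).conj_mem _ hg (signPow (E D) b)⁻¹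
          simpa [mul_assoc] using this⟩ h2
      exact ⟨⟨trivial, h3⟩, h4⟩

/-- Replacement of three segments of a sequence of symbols. -/
theorem CrossingOk.replace (hc : ∀ j, ∀ a ∈ N j, ∀ b ∈ N j, a * b = b * a)
    (hm : ∀ j, m j ∈ N j) {E E' : L → G} {s : ℕ × G} {X P Y Q Z R T P' Q' R' : List (Crossing L)}
    (hX : ∀ t ∈ X, ∀ D ∈ t.letters, E' D = E D) (hY : ∀ t ∈ Y, ∀ D ∈ t.letters, E' D = E D)
    (hZ : ∀ t ∈ Z, ∀ D ∈ t.letters, E' D = E D) (hT : ∀ t ∈ T, ∀ D ∈ t.letters, E' D = E D)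
    (h : CrossingOk N m lam E s (X ++ P ++ Y ++ Q ++ Z ++ R ++ T))
    (H : ∀ s₁ s₂ s₃ : ℕ × G, s₁.1 = s.1 + barCount X → s₂.1 = s₁.1 + barCount (P ++ Y) →
      s₃.1 = s₂.1 + barCount (Q ++ Z) →
      CrossingOk N m lam E s₁ P → CrossingOk N m lam E s₂ Q → CrossingOk N m lam E s₃ R →
      (CrossingOk N m lam E' s₁ P' ∧
        StateCong N (crossingRun E s₁ P) (crossingRun E' s₁ P')) ∧
      (CrossingOk N m lam E' s₂ Q' ∧
        StateCong N (crossingRun E s₂ Q) (crossingRun E' s₂ Q')) ∧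
      (CrossingOk N m lam E' s₃ R' ∧
        StateCong N (crossingRun E s₃ R) (crossingRun E' s₃ R'))) :
    CrossingOk N m lam E' s (X ++ P' ++ Y ++ Q' ++ Z ++ R' ++ T) := by
  simp only [crossingOk_append, crossingRun_append, and_assoc] at h ⊢
  obtain ⟨h1, h2, h3, h4, h5, h6, h7⟩ := h
  obtain ⟨⟨H1, H1'⟩, ⟨H2, H2'⟩, ⟨H3, H3'⟩⟩ := H _ _ _ (crossingRun_fst E s X)
    (by rw [crossingRun_fst, crossingRun_fst, barCount_append]; omega)
    (by rw [crossingRun_fst, crossingRun_fst, barCount_append]; omega) h2 h4 h6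
  obtain ⟨a1, b1⟩ := h1.transport hc hm hX (StateCong.refl N s)
  obtain ⟨a2, b2⟩ := H1.transport hc hm (fun _ _ _ _ => rfl) b1
  obtain ⟨a3, b3⟩ := h3.transport hc hm hY (H1'.trans b2)
  obtain ⟨a4, b4⟩ := H2.transport hc hm (fun _ _ _ _ => rfl) b3
  obtain ⟨a5, b5⟩ := h5.transport hc hm hZ (H2'.trans b4)
  obtain ⟨a6, b6⟩ := H3.transport hc hm (fun _ _ _ _ => rfl) b5
  obtain ⟨a7, b7⟩ := h7.transport hc hm hT (H3'.trans b6)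
  exact ⟨a1, a2, a3, a4, a5, a6, a7⟩

end Group

/-- A letter does not occur in a sequence of symbols. -/
def Absent {L : Type} (A : L) (x : List (Crossing L)) : Prop := ∀ t ∈ x, A ∉ t.letters

theorem Absent.update {L : Type} [DecidableEq L] {A : L} {x : List (Crossing L)} (h : Absent A x)
    {G : Type*} (E : L → G) (g : G) : ∀ t ∈ x, ∀ D ∈ t.letters, Function.update E A g D = E D := by
  intro t ht D hD
  refine Function.update_of_ne ?_ _ _
  rintro rfl
  exact h t ht hD

theorem mem_of_eq_one {G : Type*} [Group G] {N : Subgroup G} {x : G} (hx : x = 1) : x ∈ N :=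
  hx ▸ N.one_mem

/-! ### The moves H2 and H3 on crossing sequences -/

section Moves

variable {G : Type*} [Group G] {L : Type} {N : ℕ → Subgroup G} [∀ j, (N j).Normal] {m lam : ℕ → G}

/-- Cancellation of two signed letters with inverse signs whose other occurrences are adjacent. -/
theorem CrossingOk.cancel_below_above (hc : ∀ j, ∀ a ∈ N j, ∀ b ∈ N j, a * b = b * a)
    (hm : ∀ j, m j ∈ N j) {E : L → G} {s : ℕ × G} {X Y Z : List (Crossing L)} {A B : L} {b : Bool}
    (h : CrossingOk N m lam E s
      (X ++ [.below A b, .below B !b] ++ Y ++ [.above B, .above A] ++ Z)) :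
    CrossingOk N m lam E s (X ++ Y ++ Z) := by
  have key := CrossingOk.replace (X := X) (Y := Y) (Z := Z) (P := [.below A b, .below B !b])
    (Q := [.above B, .above A]) (lam := lam) (s := s)
    (E := E) (E' := E) (R := []) (T := []) (P' := []) (Q' := []) (R' := []) hc hm
    (by simp) (by simp) (by simp) (by simp) (by simpa using h) ?_
  · simpa using key
  rintro s₁ s₂ s₃ - - - - h2 -
  simp only [CrossingOk, CrossingOkAt, crossingRun, crossingStep, and_true] at h2 ⊢
  -- Adjacent occurrences of sign zero see the same partial longitude, so both values are the same
  -- conjugate of the meridian.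
  have hAB : E A = E B := h2.2.trans h2.1.symm
  refine ⟨⟨trivial, ?_⟩, ⟨trivial, StateCong.refl N _⟩, ⟨trivial, StateCong.refl N _⟩⟩
  convert StateCong.refl N s₁ using 1
  cases b <;> simp [hAB, mul_assoc]

/-- The mirror case: here the occurrences of sign zero come first in the phrase and force the two
values to be equal. -/
theorem CrossingOk.cancel_above_below (hc : ∀ j, ∀ a ∈ N j, ∀ b ∈ N j, a * b = b * a)
    (hm : ∀ j, m j ∈ N j) {E : L → G} {s : ℕ × G} {X Y Z : List (Crossing L)} {A B : L} {b : Bool}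
    (h : CrossingOk N m lam E s
      (X ++ [.above A, .above B] ++ Y ++ [.below B !b, .below A b] ++ Z)) :
    CrossingOk N m lam E s (X ++ Y ++ Z) := by
  have key := CrossingOk.replace (X := X) (Y := Y) (Z := Z) (P := [.above A, .above B])
    (Q := [.below B !b, .below A b]) (lam := lam) (s := s)
    (E := E) (E' := E) (R := []) (T := []) (P' := []) (Q' := []) (R' := []) hc hm
    (by simp) (by simp) (by simp) (by simp) (by simpa using h) ?_
  · simpa using key
  rintro s₁ s₂ s₃ - - - h1 - -
  simp only [CrossingOk, CrossingOkAt, crossingRun, crossingStep, and_true] at h1 ⊢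
  have hAB : E A = E B := h1.1.trans h1.2.symm
  refine ⟨⟨trivial, StateCong.refl N _⟩, ⟨trivial, ?_⟩, ⟨trivial, StateCong.refl N _⟩⟩
  convert StateCong.refl N s₂ using 1
  cases b <;> simp [hAB, mul_assoc]

theorem crossing_conj_mem (hm : ∀ j, m j ∈ N j) (k : ℕ) (g : G) : g⁻¹ * m k * g ∈ N k := by
  simpa using (inferInstance : (N k).Normal).conj_mem _ (hm k) g⁻¹

/-- A commutator with an element of a normal subgroup lies in that subgroup. Thus conjugating a
signed letter by an element of `N k` is invisible to the longitude of the `k`th component. -/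
theorem signPow_conj_cong {N : Subgroup G} [hN : N.Normal] {g a : G} (ha : a ∈ N) (b : Bool) :
    (signPow g b)⁻¹ * signPow (a⁻¹ * g * a) b ∈ N := by
  have h1 := hN.conj_mem _ (N.inv_mem ha)
  cases b
  · have := N.mul_mem (h1 g) ha
    simpa [mul_assoc] using this
  · have := N.mul_mem (h1 g⁻¹) ha
    simpa [mul_assoc] using this

theorem signPow_conj_cong' {N : Subgroup G} [hN : N.Normal] {g a : G} (ha : a ∈ N) (b : Bool) :
    (signPow g b)⁻¹ * signPow (a * g * a⁻¹) b ∈ N := by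
  simpa using signPow_conj_cong (N.inv_mem ha) b

/-- The first occurrence in the phrase of a letter; `f` tells that this is the signed one. -/
def firstOcc (β f : Bool) (D : L) : Crossing L := if f then .below D β else .above D

/-- The second occurrence in the phrase of a letter; `f` tells that the first one is signed. -/
def secondOcc (β f : Bool) (D : L) : Crossing L := if f then .above D else .below D !β

set_option linter.unusedSimpArgs false in
/-- The third move for letters that connect three distinct components. -/
theorem CrossingOk.triangle (hc : ∀ j, ∀ a ∈ N j, ∀ b ∈ N j, a * b = b * a)
    (hm : ∀ j, m j ∈ N j) {E : L → G} {s : ℕ × G} {X Y Z T : List (Crossing L)} {A B C : L}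
    {β a b c : Bool} (habc : a = b ∨ b = c) (hAB : A ≠ B) (hAC : A ≠ C) (hBC : B ≠ C)
    (hA : Absent A X ∧ Absent A Y ∧ Absent A Z ∧ Absent A T)
    (hB : Absent B X ∧ Absent B Y ∧ Absent B Z ∧ Absent B T)
    (hC : Absent C X ∧ Absent C Y ∧ Absent C Z ∧ Absent C T)
    (h : CrossingOk N m lam E s (X ++ [firstOcc β a A, firstOcc β b B] ++ Y ++
      [secondOcc β a A, firstOcc β c C] ++ Z ++ [secondOcc β b B, secondOcc β c C] ++ T)) :
    ∃ E' : L → G, CrossingOk N m lam E' s (X ++ [firstOcc β b B, firstOcc β a A] ++ Y ++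
      [firstOcc β c C, secondOcc β a A] ++ Z ++ [secondOcc β c C, secondOcc β b B] ++ T) := by
  classical
  have key : ∀ (D : L) (g : G), (Absent D X ∧ Absent D Y ∧ Absent D Z ∧ Absent D T) → _ :=
    fun D g hD => CrossingOk.replace (E := E) (E' := Function.update E D g)
      (P' := [firstOcc β b B, firstOcc β a A]) (Q' := [firstOcc β c C, secondOcc β a A])
      (R' := [secondOcc β c C, secondOcc β b B]) hc hm
      (hD.1.update E g) (hD.2.1.update E g) (hD.2.2.1.update E g) (hD.2.2.2.update E g) h
  -- `habc` excludes the two patterns in which the three strands pass over each other cyclically. In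
  -- the other six there are a top, a middle and a bottom strand. The two letters on the top strand
  -- have equal values, and only the letter joining the middle and bottom strands gets a new value:
  -- its old one conjugated by this common value or by its inverse.
  cases a <;> cases b <;> cases c <;> simp only [reduceCtorEq, or_self, or_true, true_or] at habc

  · refine ⟨_, key C (signPow (E A) (!β) * E C * (signPow (E A) (!β))⁻¹) hC ?_⟩
    rintro ⟨i, g₁⟩ ⟨j, g₂⟩ ⟨k, g₃⟩ - - - h1 h2 h3
    simp [CrossingOk, CrossingOkAt, crossingRun, crossingStep, StateCong, firstOcc, secondOcc, hAB,
      hAC, hBC, hAB.symm, hAC.symm, hBC.symm] at h1 h2 h3 ⊢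
    have e : E B = E A := h1.2.trans h1.1.symm
    exact ⟨h1.symm, by rw [h2]; group, mem_of_eq_one (by rw [e]; cases β <;> simp [mul_assoc])⟩
  · refine ⟨_, key C (signPow (E B) (!β) * E C * (signPow (E B) (!β))⁻¹) hC ?_⟩
    rintro ⟨i, g₁⟩ ⟨j, g₂⟩ ⟨k, g₃⟩ - - - h1 h2 h3
    simp [CrossingOk, CrossingOkAt, crossingRun, crossingStep, StateCong, firstOcc, secondOcc, hAB,
      hAC, hBC, hAB.symm, hAC.symm, hBC.symm] at h1 h2 h3 ⊢
    have e : E B = E A := h1.2.trans h1.1.symm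
    exact ⟨h1.symm, mem_of_eq_one (by rw [e]; cases β <;> simp [mul_assoc]), by rw [h3]; group⟩
  · refine ⟨_, key A ((signPow (E B) β)⁻¹ * E A * signPow (E B) β) hA ?_⟩
    rintro ⟨i, g₁⟩ ⟨j, g₂⟩ ⟨k, g₃⟩ - - - h1 h2 h3
    simp [CrossingOk, CrossingOkAt, crossingRun, crossingStep, StateCong, firstOcc, secondOcc, hAB,
      hAC, hBC, hAB.symm, hAC.symm, hBC.symm] at h1 h2 h3 ⊢
    have e : E B = E C := h3.1.trans h3.2.symm
    exact ⟨by rw [h1]; group, mem_of_eq_one (by rw [e]; cases β <;> simp [mul_assoc]), h3.symm⟩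
  · refine ⟨_, key B (signPow (E A) β * E B * (signPow (E A) β)⁻¹) hB ?_⟩
    rintro ⟨i, g₁⟩ ⟨j, g₂⟩ ⟨k, g₃⟩ - - - h1 h2 h3
    simp [CrossingOk, CrossingOkAt, crossingRun, crossingStep, StateCong, firstOcc, secondOcc, hAB,
      hAC, hBC, hAB.symm, hAC.symm, hBC.symm] at h1 h2 h3 ⊢
    have e : E A = E C := h2.1.trans h2.2.symm
    exact ⟨by rw [h1]; group, h2.symm, mem_of_eq_one (by rw [e]; cases β <;> simp [mul_assoc])⟩
  · refine ⟨_, key B ((signPow (E C) (!β))⁻¹ * E B * signPow (E C) (!β)) hB ?_⟩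
    rintro ⟨i, g₁⟩ ⟨j, g₂⟩ ⟨k, g₃⟩ - - - h1 h2 h3
    simp [CrossingOk, CrossingOkAt, crossingRun, crossingStep, StateCong, firstOcc, secondOcc, hAB,
      hAC, hBC, hAB.symm, hAC.symm, hBC.symm] at h1 h2 h3 ⊢
    have e : E A = E C := h2.1.trans h2.2.symm
    exact ⟨mem_of_eq_one (by rw [e]; cases β <;> simp [mul_assoc]), h2.symm, by rw [h3]; group⟩
  · refine ⟨_, key A ((signPow (E C) β)⁻¹ * E A * signPow (E C) β) hA ?_⟩
    rintro ⟨i, g₁⟩ ⟨j, g₂⟩ ⟨k, g₃⟩ - - - h1 h2 h3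
    simp [CrossingOk, CrossingOkAt, crossingRun, crossingStep, StateCong, firstOcc, secondOcc, hAB,
      hAC, hBC, hAB.symm, hAC.symm, hBC.symm] at h1 h2 h3 ⊢
    have e : E B = E C := h3.1.trans h3.2.symm
    exact ⟨mem_of_eq_one (by rw [e]; cases β <;> simp [mul_assoc]), by rw [h2]; group, h3.symm⟩

set_option linter.unusedSimpArgs false in
/-- Exchange of the second occurrences of two letters that connect the same two components. -/
theorem CrossingOk.swap_second (hc : ∀ j, ∀ a ∈ N j, ∀ b ∈ N j, a * b = b * a)
    (hm : ∀ j, m j ∈ N j) {E : L → G} {s : ℕ × G} {X Y Z T : List (Crossing L)} {B C : L}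
    {β b c : Bool} (hBC : B ≠ C) (hbar : barCount Y = 0)
    (hB : Absent B X ∧ Absent B Y ∧ Absent B Z ∧ Absent B T)
    (hC : Absent C X ∧ Absent C Y ∧ Absent C Z ∧ Absent C T)
    (h : CrossingOk N m lam E s (X ++ [firstOcc β b B] ++ Y ++
      [firstOcc β c C] ++ Z ++ [secondOcc β b B, secondOcc β c C] ++ T)) :
    ∃ E' : L → G, CrossingOk N m lam E' s (X ++ [firstOcc β b B] ++ Y ++
      [firstOcc β c C] ++ Z ++ [secondOcc β c C, secondOcc β b B] ++ T) := by
  classical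
  have key : ∀ (D : L) (g : G), (Absent D X ∧ Absent D Y ∧ Absent D Z ∧ Absent D T) → _ :=
    fun D g hD => CrossingOk.replace (E := E) (E' := Function.update E D g)
      (P' := [firstOcc β b B]) (Q' := [firstOcc β c C])
      (R' := [secondOcc β c C, secondOcc β b B]) hc hm
      (hD.1.update E g) (hD.2.1.update E g) (hD.2.2.1.update E g) (hD.2.2.2.update E g) h
  -- Without bars in `Y` both first occurrences lie in one component `j`, so a letter with sign zero
  -- there has its value in `N j`. If both have, the values commute. If one has, it conjugates the
  -- value of the other, which changes the longitude of `j` only modulo `N j`. If none has, the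
  -- exchanged occurrences both have sign zero and nothing changes.
  cases b <;> cases c
  · refine ⟨_, key B (E B) hB ?_⟩
    rintro ⟨i, g₁⟩ ⟨j, g₂⟩ ⟨k, g₃⟩ - hij hjk h1 h2 h3
    simp [CrossingOk, CrossingOkAt, crossingRun, crossingStep, StateCong, firstOcc, secondOcc,
      hBC, hBC.symm, barCount, hbar] at hij hjk h1 h2 h3 ⊢
    subst hij
    have hcomm := hc j _ (signPow_mem (h1 ▸ crossing_conj_mem hm j g₁ : E B ∈ N j) !β) _
      (signPow_mem (h2 ▸ crossing_conj_mem hm j g₂ : E C ∈ N j) !β)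
    refine ⟨h1, h2, mem_of_eq_one ?_⟩
    rw [mul_assoc g₃, ← hcomm]
    group
  · refine ⟨_, key C (signPow (E B) (!β) * E C * (signPow (E B) (!β))⁻¹) hC ?_⟩
    rintro ⟨i, g₁⟩ ⟨j, g₂⟩ ⟨k, g₃⟩ - hij hjk h1 h2 h3
    simp [CrossingOk, CrossingOkAt, crossingRun, crossingStep, StateCong, firstOcc, secondOcc,
      hBC, hBC.symm, barCount, hbar] at hij hjk h1 h2 h3 ⊢
    subst hij
    exact ⟨h1, signPow_conj_cong' (signPow_mem (h1 ▸ crossing_conj_mem hm j g₁) _) β,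
      by rw [h3]; group⟩
  · refine ⟨_, key B ((signPow (E C) (!β))⁻¹ * E B * signPow (E C) (!β)) hB ?_⟩
    rintro ⟨i, g₁⟩ ⟨j, g₂⟩ ⟨k, g₃⟩ - hij hjk h1 h2 h3
    simp [CrossingOk, CrossingOkAt, crossingRun, crossingStep, StateCong, firstOcc, secondOcc,
      hBC, hBC.symm, barCount, hbar] at hij hjk h1 h2 h3 ⊢
    subst hij
    exact ⟨signPow_conj_cong (signPow_mem (h2 ▸ crossing_conj_mem hm j g₂) _) β, h2,
      by rw [h3]; group⟩
  · refine ⟨_, key B (E B) hB ?_⟩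
    rintro ⟨i, g₁⟩ ⟨j, g₂⟩ ⟨k, g₃⟩ - hij hjk h1 h2 h3
    simp [CrossingOk, CrossingOkAt, crossingRun, crossingStep, StateCong, firstOcc, secondOcc,
      hBC, hBC.symm, barCount, hbar] at hij hjk h1 h2 h3 ⊢
    exact h3.symm

set_option linter.unusedSimpArgs false in
/-- Exchange of the first occurrences of two letters that connect the same two components. -/
theorem CrossingOk.swap_first (hc : ∀ j, ∀ a ∈ N j, ∀ b ∈ N j, a * b = b * a)
    (hm : ∀ j, m j ∈ N j) {E : L → G} {s : ℕ × G} {X Y Z T : List (Crossing L)} {A B : L}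
    {β a b : Bool} (hAB : A ≠ B) (hbar : barCount Z = 0)
    (hA : Absent A X ∧ Absent A Y ∧ Absent A Z ∧ Absent A T)
    (hB : Absent B X ∧ Absent B Y ∧ Absent B Z ∧ Absent B T)
    (h : CrossingOk N m lam E s (X ++ [firstOcc β a A, firstOcc β b B] ++ Y ++
      [secondOcc β a A] ++ Z ++ [secondOcc β b B] ++ T)) :
    ∃ E' : L → G, CrossingOk N m lam E' s (X ++ [firstOcc β b B, firstOcc β a A] ++ Y ++
      [secondOcc β a A] ++ Z ++ [secondOcc β b B] ++ T) := by
  classical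
  have key : ∀ (D : L) (g : G), (Absent D X ∧ Absent D Y ∧ Absent D Z ∧ Absent D T) → _ :=
    fun D g hD => CrossingOk.replace (E := E) (E' := Function.update E D g)
      (P' := [firstOcc β b B, firstOcc β a A]) (Q' := [secondOcc β a A])
      (R' := [secondOcc β b B]) hc hm
      (hD.1.update E g) (hD.2.1.update E g) (hD.2.2.1.update E g) (hD.2.2.2.update E g) h
  -- The same alternatives with the roles of first and second occurrences exchanged: both second
  -- occurrences lie in component `k`, and values read there with sign zero belong to `N k`.
  cases a <;> cases b
  · refine ⟨_, key A (E A) hA ?_⟩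
    rintro ⟨i, g₁⟩ ⟨j, g₂⟩ ⟨k, g₃⟩ - hij hjk h1 h2 h3
    simp [CrossingOk, CrossingOkAt, crossingRun, crossingStep, StateCong, firstOcc, secondOcc,
      hAB, hAB.symm, barCount, hbar] at hij hjk h1 h2 h3 ⊢
    exact h1.symm
  · refine ⟨_, key A ((signPow (E B) β)⁻¹ * E A * signPow (E B) β) hA ?_⟩
    rintro ⟨i, g₁⟩ ⟨j, g₂⟩ ⟨k, g₃⟩ - hij hjk h1 h2 h3
    simp [CrossingOk, CrossingOkAt, crossingRun, crossingStep, StateCong, firstOcc, secondOcc,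
      hAB, hAB.symm, barCount, hbar] at hij hjk h1 h2 h3 ⊢
    subst hjk
    exact ⟨by rw [h1]; group,
      signPow_conj_cong (signPow_mem (h3 ▸ crossing_conj_mem hm k g₃) _) (!β), h3⟩
  · refine ⟨_, key B (signPow (E A) β * E B * (signPow (E A) β)⁻¹) hB ?_⟩
    rintro ⟨i, g₁⟩ ⟨j, g₂⟩ ⟨k, g₃⟩ - hij hjk h1 h2 h3
    simp [CrossingOk, CrossingOkAt, crossingRun, crossingStep, StateCong, firstOcc, secondOcc,
      hAB, hAB.symm, barCount, hbar] at hij hjk h1 h2 h3 ⊢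
    subst hjk
    exact ⟨by rw [h1]; group, h2,
      signPow_conj_cong' (signPow_mem (h2 ▸ crossing_conj_mem hm k g₂) _) (!β)⟩
  · refine ⟨_, key A (E A) hA ?_⟩
    rintro ⟨i, g₁⟩ ⟨j, g₂⟩ ⟨k, g₃⟩ - hij hjk h1 h2 h3
    simp [CrossingOk, CrossingOkAt, crossingRun, crossingStep, StateCong, firstOcc, secondOcc,
      hAB, hAB.symm, barCount, hbar] at hij hjk h1 h2 h3 ⊢
    subst hjk
    have hcomm := hc k _ (signPow_mem (h2 ▸ crossing_conj_mem hm k g₂ : E A ∈ N k) β) _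
      (signPow_mem (h3 ▸ crossing_conj_mem hm k g₃ : E B ∈ N k) β)
    refine ⟨mem_of_eq_one ?_, h2, h3⟩
    rw [mul_assoc g₁, ← hcomm]
    group

end Moves

/-! ### The crossing sequence of a nanophrase -/

/-- Whether the first occurrence of a letter is the signed one. -/
def AlphaV.signedFirst : AlphaV → Bool
  | bPlus => true
  | aMinus => true
  | aPlus => false
  | bMinus => false

/-- Whether the projection of a letter is one of `b₊`, `b₋`. -/
def AlphaV.isB : AlphaV → Bool
  | bPlus => true
  | bMinus => true
  | aPlus => false
  | aMinus => false

section Crossings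

variable {L : Type}

/-- The crossing symbol of a letter `D` in the `k`th component, where `st D` consists of the
components of the two occurrences of `D` and of its projection. -/
def crossingAt (st : L → ℕ × ℕ × AlphaV) (k : ℕ) (D : L) : List (Crossing L) :=
  if (st D).1 = (st D).2.1 then []
  else if k = (st D).1 then [firstOcc (st D).2.2.isB (st D).2.2.signedFirst D]
  else if k = (st D).2.1 then [secondOcc (st D).2.2.isB (st D).2.2.signedFirst D]
  else []

/-- The crossing sequence of a phrase that starts in the `k`th component. -/
def crossings (st : L → ℕ × ℕ × AlphaV) : ℕ → List (Option L) → List (Crossing L)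
  | _, [] => []
  | k, none :: l => .bar :: crossings st (k + 1) l
  | k, some D :: l => crossingAt st k D ++ crossings st k l

/-- The number of bars of a phrase. -/
def noneCount : List (Option L) → ℕ
  | [] => 0
  | none :: l => noneCount l + 1
  | some _ :: l => noneCount l

/-- The letter `D` occurs in the `i`th component of a phrase that starts in the `k`th one. -/
def OccursAt : ℕ → List (Option L) → ℕ → L → Prop
  | _, [], _, _ => False
  | k, none :: l, i, D => OccursAt (k + 1) l i D
  | k, some C :: l, i, D => (i = k ∧ D = C) ∨ OccursAt k l i D

theorem noneCount_append (x y : List (Option L)) :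
    noneCount (x ++ y) = noneCount x + noneCount y := by
  induction x with
  | nil => simp [noneCount]
  | cons t x ih => cases t <;> (simp [noneCount, ih]; try omega)

theorem crossings_append (st : L → ℕ × ℕ × AlphaV) (k : ℕ) (x y : List (Option L)) :
    crossings st k (x ++ y) = crossings st k x ++ crossings st (k + noneCount x) y := by
  induction x generalizing k with
  | nil => rfl
  | cons t x ih =>
    cases t with
    | none =>
      simp only [List.cons_append, crossings, noneCount, ih]
      rw [show k + 1 + noneCount x = k + (noneCount x + 1) by omega]
    | some D => simp [crossings, noneCount, ih]

theorem occursAt_append (k : ℕ) (x y : List (Option L)) (i : ℕ) (D : L) :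
    OccursAt k (x ++ y) i D ↔ OccursAt k x i D ∨ OccursAt (k + noneCount x) y i D := by
  induction x generalizing k with
  | nil => simp [OccursAt, noneCount]
  | cons t x ih =>
    cases t with
    | none =>
      simp only [List.cons_append, OccursAt, noneCount, ih]
      rw [show k + 1 + noneCount x = k + (noneCount x + 1) by omega]
    | some C => simp [OccursAt, noneCount, ih, or_assoc]

theorem OccursAt.mem {k : ℕ} {x : List (Option L)} {i : ℕ} {D : L} (h : OccursAt k x i D) :
    some D ∈ x := by
  induction x generalizing k with
  | nil => exact h.elim
  | cons t x ih =>
    cases t with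
    | none => exact List.mem_cons_of_mem _ (ih h)
    | some C =>
      rcases h with h | h
      · simp [h.2]
      · exact List.mem_cons_of_mem _ (ih h)

theorem barCount_crossingAt (st : L → ℕ × ℕ × AlphaV) (k : ℕ) (D : L) :
    barCount (crossingAt st k D) = 0 := by
  unfold crossingAt firstOcc secondOcc
  split_ifs <;> rfl

theorem barCount_crossings (st : L → ℕ × ℕ × AlphaV) (k : ℕ) (x : List (Option L)) :
    barCount (crossings st k x) = noneCount x := by
  induction x generalizing k with
  | nil => rfl
  | cons t x ih =>
    cases t with
    | none => simp [crossings, barCount, noneCount, ih]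
    | some D => simp [crossings, barCount_append, barCount_crossingAt, noneCount, ih]

theorem letters_crossingAt (st : L → ℕ × ℕ × AlphaV) (k : ℕ) (D : L) :
    ∀ t ∈ crossingAt st k D, t.letters = [D] := by
  unfold crossingAt firstOcc secondOcc
  split_ifs <;> simp [Crossing.letters]

theorem absent_crossings (st : L → ℕ × ℕ × AlphaV) (k : ℕ) {x : List (Option L)} {A : L}
    (h : some A ∉ x) : Absent A (crossings st k x) := by
  induction x generalizing k with
  | nil => intro t ht; simp [crossings] at ht
  | cons u x ih =>
    have hx : some A ∉ x := fun h' => h (List.mem_cons_of_mem _ h')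
    intro t ht
    cases u with
    | none =>
      rcases List.mem_cons.mp ht with rfl | ht
      · simp [Crossing.letters]
      · exact ih _ hx t ht
    | some D =>
      rcases List.mem_append.mp ht with ht | ht
      · rw [letters_crossingAt st k D t ht, List.mem_singleton]
        rintro rfl
        simp at h
      · exact ih _ hx t ht

theorem crossings_map {L' : Type} (f : L' → L) {st : L → ℕ × ℕ × AlphaV}
    {st' : L' → ℕ × ℕ × AlphaV} (hst : ∀ D, st' D = st (f D)) (k : ℕ) (x : List (Option L')) :
    (crossings st' k x).map (Crossing.map f) = crossings st k (x.map (Option.map f)) := by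
  induction x generalizing k with
  | nil => rfl
  | cons t x ih =>
    cases t with
    | none => simp [crossings, Crossing.map, ih]
    | some D =>
      simp only [crossings, List.map_append, ih, List.map_cons, Option.map_some]
      congr 1
      unfold crossingAt firstOcc secondOcc
      rw [hst]
      split_ifs <;> simp [Crossing.map]

theorem crossings_congr {st st' : L → ℕ × ℕ × AlphaV} {x : List (Option L)} (k : ℕ)
    (h : ∀ i D, some D ∈ x → crossingAt st' i D = crossingAt st i D) :
    crossings st' k x = crossings st k x := by
  induction x generalizing k with
  | nil => rfl
  | cons t x ih =>
    have hx := fun k => ih k fun i D hD => h i D (List.mem_cons_of_mem _ hD)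
    cases t with
    | none => simp [crossings, hx]
    | some D => simp [crossings, hx, h]

/-- The phrase with the given components. -/
theorem occursAt_flatMap (k : ℕ) (ws : List (List L)) (i : ℕ) (D : L) :
    OccursAt k (ws.flatMap fun v => v.map some ++ [none]) i D ↔
      ∃ j, ∃ h : j < ws.length, i = k + j ∧ D ∈ ws[j] := by
  have hsome : ∀ (v : List L) k, OccursAt k (v.map some) i D ↔ i = k ∧ D ∈ v := by
    intro v k
    induction v with
    | nil => simp [OccursAt]
    | cons C v ih => simp only [List.map_cons, OccursAt, ih, List.mem_cons]; tauto
  have hnone : ∀ v : List L, noneCount (v.map some) = 0 := by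
    intro v
    induction v with
    | nil => rfl
    | cons C v ih => simpa [noneCount] using ih
  induction ws generalizing k with
  | nil => simp [OccursAt]
  | cons v ws ih =>
    have ih' := ih (k + 1)
    rw [List.flatMap_cons, occursAt_append, occursAt_append, noneCount_append, hsome, hnone]
    simp only [OccursAt, noneCount, or_false, zero_add, List.length_cons, ih']
    constructor
    · rintro (h | ⟨j, hj, h⟩)
      · exact ⟨0, by omega, by simpa using h⟩
      · exact ⟨j + 1, by omega, by simpa [add_assoc, add_comm 1] using h⟩
    · rintro ⟨j, hj, h⟩
      cases j with
      | zero => left; simpa using h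
      | succ j => right; exact ⟨j, by omega, by simpa [add_assoc, add_comm 1] using h⟩

theorem occursAt_flatPhrase {n : ℕ} (w : Fin n → List L) (i : Fin n) (D : L) :
    OccursAt 0 (flatPhrase w) i D ↔ D ∈ w i := by
  rw [flatPhrase, occursAt_flatMap]
  simp only [List.length_ofFn, zero_add, List.getElem_ofFn]
  constructor
  · rintro ⟨j, hj, h1, h2⟩
    have : i = ⟨j, hj⟩ := Fin.ext h1
    rwa [this]
  · intro h
    exact ⟨i, i.2, rfl, h⟩

theorem OccursAt.lt {n : ℕ} {w : Fin n → List L} {i : ℕ} {D : L}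
    (h : OccursAt 0 (flatPhrase w) i D) : i < n := by
  rw [flatPhrase, occursAt_flatMap] at h
  obtain ⟨j, hj, h1, -⟩ := h
  simp only [List.length_ofFn] at hj
  omega

theorem crossingOk_flatMap {G : Type*} [Group G] {N : ℕ → Subgroup G} {m lam : ℕ → G} {E : L → G}
    (st : L → ℕ × ℕ × AlphaV) (k : ℕ) (ws : List (List L)) :
    CrossingOk N m lam E (k, 1) (crossings st k (ws.flatMap fun v => v.map some ++ [none])) ↔
      ∀ j, ∀ h : j < ws.length,
        CrossingOk N m lam E (k + j, 1) (crossings st (k + j) (ws[j].map some)) ∧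
        (crossingRun E (k + j, 1) (crossings st (k + j) (ws[j].map some))).2⁻¹ * lam (k + j) ∈
          N (k + j) := by
  have hnone : ∀ v : List L, noneCount (v.map some) = 0 := by
    intro v
    induction v with
    | nil => rfl
    | cons C v ih => simpa [noneCount] using ih
  induction ws generalizing k with
  | nil => simp [CrossingOk, crossings]
  | cons v ws ih =>
    have ih' := ih (k + 1)
    have hfst : (crossingRun E (k, (1 : G)) (crossings st k (v.map some))).1 = k := by
      rw [crossingRun_fst, barCount_crossings, hnone]; rfl
    rw [List.flatMap_cons, crossings_append, crossings_append, crossingOk_append,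
      crossingOk_append, crossingRun_append, noneCount_append, hnone]
    simp only [crossings, noneCount, CrossingOk, CrossingOkAt, crossingRun, crossingStep, zero_add,
      and_true, hfst, ih']
    constructor
    · rintro ⟨h1, h2⟩ j hj
      cases j with
      | zero => exact h1
      | succ j =>
        rw [show k + (j + 1) = k + 1 + j by omega]
        exact h2 j (by simpa using hj)
    · intro h
      refine ⟨h 0 (by simp), fun j hj => ?_⟩
      rw [show k + 1 + j = k + (j + 1) by omega]
      exact h (j + 1) (by simpa using hj)

end Crossings

section Occurrences

variable {L : Type}

theorem occursAt_map {L' : Type} {f : L' → L} (hf : Function.Injective f) (k : ℕ)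
    (x : List (Option L')) (i : ℕ) (D : L') :
    OccursAt k (x.map (Option.map f)) i (f D) ↔ OccursAt k x i D := by
  induction x generalizing k with
  | nil => rfl
  | cons t x ih =>
    cases t with
    | none => simp [OccursAt, ih]
    | some C => simp [OccursAt, ih, hf.eq_iff]

theorem IsGaussPhrase.count_flatPhrase [DecidableEq L] {n : ℕ} {w : Fin n → List L}
    (hw : IsGaussPhrase w) (A : L) : (flatPhrase w).count (some A) = 2 := by
  have key : ∀ ws : List (List L),
      (ws.flatMap fun v => v.map some ++ [none]).count (some A) = ws.flatten.count A := by
    intro ws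
    induction ws with
    | nil => rfl
    | cons v ws ih =>
      rw [List.flatMap_cons, List.count_append, ih, List.flatten_cons, List.count_append,
        List.count_append, List.count_map_of_injective _ _ (Option.some_injective L)]
      simp
  rw [flatPhrase, key]
  convert hw A

end Occurrences

/-! ### Solutions for a nanophrase and the moves H1, H2, H3 -/

namespace Nanophrase

section Status

variable {n : ℕ} (p : Nanophrase AlphaV n)

/-- The components of the two occurrences of a letter, and its projection. -/
noncomputable def status (D : p.Letter) : ℕ × ℕ × AlphaV :=
  (p.firstComp D, p.secondComp D, p.proj D)

variable {p}

theorem comps_eq {q : Nanophrase AlphaV n} {D : p.Letter} {D' : q.Letter}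
    (h : ∀ i, D ∈ p.word i ↔ D' ∈ q.word i) : p.comps D = q.comps D' := by
  ext i
  simp [comps, h i]

theorem firstComp_eq {q : Nanophrase AlphaV n} {D : p.Letter} {D' : q.Letter}
    (h : ∀ i, D ∈ p.word i ↔ D' ∈ q.word i) : p.firstComp D = q.firstComp D' := by
  simp only [firstComp, comps_eq h]

theorem secondComp_eq {q : Nanophrase AlphaV n} {D : p.Letter} {D' : q.Letter}
    (h : ∀ i, D ∈ p.word i ↔ D' ∈ q.word i) : p.secondComp D = q.secondComp D' := by
  simp only [secondComp, comps_eq h]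

theorem status_eq {q : Nanophrase AlphaV n} {D : p.Letter} {D' : q.Letter}
    (h : ∀ i, D ∈ p.word i ↔ D' ∈ q.word i) (hp : p.proj D = q.proj D') :
    p.status D = q.status D' := by
  rw [status, status, firstComp_eq h, secondComp_eq h, hp]

theorem mem_comps {D : p.Letter} {i : Fin n} : i ∈ p.comps D ↔ D ∈ p.word i := by
  simp [comps]

/-- The moves are stated for phrases with bars, where the index of a component is the number of bars
passed. This reads the status of a letter off such a description. -/
theorem status_of_occursAt {D : p.Letter} {a b : ℕ} (hab : a ≤ b)
    (h : ∀ i, OccursAt 0 (flatPhrase p.word) i D ↔ i = a ∨ i = b) :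
    p.status D = (a, b, p.proj D) := by
  have ha : a < n := ((h a).2 (Or.inl rfl)).lt
  have hb : b < n := ((h b).2 (Or.inr rfl)).lt
  have hmem : ∀ i, i ∈ p.comps D ↔ (i : ℕ) = a ∨ (i : ℕ) = b := fun i => by
    rw [mem_comps, ← occursAt_flatPhrase, h]
  have h1 : p.firstComp D = ⟨a, ha⟩ := by
    refine le_antisymm (Finset.min'_le _ _ ((hmem _).2 (Or.inl rfl))) ?_
    refine Finset.le_min' _ _ _ fun i hi => ?_
    rcases (hmem i).1 hi with h | h <;> (rw [Fin.le_def]; simp only; omega)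
  have h2 : p.secondComp D = ⟨b, hb⟩ := by
    refine le_antisymm ?_ (Finset.le_max' _ _ ((hmem _).2 (Or.inr rfl)))
    refine Finset.max'_le _ _ _ fun i hi => ?_
    rcases (hmem i).1 hi with h | h <;> (rw [Fin.le_def]; simp only; omega)
  rw [status, h1, h2]

variable (p) in
/-- The values `E` of the letters form a system of conjugates of the meridians `m` with the
longitudes `lam`. -/
def Solves {G : Type*} [Group G] (N : ℕ → Subgroup G) (m lam : ℕ → G) (E : p.Letter → G) : Prop :=
  CrossingOk N m lam E (0, 1) (crossings p.status 0 (flatPhrase p.word))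

end Status

section Moves

variable {n : ℕ} {G : Type*} [Group G] {N : ℕ → Subgroup G} {m lam : ℕ → G}

/-- Removal of letters that leaves the crossing sequence solvable. -/
theorem Solves.of_map {p q : Nanophrase AlphaV n} (f : q.Letter → p.Letter) {E : p.Letter → G}
    (hst : ∀ D, q.status D = p.status (f D))
    (h : CrossingOk N m lam E (0, 1)
      (crossings p.status 0 ((flatPhrase q.word).map (Option.map f)))) :
    q.Solves N m lam (E ∘ f) := by
  rw [← crossings_map f hst, crossingOk_map] at h
  exact h

/-- No bar separates the two occurrences of `A`, so `A` contributes no crossing symbol and can be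
deleted without effect. -/
theorem solves_h1 {L : Type} (hL : Finite L) (proj : L → AlphaV) (w : Fin n → List L)
    (hw : IsGaussPhrase w) (A : L) (hL' : Finite {C : L // C ≠ A})
    (w' : Fin n → List {C : L // C ≠ A}) (hw' : IsGaussPhrase w')
    (x y : List (Option L))
    (h : flatPhrase w = x ++ [some A, some A] ++ y)
    (h' : (flatPhrase w').map (Option.map Subtype.val) = x ++ y) {E : L → G}
    (hE : Solves ⟨L, hL, proj, w, hw⟩ N m lam E) :
    Solves ⟨{C : L // C ≠ A}, hL', fun C => proj C, w', hw'⟩ N m lam (E ∘ Subtype.val) := by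
  classical
  have hcount := hw.count_flatPhrase A
  rw [h] at hcount
  simp only [List.count_append, List.count_cons_self, List.count_nil] at hcount
  have hx : some A ∉ x := List.count_eq_zero.mp (by omega)
  have hy : some A ∉ y := List.count_eq_zero.mp (by omega)
  refine Solves.of_map (p := ⟨L, hL, proj, w, hw⟩)
    (q := ⟨{C : L // C ≠ A}, hL', fun C => proj C, w', hw'⟩) Subtype.val ?_ ?_
  · intro D
    refine status_eq (fun i => ?_) rfl
    rw [← occursAt_flatPhrase, ← occursAt_flatPhrase,
      ← occursAt_map (f := Subtype.val) Subtype.val_injective]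
    simp only [h, h', occursAt_append, OccursAt, noneCount_append, noneCount, D.2, and_false,
      or_false]
    simp
  · simp only [h']
    have hA : status ⟨L, hL, proj, w, hw⟩ A = (noneCount x, noneCount x, proj A) := by
      refine status_of_occursAt le_rfl fun i => ?_
      have h1 : ¬ OccursAt 0 x i A := fun h => hx h.mem
      have h2 : ∀ k, ¬ OccursAt k y i A := fun k h => hy h.mem
      simp [h, occursAt_append, OccursAt, h1, h2]
    have hA' : ∀ k, crossingAt (status ⟨L, hL, proj, w, hw⟩) k A = [] := fun k => by
      simp [crossingAt, hA]
    unfold Solves at hE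
    simp only [h] at hE
    simpa [crossings_append, crossings, hA', noneCount_append, noneCount] using hE

/-- The involution τ keeps the position of the signed occurrence and reverses its sign, which is
what the cancellation of two crossings requires. -/
theorem AlphaV.tau_cases {a b : AlphaV} (h : AlphaV.tau a = b) :
    b.signedFirst = a.signedFirst ∧ b.isB = !a.isB := by
  subst h
  cases a <;> exact ⟨rfl, rfl⟩

variable [∀ j, (N j).Normal]

theorem solves_h2 (hc : ∀ j, ∀ a ∈ N j, ∀ b ∈ N j, a * b = b * a)
    (hm : ∀ j, m j ∈ N j) {L : Type} (hL : Finite L) (proj : L → AlphaV) (w : Fin n → List L)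
    (hw : IsGaussPhrase w) (A B : L) (hL' : Finite {C : L // C ≠ A ∧ C ≠ B})
    (w' : Fin n → List {C : L // C ≠ A ∧ C ≠ B}) (hw' : IsGaussPhrase w')
    (x y z : List (Option L)) (hAB : AlphaV.tau (proj A) = proj B)
    (h : flatPhrase w = x ++ [some A, some B] ++ y ++ [some B, some A] ++ z)
    (h' : (flatPhrase w').map (Option.map Subtype.val) = x ++ y ++ z) {E : L → G}
    (hE : Solves ⟨L, hL, proj, w, hw⟩ N m lam E) :
    Solves ⟨{C : L // C ≠ A ∧ C ≠ B}, hL', fun C => proj C, w', hw'⟩ N m lam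
      (E ∘ Subtype.val) := by
  classical
  have hcA := hw.count_flatPhrase A
  have hcB := hw.count_flatPhrase B
  rw [h] at hcA hcB
  have hne : A ≠ B := by
    rintro rfl
    simp only [List.count_append, List.count_cons_self, List.count_nil] at hcA
    omega
  simp only [List.count_append, List.count_cons, List.count_nil, beq_iff_eq, Option.some.injEq,
    hne, hne.symm, if_true, if_false] at hcA hcB
  have hA : some A ∉ x ∧ some A ∉ y ∧ some A ∉ z :=
    ⟨List.count_eq_zero.mp (by omega), List.count_eq_zero.mp (by omega),
      List.count_eq_zero.mp (by omega)⟩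
  have hB : some B ∉ x ∧ some B ∉ y ∧ some B ∉ z :=
    ⟨List.count_eq_zero.mp (by omega), List.count_eq_zero.mp (by omega),
      List.count_eq_zero.mp (by omega)⟩
  refine Solves.of_map (p := ⟨L, hL, proj, w, hw⟩)
    (q := ⟨{C : L // C ≠ A ∧ C ≠ B}, hL', fun C => proj C, w', hw'⟩) Subtype.val ?_ ?_
  · intro D
    refine status_eq (fun i => ?_) rfl
    rw [← occursAt_flatPhrase, ← occursAt_flatPhrase,
      ← occursAt_map (f := Subtype.val) Subtype.val_injective]
    simp only [h, h', occursAt_append, OccursAt, noneCount_append, noneCount, D.2.1, D.2.2,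
      and_false, or_false]
    simp
  · simp only [h']
    have hst : ∀ D, (D = A ∨ D = B) → status ⟨L, hL, proj, w, hw⟩ D =
        (noneCount x, noneCount x + noneCount y, proj D) := by
      intro D hD
      refine status_of_occursAt (by omega) fun i => ?_
      have hD' : some D ∉ x ∧ some D ∉ y ∧ some D ∉ z := by
        rcases hD with rfl | rfl <;> assumption
      have h1 : ∀ k, ¬ OccursAt k x i D := fun k h => hD'.1 h.mem
      have h2 : ∀ k, ¬ OccursAt k y i D := fun k h => hD'.2.1 h.mem
      have h3 : ∀ k, ¬ OccursAt k z i D := fun k h => hD'.2.2 h.mem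
      rcases hD with rfl | rfl <;>
        simp [h, occursAt_append, OccursAt, h1, h2, h3, hne, hne.symm]
    obtain ⟨hf, hb⟩ := AlphaV.tau_cases hAB
    unfold Solves at hE
    simp only [h] at hE
    -- Without a bar in `y` both letters stay within one component and are invisible. Otherwise
    -- their crossing symbols cancel.
    by_cases hy : noneCount y = 0
    · have hA' : ∀ k, crossingAt (status ⟨L, hL, proj, w, hw⟩) k A = [] := fun k => by
        simp [crossingAt, hst, hy]
      have hB' : ∀ k, crossingAt (status ⟨L, hL, proj, w, hw⟩) k B = [] := fun k => by
        simp [crossingAt, hst, hy]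
      simpa [crossings_append, crossings, hA', hB', noneCount_append, noneCount] using hE
    · simp [crossings_append, crossings, crossingAt, hst, hy, hf, hb] at hE ⊢
      rw [← List.append_assoc]
      cases hs : (proj A).signedFirst
      · refine CrossingOk.cancel_above_below (b := !(proj A).isB) (A := A) (B := B) hc hm ?_
        simpa [firstOcc, secondOcc, hs] using hE
      · refine CrossingOk.cancel_below_above (b := (proj A).isB) (A := A) (B := B) hc hm ?_
        simpa [firstOcc, secondOcc, hs] using hE

/-- Membership in `S_v` gives the common parameter β of the three letters and excludes the cyclic
over-under patterns. -/
theorem AlphaV.S_cases {a b c : AlphaV} (h : (a, b, c) ∈ AlphaV.S) :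
    b.isB = a.isB ∧ c.isB = a.isB ∧
      (a.signedFirst = b.signedFirst ∨ b.signedFirst = c.signedFirst) := by
  simp only [AlphaV.S, Set.mem_insert_iff, Set.mem_singleton_iff, Prod.mk.injEq] at h
  rcases h with h | h | h | h | h | h | h | h | h | h | h | h <;> obtain ⟨rfl, rfl, rfl⟩ := h <;>
    simp [AlphaV.isB, AlphaV.signedFirst]

theorem solves_h3 (hc : ∀ j, ∀ a ∈ N j, ∀ b ∈ N j, a * b = b * a)
    (hm : ∀ j, m j ∈ N j) {L : Type} (hL : Finite L) (proj : L → AlphaV)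
    (w w' : Fin n → List L) (hw : IsGaussPhrase w) (hw' : IsGaussPhrase w')
    (A B C : L) (x y z t : List (Option L)) (hS : (proj A, proj B, proj C) ∈ AlphaV.S)
    (h : flatPhrase w =
      x ++ [some A, some B] ++ y ++ [some A, some C] ++ z ++ [some B, some C] ++ t)
    (h' : flatPhrase w' =
      x ++ [some B, some A] ++ y ++ [some C, some A] ++ z ++ [some C, some B] ++ t) {E : L → G}
    (hE : Solves ⟨L, hL, proj, w, hw⟩ N m lam E) :
    ∃ E' : L → G, Solves ⟨L, hL, proj, w', hw'⟩ N m lam E' := by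
  classical
  have hcA := hw.count_flatPhrase A
  have hcB := hw.count_flatPhrase B
  have hcC := hw.count_flatPhrase C
  rw [h] at hcA hcB hcC
  have hAB : A ≠ B := by
    rintro rfl
    simp only [List.count_append, List.count_cons_self, List.count_nil, List.count_cons] at hcA
    omega
  have hAC : A ≠ C := by
    rintro rfl
    simp only [List.count_append, List.count_cons_self, List.count_nil, List.count_cons] at hcA
    omega
  have hBC : B ≠ C := by
    rintro rfl
    simp only [List.count_append, List.count_cons_self, List.count_nil, List.count_cons] at hcB
    omega
  simp only [List.count_append, List.count_cons, List.count_nil, beq_iff_eq, Option.some.injEq,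
    hAB, hAC, hBC, hAB.symm, hAC.symm, hBC.symm, if_true, if_false] at hcA hcB hcC
  have absent : ∀ D : L, x.count (some D) = 0 ∧ y.count (some D) = 0 ∧ z.count (some D) = 0 ∧
      t.count (some D) = 0 → some D ∉ x ∧ some D ∉ y ∧ some D ∉ z ∧ some D ∉ t := fun D hD =>
    ⟨List.count_eq_zero.mp hD.1, List.count_eq_zero.mp hD.2.1, List.count_eq_zero.mp hD.2.2.1,
      List.count_eq_zero.mp hD.2.2.2⟩
  have hA := absent A (by omega)
  have hB := absent B (by omega)
  have hC := absent C (by omega)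
  have noOcc : ∀ D : L, (some D ∉ x ∧ some D ∉ y ∧ some D ∉ z ∧ some D ∉ t) → ∀ i,
      (∀ k, ¬ OccursAt k x i D) ∧ (∀ k, ¬ OccursAt k y i D) ∧ (∀ k, ¬ OccursAt k z i D) ∧
        ∀ k, ¬ OccursAt k t i D := fun D hD i =>
    ⟨fun k h => hD.1 h.mem, fun k h => hD.2.1 h.mem, fun k h => hD.2.2.1 h.mem,
      fun k h => hD.2.2.2 h.mem⟩
  have hsA : status ⟨L, hL, proj, w, hw⟩ A =
      (noneCount x, noneCount x + noneCount y, proj A) := by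
    refine status_of_occursAt (by omega) fun i => ?_
    obtain ⟨h1, h2, h3, h4⟩ := noOcc A hA i
    simp [h, occursAt_append, OccursAt, h1, h2, h3, h4, hAB, hAC]
  have hsB : status ⟨L, hL, proj, w, hw⟩ B =
      (noneCount x, noneCount x + noneCount y + noneCount z, proj B) := by
    refine status_of_occursAt (by omega) fun i => ?_
    obtain ⟨h1, h2, h3, h4⟩ := noOcc B hB i
    simp [h, occursAt_append, OccursAt, h1, h2, h3, h4, hAB.symm, hBC, add_assoc]
  have hsC : status ⟨L, hL, proj, w, hw⟩ C =
      (noneCount x + noneCount y, noneCount x + noneCount y + noneCount z, proj C) := by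
    refine status_of_occursAt (by omega) fun i => ?_
    obtain ⟨h1, h2, h3, h4⟩ := noOcc C hC i
    simp [h, occursAt_append, OccursAt, h1, h2, h3, h4, hAC.symm, hBC.symm, add_assoc]
  have hst : status ⟨L, hL, proj, w', hw'⟩ = status ⟨L, hL, proj, w, hw⟩ := by
    funext D
    refine status_eq (fun i => ?_) rfl
    rw [← occursAt_flatPhrase, ← occursAt_flatPhrase]
    have hswap : ∀ (P Q : L) k, OccursAt k [some Q, some P] i D ↔ OccursAt k [some P, some Q] i D :=
      fun P Q k => by simp only [OccursAt, or_false]; exact or_comm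
    simp only [h, h', occursAt_append, noneCount_append, noneCount, hswap A B, hswap A C,
      hswap B C]
  obtain ⟨hb, hc', hsf⟩ := AlphaV.S_cases hS
  unfold Solves at hE ⊢
  rw [hst]
  simp only [h, h'] at hE ⊢
  have abs : ∀ D : L, (some D ∉ x ∧ some D ∉ y ∧ some D ∉ z ∧ some D ∉ t) → ∀ st i j k l,
      Absent D (crossings st i x) ∧ Absent D (crossings st j y) ∧ Absent D (crossings st k z) ∧
        Absent D (crossings st l t) := fun D hD st i j k l =>
    ⟨absent_crossings _ _ hD.1, absent_crossings _ _ hD.2.1, absent_crossings _ _ hD.2.2.1,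
      absent_crossings _ _ hD.2.2.2⟩
  simp only [crossings_append, noneCount_append, crossings, noneCount, crossingAt, hsA, hsB, hsC,
    hb, hc', Nat.add_zero, Nat.zero_add] at hE ⊢
  -- The bars in `y` and `z` decide which of the three strands share a component. If `y` has none,
  -- `A` is invisible and `B`, `C` join the same two components; if `z` has none, this holds for `C`
  -- and for `A`, `B`. If both have bars, the three components are distinct.
  by_cases hy : noneCount y = 0
  · by_cases hz : noneCount z = 0
    · refine ⟨E, ?_⟩
      simpa [hy, hz] using hE
    · simp [hy, hz] at hE ⊢
      have key := CrossingOk.swap_second (X := crossings _ 0 x)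
        (Y := crossings _ (noneCount x) y) (Z := crossings _ (noneCount x) z)
        (T := crossings _ (noneCount x + noneCount z) t) hc hm hBC
        ((barCount_crossings _ _ _).trans hy) (abs B hB _ _ _ _ _) (abs C hC _ _ _ _ _)
        (by simpa using hE)
      simpa using key
  · have h1 : noneCount x ≠ noneCount x + noneCount y + noneCount z := by omega
    by_cases hz : noneCount z = 0
    · simp [hy, hz] at hE ⊢
      have key := CrossingOk.swap_first (X := crossings _ 0 x)
        (Y := crossings _ (noneCount x) y) (Z := crossings _ (noneCount x + noneCount y) z)
        (T := crossings _ (noneCount x + noneCount y) t) hc hm hAB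
        ((barCount_crossings _ _ _).trans hz) (abs A hA _ _ _ _ _) (abs B hB _ _ _ _ _)
        (by simpa using hE)
      simpa using key
    · simp [hy, hz, h1, h1.symm] at hE ⊢
      have key := CrossingOk.triangle (X := crossings _ 0 x)
        (Y := crossings _ (noneCount x) y) (Z := crossings _ (noneCount x + noneCount y) z)
        (T := crossings _ (noneCount x + noneCount y + noneCount z) t) hc hm hsf hAB hAC hBC
        (abs A hA _ _ _ _ _) (abs B hB _ _ _ _ _) (abs C hC _ _ _ _ _) (by simpa using hE)
      simpa using key

end Moves
end Nanophrase

/-! ### Self-crossing moves, isomorphisms and shifts -/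

section BarFree

variable {G : Type*} [Group G] {L : Type} {N : ℕ → Subgroup G} {m lam : ℕ → G}

/-- Without bars, only the meridian of the current component matters. -/
theorem CrossingOk.congr_meridian {m' lam' : ℕ → G} {E : L → G} {s : ℕ × G}
    {x : List (Crossing L)} (hx : barCount x = 0) (hm : m' s.1 = m s.1)
    (h : CrossingOk N m lam E s x) : CrossingOk N m' lam' E s x := by
  induction x generalizing s with
  | nil => trivial
  | cons t x ih =>
    cases t with
    | bar => simp [barCount] at hx
    | above D => exact ⟨by simpa [CrossingOkAt, hm] using h.1, ih hx hm h.2⟩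
    | below D b => exact ⟨trivial, ih hx hm h.2⟩

/-- Without bars, a factor of the partial longitude can be moved to the meridian. -/
theorem CrossingOk.conj_meridian {m' lam' : ℕ → G} {E : L → G} {i : ℕ} {g h : G}
    {x : List (Crossing L)} (hx : barCount x = 0) (hm : m' i = g⁻¹ * m i * g)
    (hok : CrossingOk N m lam E (i, g * h) x) :
    CrossingOk N m' lam' E (i, h) x ∧
      crossingRun E (i, g * h) x = (i, g * (crossingRun E (i, h) x).2) := by
  induction x generalizing h with
  | nil => exact ⟨trivial, rfl⟩
  | cons t x ih =>
    cases t with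
    | bar => simp [barCount] at hx
    | above D =>
      obtain ⟨h1, h2⟩ := ih hx hok.2
      refine ⟨⟨?_, h1⟩, h2⟩
      have := hok.1
      simp only [CrossingOkAt] at this ⊢
      rw [this, hm]
      group
    | below D b =>
      have h2 : CrossingOk N m lam E (i, g * (h * signPow (E D) b)) x := by
        rw [← mul_assoc]; exact hok.2
      obtain ⟨h3, h4⟩ := ih hx h2
      refine ⟨⟨trivial, h3⟩, ?_⟩
      rw [← mul_assoc] at h4
      exact h4

theorem crossingAt_cases (st : L → ℕ × ℕ × AlphaV) (k : ℕ) (D : L) :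
    crossingAt st k D = [] ∨ crossingAt st k D = [.above D] ∨
      ∃ b, crossingAt st k D = [.below D b] := by
  unfold crossingAt firstOcc secondOcc
  split_ifs <;> simp

theorem noneCount_map_some (v : List L) : noneCount (v.map some) = 0 := by
  induction v with
  | nil => rfl
  | cons C v ih => simpa [noneCount] using ih

theorem IsGaussPhrase.sum_count [DecidableEq L] {n : ℕ} {w : Fin n → List L}
    (hw : IsGaussPhrase w) (A : L) : ∑ i, (w i).count A = 2 := by
  have h : (List.ofFn w).flatten.count A = 2 := by convert hw A
  rwa [List.count_flatten, List.map_ofFn, List.sum_ofFn] at h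

theorem IsGaussPhrase.eq_of_two_le_count [DecidableEq L] {n : ℕ} {w : Fin n → List L}
    (hw : IsGaussPhrase w) {A : L} {i j : Fin n} (hi : 2 ≤ (w i).count A) (hj : A ∈ w j) :
    j = i := by
  by_contra hne
  have h := hw.sum_count A
  have h1 : ∑ k ∈ {i, j}, (w k).count A ≤ ∑ k, (w k).count A :=
    Finset.sum_le_sum_of_subset (Finset.subset_univ _)
  rw [Finset.sum_pair (Ne.symm hne)] at h1
  have h2 : 0 < (w j).count A := List.count_pos_iff.mpr hj
  omega

end BarFree

namespace Nanophrase

variable {n : ℕ} {G : Type*} [Group G] {N : ℕ → Subgroup G} {m lam : ℕ → G}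

theorem solves_iff {p : Nanophrase AlphaV n} {E : p.Letter → G} :
    p.Solves N m lam E ↔ ∀ i : Fin n,
      CrossingOk N m lam E (i, 1) (crossings p.status i ((p.word i).map some)) ∧
      (crossingRun E ((i : ℕ), 1) (crossings p.status i ((p.word i).map some))).2⁻¹ * lam i ∈
        N i := by
  rw [Solves, flatPhrase, crossingOk_flatMap]
  simp only [List.length_ofFn, zero_add, List.getElem_ofFn]
  exact ⟨fun h i => h i i.2, fun h j hj => h ⟨j, hj⟩⟩

/-- A letter that occurs twice in one component has no crossing symbol. -/
theorem crossingAt_of_two_le_count {p : Nanophrase AlphaV n} [DecidableEq p.Letter] {A : p.Letter}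
    {i : Fin n} (h : 2 ≤ (p.word i).count A) (k : ℕ) : crossingAt p.status k A = [] := by
  have h1 : p.firstComp A = i :=
    p.gauss.eq_of_two_le_count h (mem_comps.1 (Finset.min'_mem _ (p.comps_nonempty A)))
  have h2 : p.secondComp A = i :=
    p.gauss.eq_of_two_le_count h (mem_comps.1 (Finset.max'_mem _ (p.comps_nonempty A)))
  simp [crossingAt, status, h1, h2]

/-- The projection of a letter enters the equations only through its crossing symbols, and the
letter concerned has none. -/
theorem solves_selfCrossing {L : Type} (hL : Finite L) (proj proj' : L → AlphaV)
    (w : Fin n → List L) (hw : IsGaussPhrase w) (k : Fin n) (A : L) (x y z : List L)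
    (h : w k = x ++ [A] ++ y ++ [A] ++ z) (hproj : ∀ B, B ≠ A → proj' B = proj B) {E : L → G}
    (hE : Solves ⟨L, hL, proj, w, hw⟩ N m lam E) :
    Solves ⟨L, hL, proj', w, hw⟩ N m lam E := by
  classical
  unfold Solves at hE ⊢
  rwa [crossings_congr (st' := status ⟨L, hL, proj', w, hw⟩) (st := status ⟨L, hL, proj, w, hw⟩)]
  intro i D _
  by_cases hD : D = A
  · subst hD
    have h2 : 2 ≤ (w k).count D := by
      rw [h]
      simp only [List.count_append, List.count_cons_self, List.count_nil]
      omega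
    rw [crossingAt_of_two_le_count (p := ⟨L, hL, proj', w, hw⟩) h2,
      crossingAt_of_two_le_count (p := ⟨L, hL, proj, w, hw⟩) h2]
  · have : status ⟨L, hL, proj', w, hw⟩ D = status ⟨L, hL, proj, w, hw⟩ D :=
      status_eq (fun _ => Iff.rfl) (hproj D hD)
    simp only [crossingAt, this]

theorem solves_iso {p q : Nanophrase AlphaV n} (f : p.Letter ≃ q.Letter)
    (hproj : ∀ A, q.proj (f A) = p.proj A) (hword : ∀ i, q.word i = (p.word i).map f)
    {E : p.Letter → G} (hE : p.Solves N m lam E) : q.Solves N m lam (E ∘ f.symm) := by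
  refine Solves.of_map f.symm (fun D => ?_) ?_
  · refine status_eq (fun i => ?_) ?_
    · rw [hword]
      simp only [List.mem_map]
      constructor
      · rintro ⟨C, hC, rfl⟩
        simpa using hC
      · intro h
        exact ⟨_, h, by simp⟩
    · rw [← hproj]; simp
  · have : (flatPhrase q.word).map (Option.map f.symm) = flatPhrase p.word := by
      have hq : q.word = fun i => (p.word i).map f := funext hword
      have : ∀ ws : List (List p.Letter),
          ((ws.map (List.map f)).flatMap fun v => v.map some ++ [none]).map (Option.map f.symm) =
            ws.flatMap fun v => v.map some ++ [none] := by
        intro ws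
        induction ws with
        | nil => rfl
        | cons v ws ih =>
          rw [List.map_cons, List.flatMap_cons, List.map_append, ih, List.flatMap_cons]
          simp [Function.comp_def]
      rw [flatPhrase, hq, flatPhrase, ← this, List.map_ofFn]
      rfl
    rw [this]
    exact hE

/-- A shift conjugates the meridian and the longitude of the component if the letter is signed; it
changes nothing else, provided that meridian and longitude commute. -/
theorem solves_shift [∀ j, (N j).Normal] (hc : ∀ j, ∀ a ∈ N j, ∀ b ∈ N j, a * b = b * a)
    (hm : ∀ j, m j ∈ N j) (hcomm : ∀ j, m j * lam j = lam j * m j)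
    {L : Type} (hL : Finite L) (proj proj' : L → AlphaV) (w w' : Fin n → List L)
    (hw : IsGaussPhrase w) (hw' : IsGaussPhrase w') (i : Fin n) (A : L) (x : List L)
    (h : w i = A :: x) (h' : w' i = x ++ [A]) (hne : ∀ j, j ≠ i → w' j = w j)
    (hA' : A ∉ x → proj' A = proj A)
    (hproj : ∀ B, B ≠ A → proj' B = proj B) {E : L → G}
    (hE : Solves ⟨L, hL, proj, w, hw⟩ N m lam E) :
    ∃ (i : ℕ) (g : G), Solves ⟨L, hL, proj', w', hw'⟩ N
      (Function.update m i (g⁻¹ * m i * g)) (Function.update lam i (g⁻¹ * lam i * g)) E := by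
  classical
  have hmem : ∀ (D : L) j, D ∈ w' j ↔ D ∈ w j := by
    intro D j
    by_cases hj : j = i
    · subst hj
      rw [h, h']
      simp [or_comm]
    · rw [hne j hj]
  have hat : ∀ k D, crossingAt (status ⟨L, hL, proj', w', hw'⟩) k D =
      crossingAt (status ⟨L, hL, proj, w, hw⟩) k D := by
    intro k D
    -- Only a letter with both occurrences in the shifted component changes its projection by ν, and
    -- such a letter has no crossing symbol.
    by_cases hD : D = A ∧ D ∈ x
    · obtain ⟨rfl, hx⟩ := hD
      have h0 : 0 < x.count D := List.count_pos_iff.mpr hx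
      rw [crossingAt_of_two_le_count (p := ⟨L, hL, proj', w', hw'⟩) (i := i)
          (by simp only [h', List.count_append, List.count_cons_self, List.count_nil]; omega),
        crossingAt_of_two_le_count (p := ⟨L, hL, proj, w, hw⟩) (i := i)
          (by simp only [h, List.count_cons_self]; omega)]
    · have : status ⟨L, hL, proj', w', hw'⟩ D = status ⟨L, hL, proj, w, hw⟩ D := by
        refine status_eq (hmem D) ?_
        by_cases hDA : D = A
        · subst hDA
          exact hA' fun hx => hD ⟨rfl, hx⟩
        · exact hproj D hDA
      simp only [crossingAt, this]
  have hcr : ∀ k y, crossings (status ⟨L, hL, proj', w', hw'⟩) k y =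
      crossings (status ⟨L, hL, proj, w, hw⟩) k y := fun k y =>
    crossings_congr k fun i D _ => hat i D
  rw [solves_iff] at hE
  simp only [solves_iff, hcr]
  obtain ⟨h1, h2⟩ := hE i
  simp only [h, List.map_cons, crossings] at h1 h2
  have hbar : ∀ k (v : List L), barCount (crossings (status ⟨L, hL, proj, w, hw⟩) k (v.map some)) = 0 :=
    fun k v => by rw [barCount_crossings, noneCount_map_some]
  rcases crossingAt_cases (status ⟨L, hL, proj, w, hw⟩) i A with hcase | hcase | ⟨b, hcase⟩
  -- An invisible letter requires no conjugation; the pair `0`, `1` encodes the trivial one.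
  · refine ⟨0, 1, fun j => ?_⟩
    simp only [inv_one, one_mul, mul_one, Function.update_eq_self]
    by_cases hj : j = i
    · subst hj
      simpa [h', crossings_append, crossings, noneCount_map_some, hcase] using And.intro h1 h2
    · simpa [hne j hj] using hE j
  · refine ⟨0, 1, fun j => ?_⟩
    simp only [inv_one, one_mul, mul_one, Function.update_eq_self]
    by_cases hj : j = i
    · subst hj
      rw [hcase] at h1 h2
      simp only [List.cons_append, List.nil_append, CrossingOk, CrossingOkAt, crossingStep,
        crossingRun, inv_one, one_mul, mul_one] at h1 h2
      simp only [h', List.map_append, crossings_append, crossings, List.map_cons, List.map_nil,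
        noneCount_map_some, hcase, crossingOk_append, crossingRun_append, CrossingOk, CrossingOkAt,
        crossingRun, crossingStep, List.append_nil, Nat.add_zero, and_true]
      refine ⟨⟨h1.2, ?_⟩, h2⟩
      have hfst := crossingRun_fst E ((j : ℕ), (1 : G))
        (crossings (status ⟨L, hL, proj, w, hw⟩) j (x.map some))
      rw [hbar, Nat.add_zero] at hfst
      -- At the start of the component the value of `A` is the meridian itself, at the end it must
      -- be the meridian conjugated by the complete longitude. The latter may be replaced by `lam
      -- j`, which commutes with the meridian.
      rw [hfst, h1.1, conj_eq_of_cong (hc j) (hm j) h2, mul_assoc, hcomm, inv_mul_cancel_left]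
    · simpa [hne j hj] using hE j
  -- Moving the initial factor `g` of the longitude to its end conjugates the longitude by `g`. The
  -- later occurrences of sign zero lose `g` from their partial longitudes, so the meridian is
  -- conjugated by `g` as well.
  · refine ⟨i, signPow (E A) b, fun j => ?_⟩
    by_cases hj : j = i
    · subst hj
      rw [hcase] at h1 h2
      simp only [List.cons_append, List.nil_append, CrossingOk, CrossingOkAt, crossingStep,
        crossingRun, one_mul, true_and] at h1 h2
      rw [← mul_one (signPow (E A) b)] at h1
      obtain ⟨h3, h4⟩ := h1.conj_meridian
        (m' := Function.update m j ((signPow (E A) b)⁻¹ * m j * signPow (E A) b))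
        (lam' := Function.update lam j ((signPow (E A) b)⁻¹ * lam j * signPow (E A) b))
        (hbar _ _) (by simp)
      rw [mul_one] at h4
      rw [h4] at h2
      simp only [h', List.map_append, crossings_append, crossings, List.map_cons, List.map_nil,
        noneCount_map_some, hcase, crossingOk_append, crossingRun_append, CrossingOk, CrossingOkAt,
        crossingRun, crossingStep, List.append_nil, Nat.add_zero, and_true, Function.update_self]
      refine ⟨h3, ?_⟩
      have := (inferInstance : (N j).Normal).conj_mem _ h2 (signPow (E A) b)⁻¹
      simpa [mul_assoc] using this
    · obtain ⟨h3, h4⟩ := hE j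
      have hj' : (j : ℕ) ≠ i := fun hji => hj (Fin.ext hji)
      rw [hne j hj, Function.update_of_ne hj']
      exact ⟨h3.congr_meridian (hbar _ _) (by rw [Function.update_of_ne hj']), h4⟩

/-- Every move transports solutions, up to a conjugation of one meridian and its longitude. -/
theorem Solves.of_mMove [∀ j, (N j).Normal] (hc : ∀ j, ∀ a ∈ N j, ∀ b ∈ N j, a * b = b * a)
    (hm : ∀ j, m j ∈ N j) (hcomm : ∀ j, m j * lam j = lam j * m j)
    {p q : Nanophrase AlphaV n} (hpq : MMove virtualData p q) {E : p.Letter → G}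
    (hE : p.Solves N m lam E) :
    ∃ (i : ℕ) (g : G) (E' : q.Letter → G), q.Solves N
      (Function.update m i (g⁻¹ * m i * g)) (Function.update lam i (g⁻¹ * lam i * g)) E' := by
  have of_eq : ∀ E' : q.Letter → G, q.Solves N m lam E' → ∃ (i : ℕ) (g : G) (E' : q.Letter → G),
      q.Solves N (Function.update m i (g⁻¹ * m i * g))
        (Function.update lam i (g⁻¹ * lam i * g)) E' := fun E' hE' => ⟨0, 1, E', by simpa using hE'⟩
  cases hpq with
  | iso _ _ f hproj hword => exact of_eq _ (solves_iso f hproj hword hE)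
  | h1 hL proj w hw A hL' w' hw' x y h h' =>
    exact of_eq _ (solves_h1 hL proj w hw A hL' w' hw' x y h h' hE)
  | h2 hL proj w hw A B hL' w' hw' x y z hAB h h' =>
    exact of_eq _ (solves_h2 hc hm hL proj w hw A B hL' w' hw' x y z hAB h h' hE)
  | h3 hL proj w w' hw hw' A B C x y z t hS h h' =>
    obtain ⟨E', hE'⟩ := solves_h3 hc hm hL proj w w' hw hw' A B C x y z t hS h h' hE
    exact of_eq E' hE'
  | shift hL proj proj' w w' hw hw' i A x h h' hne hA hA' hproj =>
    obtain ⟨j, g, h⟩ := solves_shift hc hm hcomm hL proj proj' w w' hw hw' i A x h h' hne hA'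
      hproj hE
    exact ⟨j, g, E, h⟩
  | selfCrossing hL proj proj' w hw k A x y z h hA hproj =>
    exact of_eq _ (solves_selfCrossing hL proj proj' w hw k A x y z h hproj hE)

end Nanophrase

/-! ### Solutions and the words `ρ^q` -/

/-- The product of the values of the letters of a signed word. -/
def wordVal {G : Type*} [Group G] {L : Type*} (E : L → G) (l : List (L × Bool)) : G :=
  (l.map fun a => signPow (E a.1) a.2).prod

section WordVal

variable {G : Type*} [Group G] {L : Type*} (E : L → G)

@[simp] theorem wordVal_nil : wordVal E [] = 1 := rfl

theorem wordVal_cons (a : L × Bool) (l : List (L × Bool)) :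
    wordVal E (a :: l) = signPow (E a.1) a.2 * wordVal E l := by simp [wordVal]

theorem wordVal_append (l l' : List (L × Bool)) :
    wordVal E (l ++ l') = wordVal E l * wordVal E l' := by simp [wordVal]

theorem signPow_not (g : G) (b : Bool) : signPow g (!b) = (signPow g b)⁻¹ := by
  cases b <;> simp

theorem wordVal_invRev (l : List (L × Bool)) :
    wordVal E (FreeGroup.invRev l) = (wordVal E l)⁻¹ := by
  induction l with
  | nil => simp [FreeGroup.invRev]
  | cons a l ih =>
    have e : FreeGroup.invRev (a :: l) = FreeGroup.invRev l ++ [(a.1, !a.2)] := by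
      simp [FreeGroup.invRev]
    rw [e, wordVal_append, ih, wordVal_cons, wordVal_cons, wordVal_nil, signPow_not]
    simp

end WordVal

theorem List.exists_eq_takeWhile_append {L : Type*} [DecidableEq L] {v : List L} {D : L}
    (h : D ∈ v) : ∃ r, v = v.takeWhile (fun B => decide (B ≠ D)) ++ D :: r := by
  induction v with
  | nil => simp at h
  | cons C v ih =>
    by_cases hC : C = D
    · exact ⟨v, by simp [hC]⟩
    · obtain ⟨r, hr⟩ := ih ((List.mem_cons.mp h).resolve_left (Ne.symm hC))
      exact ⟨r, by rw [List.takeWhile_cons_of_pos (by simpa using hC), List.cons_append, ← hr]⟩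

theorem List.takeWhile_ne_append_cons {L : Type*} [DecidableEq L] {l r : List L} {D : L}
    (h : D ∉ l) : (l ++ D :: r).takeWhile (fun B => decide (B ≠ D)) = l := by
  induction l with
  | nil => simp
  | cons C l ih =>
    simp only [List.mem_cons, not_or] at h
    rw [List.cons_append, List.takeWhile_cons_of_pos (by simpa using Ne.symm h.1), ih h.2]

namespace Nanophrase

variable {n : ℕ} {p : Nanophrase AlphaV n}

variable (p) in
/-- The letter connects two distinct components. -/
def IsMixed (D : p.Letter) : Prop := p.firstComp D ≠ p.secondComp D

theorem mem_word_firstComp (D : p.Letter) : D ∈ p.word (p.firstComp D) :=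
  mem_comps.1 (Finset.min'_mem _ (p.comps_nonempty D))

theorem mem_word_secondComp (D : p.Letter) : D ∈ p.word (p.secondComp D) :=
  mem_comps.1 (Finset.max'_mem _ (p.comps_nonempty D))

theorem firstComp_le {D : p.Letter} {i : Fin n} (h : D ∈ p.word i) : p.firstComp D ≤ i :=
  Finset.min'_le _ _ (mem_comps.2 h)

theorem le_secondComp {D : p.Letter} {i : Fin n} (h : D ∈ p.word i) : i ≤ p.secondComp D :=
  Finset.le_max' _ _ (mem_comps.2 h)

theorem eq_firstComp_or_secondComp {D : p.Letter} {i : Fin n} (h : D ∈ p.word i) :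
    i = p.firstComp D ∨ i = p.secondComp D := by
  classical
  by_contra! hne
  have h1 : p.firstComp D < i := lt_of_le_of_ne (firstComp_le h) hne.1.symm
  have h2 : i < p.secondComp D := lt_of_le_of_ne (le_secondComp h) hne.2
  have hs := p.gauss.sum_count D
  have hle : ∑ k ∈ {p.firstComp D, i, p.secondComp D}, (p.word k).count D ≤
      ∑ k, (p.word k).count D := Finset.sum_le_sum_of_subset (Finset.subset_univ _)
  rw [Finset.sum_insert (by simp [h1.ne, (h1.trans h2).ne]), Finset.sum_pair h2.ne] at hle
  have e1 := List.count_pos_iff.mpr (mem_word_firstComp D)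
  have e2 := List.count_pos_iff.mpr (mem_word_secondComp D)
  have e3 := List.count_pos_iff.mpr h
  omega

theorem exists_lt_mem_word {D : p.Letter} {i : Fin n} :
    (∃ k, i < k ∧ D ∈ p.word k) ↔ i < p.secondComp D :=
  ⟨fun ⟨_, hk, hD⟩ => hk.trans_le (le_secondComp hD), fun h => ⟨_, h, mem_word_secondComp D⟩⟩

theorem exists_gt_mem_word {D : p.Letter} {i : Fin n} :
    (∃ k, k < i ∧ D ∈ p.word k) ↔ p.firstComp D < i :=
  ⟨fun ⟨_, hk, hD⟩ => (firstComp_le hD).trans_lt hk, fun h => ⟨_, h, mem_word_firstComp D⟩⟩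

theorem firstComp_lt_secondComp {D : p.Letter} (h : p.IsMixed D) :
    p.firstComp D < p.secondComp D :=
  lt_of_le_of_ne (firstComp_le (mem_word_secondComp D)) h

theorem etaIndex_eq (D : p.Letter) :
    p.etaIndex D = if (p.proj D).signedFirst then p.secondComp D else p.firstComp D := by
  unfold etaIndex
  cases p.proj D <;> rfl

theorem mem_word_etaIndex (D : p.Letter) : D ∈ p.word (p.etaIndex D) := by
  rw [etaIndex_eq]
  split_ifs
  · exact mem_word_secondComp D
  · exact mem_word_firstComp D

open Classical in
theorem signedLetter_eq (D : p.Letter) (i : Fin n) : p.signedLetter i D =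
    if (i < p.secondComp D ∧ p.proj D = AlphaV.bPlus) ∨
      (p.firstComp D < i ∧ p.proj D = AlphaV.aPlus) then [(D, true)]
    else if (i < p.secondComp D ∧ p.proj D = AlphaV.aMinus) ∨
      (p.firstComp D < i ∧ p.proj D = AlphaV.bMinus) then [(D, false)] else [] := by
  unfold signedLetter
  refine if_congr ?_ rfl (if_congr ?_ rfl rfl) <;> rw [exists_lt_mem_word, exists_gt_mem_word]

/-- The crossing symbol of an occurrence and its sign. -/
theorem crossingAt_eq {D : p.Letter} {i : Fin n} (h : D ∈ p.word i) :
    (¬ p.IsMixed D ∧ p.signedLetter i D = [] ∧ crossingAt p.status i D = []) ∨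
    (p.IsMixed D ∧ p.etaIndex D = i ∧ p.signedLetter i D = [] ∧
      crossingAt p.status i D = [.above D]) ∨
    (p.IsMixed D ∧ p.etaIndex D ≠ i ∧ ∃ b, p.signedLetter i D = [(D, b)] ∧
      crossingAt p.status i D = [.below D b]) := by
  rw [etaIndex_eq, signedLetter_eq]
  simp only [crossingAt, status, Fin.val_inj]
  by_cases hmix : p.IsMixed D
  · have hlt := firstComp_lt_secondComp hmix
    rw [if_neg hmix.symm.symm]
    simp only [hmix, not_true_eq_false, false_and, true_and, false_or]
    rcases eq_firstComp_or_secondComp h with rfl | rfl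
    · cases p.proj D <;> simp [AlphaV.signedFirst, firstOcc, AlphaV.isB, hlt, hlt.ne']
    · cases p.proj D <;>
        simp [AlphaV.signedFirst, secondOcc, AlphaV.isB, hlt, hlt.ne, hlt.ne']
  · have heq : p.firstComp D = p.secondComp D := not_not.mp hmix
    have hi : i = p.secondComp D := by
      rcases eq_firstComp_or_secondComp h with h | h
      · rw [h, heq]
      · exact h
    left
    simp [hmix, heq, hi]

variable {G : Type*} [Group G] {N : ℕ → Subgroup G} {m lam : ℕ → G}

/-- The bridge to the definition of μ: reading crossing symbols multiplies the values of the signed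
word. -/
theorem crossingRun_word (E : p.Letter → G) {i : Fin n} {v : List p.Letter}
    (hv : ∀ D ∈ v, D ∈ p.word i) (g : G) :
    crossingRun E ((i : ℕ), g) (crossings p.status i (v.map some)) =
      ((i : ℕ), g * wordVal E (v.flatMap (p.signedLetter i))) := by
  induction v generalizing g with
  | nil => simp [crossings, crossingRun]
  | cons D v ih =>
    have hv' : ∀ C ∈ v, C ∈ p.word i := fun C hC => hv C (by simp [hC])
    rw [List.map_cons, crossings, crossingRun_append, List.flatMap_cons, wordVal_append]
    rcases crossingAt_eq (hv D (by simp)) with ⟨-, h1, h2⟩ | ⟨-, -, h1, h2⟩ | ⟨-, -, b, h1, h2⟩ <;>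
      simp [h1, h2, crossingRun, crossingStep, ih hv', wordVal_cons, mul_assoc]

theorem crossingOk_word {E : p.Letter → G} {i : Fin n} {v : List p.Letter}
    (hv : ∀ D ∈ v, D ∈ p.word i) (g : G) :
    CrossingOk N m lam E ((i : ℕ), g) (crossings p.status i (v.map some)) ↔
      ∀ l D r, v = l ++ D :: r → p.IsMixed D → p.etaIndex D = i →
        E D = (g * wordVal E (l.flatMap (p.signedLetter i)))⁻¹ * m i *
          (g * wordVal E (l.flatMap (p.signedLetter i))) := by
  induction v generalizing g with
  | nil => simp [crossings, CrossingOk]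
  | cons D v ih =>
    have hv' : ∀ C ∈ v, C ∈ p.word i := fun C hC => hv C (by simp [hC])
    have hD : CrossingOk N m lam E ((i : ℕ), g) (crossingAt p.status i D) ↔
        (p.IsMixed D → p.etaIndex D = i → E D = g⁻¹ * m i * g) := by
      rcases crossingAt_eq (hv D (by simp)) with
        ⟨h0, h1, h2⟩ | ⟨h0, h0', h1, h2⟩ | ⟨h0, h0', b, h1, h2⟩
      · simp [h0, h2, CrossingOk]
      · simp [h0, h2, CrossingOk, CrossingOkAt, h0']
      · simp [h2, CrossingOk, CrossingOkAt, h0']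
    have hrun : crossingRun E ((i : ℕ), g) (crossingAt p.status i D) =
        ((i : ℕ), g * wordVal E (p.signedLetter i D)) := by
      simpa [crossings] using crossingRun_word (p := p) E (v := [D])
        (fun C hC => hv C (by simp at hC; simp [hC])) g
    rw [List.map_cons, crossings, crossingOk_append, hD, hrun, ih hv']
    constructor
    · rintro ⟨h1, h2⟩ l C r hl hmix heta
      cases l with
      | nil =>
        simp only [List.nil_append, List.cons.injEq] at hl
        obtain ⟨rfl, rfl⟩ := hl
        simpa using h1 hmix heta
      | cons B l =>
        simp only [List.cons_append, List.cons.injEq] at hl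
        obtain ⟨rfl, rfl⟩ := hl
        simpa [wordVal_append, mul_assoc] using h2 l C r rfl hmix heta
    · intro h
      refine ⟨fun h1 h2 => by simpa using h [] D v rfl h1 h2, fun l C r hl h1 h2 => ?_⟩
      simpa [wordVal_append, mul_assoc] using h (D :: l) C r (by simp [hl]) h1 h2

/-- Solutions in terms of the truncated signed words. -/
theorem solves_iff_truncWord {E : p.Letter → G} :
    p.Solves N m lam E ↔
      (∀ D, p.IsMixed D → E D = (wordVal E (p.truncWord D))⁻¹ * m (p.etaIndex D) *
        wordVal E (p.truncWord D)) ∧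
      ∀ i : Fin n, (wordVal E (p.signedWord i))⁻¹ * lam i ∈ N i := by
  classical
  rw [solves_iff]
  simp only [crossingRun_word E (fun D hD => hD), crossingOk_word (fun D hD => hD), one_mul]
  constructor
  · intro h
    refine ⟨fun D hD => ?_, fun i => (h i).2⟩
    obtain ⟨r, hr⟩ := List.exists_eq_takeWhile_append (mem_word_etaIndex D)
    have := (h (p.etaIndex D)).1 _ D r hr hD rfl
    unfold truncWord
    convert this
  · rintro ⟨h1, h2⟩ i
    refine ⟨fun l D r hl hD hi => ?_, h2 i⟩
    -- A letter joining two components occurs only once in each of them, so the prefix before this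
    -- occurrence is the one that `truncWord` takes.
    have hDl : D ∉ l := by
      intro hDl
      have h3 : 2 ≤ (p.word i).count D := by
        have := List.count_pos_iff.mpr hDl
        rw [hl, List.count_append, List.count_cons_self]
        omega
      exact hD ((p.gauss.eq_of_two_le_count h3 (mem_word_firstComp D)).trans
        (p.gauss.eq_of_two_le_count h3 (mem_word_secondComp D)).symm)
    have h3 : p.truncWord D = l.flatMap (p.signedLetter i) := by
      unfold truncWord
      rw [hi, hl]
      congr 1
      convert List.takeWhile_ne_append_cons hDl
    have h4 := h1 D hD
    rwa [h3, hi] at h4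

/-- All letters of a signed word connect distinct components. -/
theorem isMixed_of_mem_flatMap {i : Fin n} {v : List p.Letter} (hv : ∀ D ∈ v, D ∈ p.word i) :
    ∀ a ∈ v.flatMap (p.signedLetter i), p.IsMixed a.1 := by
  intro a ha
  rw [List.mem_flatMap] at ha
  obtain ⟨D, hD, ha⟩ := ha
  rcases crossingAt_eq (hv D hD) with ⟨-, h1, h2⟩ | ⟨-, -, h1, h2⟩ | ⟨h0, -, b, h1, h2⟩
  · simp [h1] at ha
  · simp [h1] at ha
  · simp only [h1, List.mem_singleton] at ha
    rwa [ha]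

theorem isMixed_of_mem_signedWord {i : Fin n} : ∀ a ∈ p.signedWord i, p.IsMixed a.1 :=
  isMixed_of_mem_flatMap fun _ hD => hD

theorem isMixed_of_mem_truncWord {D : p.Letter} : ∀ a ∈ p.truncWord D, p.IsMixed a.1 := by
  classical
  exact isMixed_of_mem_flatMap fun _ hC => (List.takeWhile_sublist _).mem hC

theorem rho_singleton_not (d : ℕ) (D : p.Letter) :
    p.rho d [(D, false)] = FreeGroup.invRev (p.rho d [(D, true)]) := by
  rw [← rho_invRev]
  simp [FreeGroup.invRev]

/-- The value of `ρ^q` of a word, letter by letter. -/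
theorem wordVal_eta_rho (mm : Fin n → G) (d : ℕ) (l : List (p.Letter × Bool)) :
    wordVal mm (p.eta (p.rho d l)) =
      wordVal (fun D => wordVal mm (p.eta (p.rho d [(D, true)]))) l := by
  induction l with
  | nil => simp [rho_nil, eta]
  | cons a l ih =>
    rw [show a :: l = [a] ++ l from rfl, rho_append, eta_append, wordVal_append, ih,
      wordVal_append]
    congr 1
    obtain ⟨D, b⟩ := a
    cases b
    · rw [rho_singleton_not, eta_invRev, wordVal_invRev]
      simp [wordVal_cons]
    · simp [wordVal_cons]

theorem wordVal_eta_rho_succ (mm : Fin n → G) (d : ℕ) (D : p.Letter) :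
    wordVal mm (p.eta (p.rho (d + 1) [(D, true)])) =
      (wordVal mm (p.eta (p.rho d (p.truncWord D))))⁻¹ * mm (p.etaIndex D) *
        wordVal mm (p.eta (p.rho d (p.truncWord D))) := by
  simp only [rho, List.flatMap_cons, List.flatMap_nil, List.append_nil, eta_append, wordVal_append,
    rho_invRev, eta_invRev, wordVal_invRev]
  simp [eta, wordVal_cons]

/-- If the values of the words `ρ^q` are stable, they form a solution. -/
theorem solves_rho {d : ℕ}
    (h : ∀ D : p.Letter, wordVal (fun h : Fin n => m h) (p.eta (p.rho (d + 1) [(D, true)])) =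
      wordVal (fun h : Fin n => m h) (p.eta (p.rho d [(D, true)])))
    (hlam : ∀ i : Fin n, lam i = wordVal (fun h : Fin n => m h) (p.eta (p.rho d (p.signedWord i)))) :
    p.Solves N m lam fun D => wordVal (fun h : Fin n => m h) (p.eta (p.rho d [(D, true)])) := by
  rw [solves_iff_truncWord]
  refine ⟨fun D _ => ?_, fun i => ?_⟩
  · rw [← h, wordVal_eta_rho_succ, wordVal_eta_rho]
  · rw [hlam, ← wordVal_eta_rho, inv_mul_cancel]
    exact (N i).one_mem

/-- The values of a solution are approximated by those of the words `ρ^q`. -/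
theorem Solves.approx {E : p.Letter → G} (hE : p.Solves N m lam E) (Γ : ℕ → Subgroup G)
    [∀ q, (Γ q).Normal] (h0 : Γ 0 = ⊤)
    (hΓ : ∀ q k, ∀ g ∈ Γ q, (m k)⁻¹ * (g⁻¹ * m k * g) ∈ Γ (q + 1)) (q : ℕ)
    {l : List (p.Letter × Bool)} (hl : ∀ a ∈ l, p.IsMixed a.1) :
    ((wordVal (fun h : Fin n => m h) (p.eta (p.rho q l)) : G) : G ⧸ Γ (q + 1)) = (wordVal E l : G) := by
  have key : ∀ q, (∀ D, p.IsMixed D →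
      ((wordVal (fun h : Fin n => m h) (p.eta (p.rho q [(D, true)])) : G) : G ⧸ Γ (q + 1)) = E D) →
      ∀ l : List (p.Letter × Bool), (∀ a ∈ l, p.IsMixed a.1) →
      ((wordVal (fun h : Fin n => m h) (p.eta (p.rho q l)) : G) : G ⧸ Γ (q + 1)) = (wordVal E l : G) := by
    intro q hq l hl
    rw [wordVal_eta_rho]
    induction l with
    | nil => simp
    | cons a l ih =>
      rw [wordVal_cons, wordVal_cons, QuotientGroup.mk_mul, QuotientGroup.mk_mul,
        ih fun b hb => hl b (by simp [hb])]
      congr 1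
      have := hq a.1 (hl a (by simp))
      cases a.2
      · simp only [signPow_false, QuotientGroup.mk_inv, this]
      · simpa using this
  refine key q ?_ l hl
  -- Commutators with meridians raise the level of the filtration. Hence conjugates of a meridian by
  -- elements congruent at level `q` are congruent at level `q + 1`, which is the gain in each
  -- round.
  have conj : ∀ q k (g h : G), ((g : G ⧸ Γ q) = h) →
      ((g⁻¹ * m k * g : G) : G ⧸ Γ (q + 1)) = (h⁻¹ * m k * h : G) := by
    intro q k g h hgh
    rw [QuotientGroup.eq] at hgh ⊢
    have h1 := (inferInstance : (Γ q).Normal).conj_mem _ hgh g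
    have h2 := (inferInstance : (Γ (q + 1)).Normal).conj_mem _ (hΓ q k _ h1) g⁻¹
    simpa [mul_assoc] using h2
  intro D hD
  rw [(solves_iff_truncWord.1 hE).1 D hD]
  induction q generalizing D with
  | zero =>
    -- At level `0` all elements are congruent, so even the conjugator `1`, which gives the value of
    -- ρ², is good enough.
    have := conj 0 (p.etaIndex D) 1 (wordVal E (p.truncWord D))
      (by rw [QuotientGroup.eq, h0]; trivial)
    simpa [rho, eta, wordVal_cons] using this
  | succ q ih =>
    rw [wordVal_eta_rho_succ]
    refine conj _ _ _ _ (key q (fun C hC => ?_) _ isMixed_of_mem_truncWord)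
    rw [(solves_iff_truncWord.1 hE).1 C hC]
    exact ih C hC

end Nanophrase

/-! ### Congruences between formal power series -/

/-- A set of monomials that contains the prefixes and suffixes of its elements. -/
def FactorClosed {σ : Type*} (V : Set (List σ)) : Prop :=
  ∀ c ∈ V, ∀ k, c.take k ∈ V ∧ c.drop k ∈ V

namespace NCSeries

variable {σ : Type*}

/-- The coefficients of the monomials of `V` are divisible by `M`. -/
def Vanish (M : ℕ) (V : Set (List σ)) (f : NCSeries σ) : Prop :=
  ∀ c ∈ V, (f.coeff c : ZMod M) = 0

theorem Vanish.add {M : ℕ} {V : Set (List σ)} {f g : NCSeries σ} (hf : Vanish M V f)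
    (hg : Vanish M V g) : Vanish M V (f + g) := fun c hc => by
  rw [coeff_add, Int.cast_add, hf c hc, hg c hc, add_zero]

theorem Vanish.neg {M : ℕ} {V : Set (List σ)} {f : NCSeries σ} (hf : Vanish M V f) :
    Vanish M V (-f) := fun c hc => by
  rw [coeff_neg, Int.cast_neg, hf c hc, neg_zero]

theorem Vanish.sub {M : ℕ} {V : Set (List σ)} {f g : NCSeries σ} (hf : Vanish M V f)
    (hg : Vanish M V g) : Vanish M V (f - g) := fun c hc => by
  rw [coeff_sub, Int.cast_sub, hf c hc, hg c hc, sub_zero]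

theorem Vanish.mul {M : ℕ} {V V' W : Set (List σ)} {f g : NCSeries σ} (hf : Vanish M V f)
    (hg : Vanish M V' g) (hW : ∀ c ∈ W, ∀ k, c.take k ∈ V ∨ c.drop k ∈ V') :
    Vanish M W (f * g) := by
  intro c hc
  rw [coeff_mul, Int.cast_sum]
  refine Finset.sum_eq_zero fun k _ => ?_
  rw [Int.cast_mul]
  rcases hW c hc k with h | h
  · rw [hf _ h, zero_mul]
  · rw [hg _ h, mul_zero]

theorem vanish_empty (M : ℕ) (f : NCSeries σ) : Vanish M ∅ f := fun _ hc => hc.elim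

theorem Vanish.mul_left {M : ℕ} {V : Set (List σ)} (hV : FactorClosed V) {f : NCSeries σ}
    (hf : Vanish M V f) (g : NCSeries σ) : Vanish M V (g * f) :=
  (vanish_empty M g).mul hf fun c hc k => Or.inr (hV c hc k).2

theorem Vanish.mul_right {M : ℕ} {V : Set (List σ)} (hV : FactorClosed V) {f : NCSeries σ}
    (hf : Vanish M V f) (g : NCSeries σ) : Vanish M V (f * g) :=
  hf.mul (vanish_empty M g) fun c hc k => Or.inl (hV c hc k).1

theorem Vanish.mono {M : ℕ} {V W : Set (List σ)} {f : NCSeries σ} (hf : Vanish M W f)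
    (h : V ⊆ W) : Vanish M V f := fun c hc => hf c (h hc)

/-- The units that are congruent to `1`. -/
def congSubgroup (M : ℕ) (V : Set (List σ)) (hV : FactorClosed V) : Subgroup (NCSeries σ)ˣ where
  carrier := {g | Vanish M V ((g : NCSeries σ) - 1)}
  one_mem' := by
    intro c _
    simp [coeff_zero]
  mul_mem' := by
    intro g h hg hh
    have e : ((g * h : (NCSeries σ)ˣ) : NCSeries σ) - 1 = (g - 1) * h + (h - 1) := by
      push_cast; noncomm_ring
    simp only [Set.mem_ofPred_eq, e]
    exact (Vanish.mul_right hV hg _).add hh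
  inv_mem' := by
    intro g hg
    have e : ((g⁻¹ : (NCSeries σ)ˣ) : NCSeries σ) - 1 = -(((g⁻¹ : (NCSeries σ)ˣ) : NCSeries σ) *
        ((g : NCSeries σ) - 1)) := by
      rw [mul_sub, Units.inv_mul, mul_one]; abel
    simp only [Set.mem_ofPred_eq, e]
    exact (Vanish.mul_left hV hg _).neg

theorem mem_congSubgroup {M : ℕ} {V : Set (List σ)} {hV : FactorClosed V} {g : (NCSeries σ)ˣ} :
    g ∈ congSubgroup M V hV ↔ Vanish M V ((g : NCSeries σ) - 1) := Iff.rfl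

instance congSubgroup_normal (M : ℕ) (V : Set (List σ)) (hV : FactorClosed V) :
    (congSubgroup M V hV).Normal where
  conj_mem := by
    intro g hg h
    have e : ((h * g * h⁻¹ : (NCSeries σ)ˣ) : NCSeries σ) - 1 =
        h * ((g : NCSeries σ) - 1) * ((h⁻¹ : (NCSeries σ)ˣ) : NCSeries σ) := by
      push_cast
      rw [mul_sub, sub_mul, mul_one, Units.mul_inv]
    rw [mem_congSubgroup, e]
    exact Vanish.mul_right hV (Vanish.mul_left hV hg _) _

/-- Multiplying by a unit preserves vanishing on a factor-closed set, so equality of cosets becomes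
a congruence of coefficients. -/
theorem inv_mul_mem_congSubgroup {M : ℕ} {V : Set (List σ)} {hV : FactorClosed V}
    {g h : (NCSeries σ)ˣ} :
    g⁻¹ * h ∈ congSubgroup M V hV ↔ Vanish M V ((h : NCSeries σ) - g) := by
  rw [mem_congSubgroup]
  constructor
  · intro H
    have e : (h : NCSeries σ) - g = g * (((g⁻¹ * h : (NCSeries σ)ˣ) : NCSeries σ) - 1) := by
      push_cast
      rw [mul_sub, mul_one, ← mul_assoc, Units.mul_inv, one_mul]
    rw [e]
    exact Vanish.mul_left hV H _
  · intro H
    have e : ((g⁻¹ * h : (NCSeries σ)ˣ) : NCSeries σ) - 1 =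
        ((g⁻¹ : (NCSeries σ)ˣ) : NCSeries σ) * ((h : NCSeries σ) - g) := by
      push_cast
      rw [mul_sub, Units.inv_mul]
    rw [e]
    exact Vanish.mul_left hV H _

/-- The unit `1 + κ_h`. -/
noncomputable def letterUnit (h : σ) : (NCSeries σ)ˣ :=
  ⟨1 + X h, altGeom h, one_add_X_mul_altGeom h, altGeom_mul_one_add_X h⟩

theorem coeff_nil_unit (g : (NCSeries σ)ˣ) :
    ((g⁻¹ : (NCSeries σ)ˣ) : NCSeries σ).coeff [] * (g : NCSeries σ).coeff [] = 1 := by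
  rw [← coeff_mul_nil, Units.inv_mul]
  rfl

/-! ### Substitution -/

/-- The scalar multiples of `1`. -/
def scalar (z : ℤ) : NCSeries σ := fun c => if c.isEmpty then z else 0

theorem coeff_scalar (z : ℤ) (c : List σ) : (scalar z).coeff c = if c.isEmpty then z else 0 := rfl

theorem coeff_sum {ι : Type*} (s : Finset ι) (f : ι → NCSeries σ) (c : List σ) :
    (∑ i ∈ s, f i).coeff c = ∑ i ∈ s, (f i).coeff c := by
  classical
  induction s using Finset.induction_on with
  | empty => simp [coeff_zero]
  | insert a s ha ih => rw [Finset.sum_insert ha, Finset.sum_insert ha, coeff_add, ih]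

theorem AgreeUpTo.mul_of_coeff_nil {d : ℕ} {y f g : NCSeries σ} (hy : y.coeff [] = 0)
    (h : AgreeUpTo d f g) : AgreeUpTo (d + 1) (y * f) (y * g) := by
  simpa using AgreeUpTo.conj (f := 1) (f' := 1) (fun _ _ => rfl) h hy

theorem AgreeUpTo.trans {d : ℕ} {f g h : NCSeries σ} (h1 : AgreeUpTo d f g)
    (h2 : AgreeUpTo d g h) : AgreeUpTo d f h := fun c hc => (h1 c hc).trans (h2 c hc)

theorem AgreeUpTo.symm {d : ℕ} {f g : NCSeries σ} (h1 : AgreeUpTo d f g) :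
    AgreeUpTo d g f := fun c hc => (h1 c hc).symm

theorem AgreeUpTo.add {d : ℕ} {f g f' g' : NCSeries σ} (h1 : AgreeUpTo d f g)
    (h2 : AgreeUpTo d f' g') : AgreeUpTo d (f + f') (g + g') := fun c hc => by
  rw [coeff_add, coeff_add, h1 c hc, h2 c hc]

theorem shift_X_mul [DecidableEq σ] (h a : σ) (f : NCSeries σ) :
    shift a (X h * f) = if a = h then f else 0 := by
  ext c
  rw [coeff_shift, coeff_X_mul]
  by_cases hah : a = h <;> simp [hah, coeff_zero]

variable [Fintype σ]

/-- The substitution of the series `κ h` for the variables, up to the degree `d`. -/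
def subst (κ : σ → NCSeries σ) : ℕ → NCSeries σ → NCSeries σ
  | 0, f => scalar (f.coeff [])
  | d + 1, f => scalar (f.coeff []) + ∑ h, κ h * subst κ d (shift h f)

variable {κ : σ → NCSeries σ}

/-- Each further round of the recursion takes place behind one more factor `κ h`, which has no
constant term. -/
theorem subst_agree (hκ : ∀ h, (κ h).coeff [] = 0) (d : ℕ) (f : NCSeries σ) :
    AgreeUpTo d (subst κ d f) (subst κ (d + 1) f) := by
  induction d generalizing f with
  | zero =>
    intro c hc
    have : c = [] := List.length_eq_zero_iff.mp (by omega)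
    subst this
    simp [subst, coeff_add, coeff_sum, coeff_mul_nil, hκ]
  | succ d ih =>
    intro c hc
    rw [subst, subst, coeff_add, coeff_add, coeff_sum, coeff_sum]
    congr 1
    exact Finset.sum_congr rfl fun h _ => (ih (shift h f)).mul_of_coeff_nil (hκ h) c hc

theorem subst_add (d : ℕ) (f g : NCSeries σ) :
    subst κ d (f + g) = subst κ d f + subst κ d g := by
  induction d generalizing f g with
  | zero =>
    ext c
    simp only [subst, coeff_add, coeff_scalar]
    split_ifs <;> simp
  | succ d ih =>
    have e : ∀ h, shift h (f + g) = shift h f + shift h g := fun h => rfl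
    ext c
    simp only [subst, coeff_add, coeff_scalar, e, ih, mul_add, Finset.sum_add_distrib]
    split_ifs <;> ring

theorem subst_zero (d : ℕ) : subst κ d 0 = 0 := by
  have h := subst_add (κ := κ) d 0 0
  rw [add_zero] at h
  simpa using h

theorem subst_one (d : ℕ) : subst κ d 1 = 1 := by
  have e : ∀ h : σ, shift h (1 : NCSeries σ) = 0 := fun h => by
    ext c
    simp [coeff_shift, coeff_one, coeff_zero]
  cases d with
  | zero => rfl
  | succ d =>
    simp only [subst, e, subst_zero, mul_zero, Finset.sum_const_zero, add_zero]
    rfl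

theorem subst_X_mul (hκ : ∀ h, (κ h).coeff [] = 0) (d : ℕ) (h : σ) (f : NCSeries σ) :
    AgreeUpTo d (subst κ d (X h * f)) (κ h * subst κ d f) := by
  classical
  cases d with
  | zero =>
    intro c hc
    have : c = [] := List.length_eq_zero_iff.mp (by omega)
    subst this
    simp [subst, coeff_mul_nil, hκ, coeff_scalar, coeff_X]
  | succ d =>
    have e : subst κ (d + 1) (X h * f) = κ h * subst κ d f := by
      have e0 : (X h * f).coeff [] = 0 := by simp [coeff_mul_nil, coeff_X]
      have e1 : (scalar 0 : NCSeries σ) = 0 := by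
        ext c; simp [coeff_scalar, coeff_zero]
      rw [subst, e0, e1, zero_add, Finset.sum_eq_single h]
      · rw [shift_X_mul, if_pos rfl]
      · intro a _ ha
        rw [shift_X_mul, if_neg ha, subst_zero, mul_zero]
      · simp
    rw [e]
    exact (subst_agree hκ d f).mul_of_coeff_nil (hκ h)

/-- Substitution of units in the expansion of a word. -/
theorem subst_wordVal {mm : σ → (NCSeries σ)ˣ} (hκ : ∀ h, ((mm h : NCSeries σ) - 1).coeff [] = 0)
    (d : ℕ) (l : List (σ × Bool)) :
    AgreeUpTo d (subst (fun h => (mm h : NCSeries σ) - 1) d (wordVal letterUnit l : (NCSeries σ)ˣ))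
      (wordVal mm l : (NCSeries σ)ˣ) := by
  set κ : σ → NCSeries σ := fun h => (mm h : NCSeries σ) - 1 with hκdef
  have key : ∀ h f, AgreeUpTo d (subst κ d ((letterUnit h : NCSeries σ) * f))
      ((mm h : NCSeries σ) * subst κ d f) := by
    intro h f
    have e1 : (letterUnit h : NCSeries σ) * f = f + X h * f := by
      simp [letterUnit, add_mul]
    have e2 : (mm h : NCSeries σ) * subst κ d f = subst κ d f + κ h * subst κ d f := by
      rw [hκdef]; noncomm_ring
    rw [e1, e2, subst_add]
    exact AgreeUpTo.add (fun _ _ => rfl) (subst_X_mul hκ d h f)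
  induction l with
  | nil =>
    rw [wordVal_nil, wordVal_nil, Units.val_one, subst_one]
    exact fun _ _ => rfl
  | cons a l ih =>
    obtain ⟨h, b⟩ := a
    rw [wordVal_cons, wordVal_cons]
    cases b
    · set f : NCSeries σ := ((wordVal letterUnit l : (NCSeries σ)ˣ) : NCSeries σ)
      simp only [signPow_false, Units.val_mul]
      -- An inverse letter needs no expansion of its geometric series: the rule for a positive
      -- letter is applied to the product with the inverse, and `mm h` is cancelled.
      have h1 := key h (((letterUnit h)⁻¹ : (NCSeries σ)ˣ) * f)
      rw [Units.mul_inv_cancel_left] at h1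
      have h2 := (AgreeUpTo.mul (f := (((mm h)⁻¹ : (NCSeries σ)ˣ) : NCSeries σ))
        (fun _ _ => rfl) (h1.symm.trans ih))
      rw [Units.inv_mul_cancel_left] at h2
      exact h2
    · simp only [signPow_true, Units.val_mul]
      exact (key h _).trans (AgreeUpTo.mul (fun _ _ => rfl) ih)

/-- A substitution `κ_h ↦ κ_h + ⋯`, where all terms contain `κ_h`, does not change the coefficient
of a monomial if those of its proper subwords vanish. -/
theorem coeff_subst {M : ℕ} (hκ : ∀ h c, h ∉ c → (κ h).coeff c = 0)
    (hκ1 : ∀ h, (κ h).coeff [h] = 1) (d : ℕ) (f : NCSeries σ) (e : List σ) (he : e.length ≤ d)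
    (hf : ∀ c, c.Sublist e → c ≠ e → (f.coeff c : ZMod M) = 0) :
    ((subst κ d f).coeff e : ZMod M) = f.coeff e := by
  classical
  induction d generalizing f e with
  | zero =>
    have : e = [] := List.length_eq_zero_iff.mp (by omega)
    subst this
    simp [subst, coeff_scalar]
  | succ d ih =>
    cases e with
    | nil => simp [subst, coeff_add, coeff_sum, coeff_mul_nil, hκ, coeff_scalar]
    | cons a e =>
      rw [subst, coeff_add, coeff_scalar, coeff_sum]
      simp only [List.isEmpty_cons, Bool.false_eq_true, if_false, zero_add, Int.cast_sum]
      have hterm : ∀ h, ((κ h * subst κ d (shift h f)).coeff (a :: e) : ZMod M) =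
          if h = a then (f.coeff (a :: e) : ZMod M) else 0 := by
        intro h
        rw [coeff_mul_cons, hκ h [] (by simp), zero_mul, zero_add, coeff_mul,
          Finset.sum_range_succ', Int.cast_add, Int.cast_sum]
        -- Terms in which `κ h` supplies a prefix of length at least two. This prefix contains `h`,
        -- so `h` followed by a subword of the remaining suffix is a proper subword of the monomial,
        -- where the coefficient of `f` vanishes.
        have h0 : ∑ k ∈ Finset.range e.length, (((shift a (κ h)).coeff (e.take (k + 1)) *
            (subst κ d (shift h f)).coeff (e.drop (k + 1)) : ℤ) : ZMod M) = 0 := by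
          refine Finset.sum_eq_zero fun k hk => ?_
          rw [Finset.mem_range] at hk
          rw [Int.cast_mul, coeff_shift]
          by_cases hmem : h ∈ a :: e.take (k + 1)
          · have hsub : ∀ c, c.Sublist (e.drop (k + 1)) →
                (h :: c).Sublist (a :: e) ∧ h :: c ≠ a :: e := by
              intro c hc
              constructor
              · have := (List.singleton_sublist.mpr hmem).append hc
                simpa using this
              · intro heq
                have h1 := hc.length_le
                have h2 := congrArg List.length heq
                simp only [List.length_cons, List.length_drop] at h1 h2
                omega
            rw [ih (shift h f) (e.drop (k + 1)) (by simp at he ⊢; omega)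
              (fun c hc _ => hf _ (hsub c hc).1 (hsub c hc).2), coeff_shift,
              hf _ (hsub _ (List.Sublist.refl _)).1 (hsub _ (List.Sublist.refl _)).2, mul_zero]
          · rw [hκ h _ hmem, Int.cast_zero, zero_mul]
        rw [h0, zero_add, Int.cast_mul, coeff_shift, List.take_zero, List.drop_zero]
        -- The remaining term takes from `κ h` the prefix `[a]`: the linear part is 1 for `h = a`
        -- and 0 otherwise.
        by_cases ha : h = a
        · subst ha
          rw [hκ1, Int.cast_one, one_mul, if_pos rfl,
            ih (shift h f) e (by simpa using he) fun c hc hne => ?_]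
          · rfl
          · exact hf _ (hc.cons_cons h) (by simpa using hne)
        · rw [if_neg ha, hκ h [a] (by simpa using ha), Int.cast_zero, zero_mul]
      simp only [hterm, Finset.sum_ite_eq', Finset.mem_univ, if_true]

end NCSeries

open NCSeries

/-! ### The group of units modulo a congruence -/

section Quotient

variable {n : ℕ} {W : Set (List (Fin n))}

/-- The monomials of `W` without the variable of index `j`. -/
def avoiding (W : Set (List (Fin n))) (j : ℕ) : Set (List (Fin n)) :=
  {c | c ∈ W ∧ ∀ h ∈ c, (h : ℕ) ≠ j}

/-- The monomials of `W` of degree less than `q`. -/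
def shorter (W : Set (List (Fin n))) (q : ℕ) : Set (List (Fin n)) :=
  {c | c ∈ W ∧ c.length < q}

theorem FactorClosed.avoiding (hW : FactorClosed W) (j : ℕ) : FactorClosed (avoiding W j) :=
  fun c hc k => ⟨⟨(hW c hc.1 k).1, fun h hh => hc.2 h (List.mem_of_mem_take hh)⟩,
    ⟨(hW c hc.1 k).2, fun h hh => hc.2 h (List.mem_of_mem_drop hh)⟩⟩

theorem FactorClosed.shorter (hW : FactorClosed W) (q : ℕ) : FactorClosed (shorter W q) :=
  fun c hc k => ⟨⟨(hW c hc.1 k).1, (List.take_sublist k c).length_le.trans_lt hc.2⟩,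
    ⟨(hW c hc.1 k).2, (List.drop_sublist k c).length_le.trans_lt hc.2⟩⟩

/-- The units modulo those that are congruent to `1` modulo `M` on the monomials of `W`. -/
abbrev UnitQuotient (M : ℕ) (hW : FactorClosed W) : Type :=
  (NCSeries (Fin n))ˣ ⧸ congSubgroup M W hW

/-- The image of a congruence subgroup. -/
def quotSubgroup (M : ℕ) (hW : FactorClosed W) {V : Set (List (Fin n))} (hV : FactorClosed V) :
    Subgroup (UnitQuotient M hW) :=
  (congSubgroup M V hV).map (QuotientGroup.mk' _)

variable (M : ℕ) (hW : FactorClosed W)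

instance quotSubgroup_normal {V : Set (List (Fin n))} (hV : FactorClosed V) :
    (quotSubgroup M hW hV).Normal :=
  (congSubgroup_normal M V hV).map _ (QuotientGroup.mk'_surjective _)

variable {M hW}

/-- Since `V ⊆ W`, a change of representative does not affect the congruence on `V`. -/
theorem mk_mem_quotSubgroup {V : Set (List (Fin n))} {hV : FactorClosed V} (hVW : V ⊆ W)
    {g : (NCSeries (Fin n))ˣ} :
    (g : UnitQuotient M hW) ∈ quotSubgroup M hW hV ↔ Vanish M V ((g : NCSeries (Fin n)) - 1) := by
  constructor
  · rintro ⟨u, hu, hug⟩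
    have h1 : u⁻¹ * g ∈ congSubgroup M W hW := QuotientGroup.eq.1 hug
    have h2 := inv_mul_mem_congSubgroup.1 h1
    have := (h2.mono hVW).add hu
    simpa using this
  · intro h
    exact ⟨g, h, rfl⟩

theorem mk_eq_mk {g h : (NCSeries (Fin n))ˣ} :
    (g : UnitQuotient M hW) = h ↔ Vanish M W ((h : NCSeries (Fin n)) - g) := by
  rw [QuotientGroup.eq, inv_mul_mem_congSubgroup]

/-- Units that are congruent to `1` on the monomials without a given variable commute modulo
monomials with repeated variables. -/
theorem quotSubgroup_avoiding_comm (hnd : ∀ c ∈ W, c.Nodup) (j : ℕ) :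
    ∀ a ∈ quotSubgroup M hW (hW.avoiding j), ∀ b ∈ quotSubgroup M hW (hW.avoiding j),
      a * b = b * a := by
  rintro _ ⟨g, hg, rfl⟩ _ ⟨h, hh, rfl⟩
  -- A monomial without repetitions contains κ_j at most once, so in each splitting one of the two
  -- factors avoids it.
  have key : ∀ u v : NCSeries (Fin n), Vanish M (avoiding W j) u → Vanish M (avoiding W j) v →
      Vanish M W (u * v) := by
    intro u v hu hv
    refine hu.mul hv fun c hc k => ?_
    by_contra! hno
    have h1 : ∃ a ∈ c.take k, (a : ℕ) = j := by
      by_contra! h1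
      exact hno.1 ⟨(hW c hc k).1, h1⟩
    have h2 : ∃ a ∈ c.drop k, (a : ℕ) = j := by
      by_contra! h2
      exact hno.2 ⟨(hW c hc k).2, h2⟩
    obtain ⟨a, ha, haj⟩ := h1
    obtain ⟨b, hb, hbj⟩ := h2
    have hab : a = b := Fin.ext (haj.trans hbj.symm)
    subst hab
    have hnd' := hnd c hc
    rw [← List.take_append_drop k c, List.nodup_append] at hnd'
    exact hnd'.2.2 a ha a hb rfl
  change ((g * h : (NCSeries (Fin n))ˣ) : UnitQuotient M hW) = (h * g : (NCSeries (Fin n))ˣ)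
  rw [mk_eq_mk]
  have e : ((h * g : (NCSeries (Fin n))ˣ) : NCSeries (Fin n)) - (g * h : (NCSeries (Fin n))ˣ) =
      ((h : NCSeries (Fin n)) - 1) * ((g : NCSeries (Fin n)) - 1) -
        ((g : NCSeries (Fin n)) - 1) * ((h : NCSeries (Fin n)) - 1) := by
    push_cast; noncomm_ring
  rw [e]
  exact (key _ _ hh hg).sub (key _ _ hg hh)

theorem quotSubgroup_shorter_zero : quotSubgroup M hW (hW.shorter 0) = ⊤ := by
  rw [eq_top_iff]
  rintro g -
  induction g using QuotientGroup.induction_on with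
  | H g =>
    rw [mk_mem_quotSubgroup fun c hc => hc.1]
    exact fun c hc => absurd hc.2 (Nat.not_lt_zero _)

theorem quotSubgroup_shorter_eq_bot {q : ℕ} (hq : ∀ c ∈ W, c.length < q) :
    quotSubgroup M hW (hW.shorter q) = ⊥ := by
  rw [eq_bot_iff]
  intro g
  induction g using QuotientGroup.induction_on with
  | H g =>
    rw [mk_mem_quotSubgroup fun c hc => hc.1, Subgroup.mem_bot, ← QuotientGroup.mk_one, eq_comm,
      mk_eq_mk]
    exact fun h c hc => h c ⟨hc, hq c hc⟩

/-- With x, y representing the two elements, xy − yx = (x − 1)(y − 1) − (y − 1)(x − 1). Modulo `M`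
on `W`, x − 1 has no constant term and y − 1 starts in degree `q`, so both products start in degree
`q + 1`. -/
theorem quotSubgroup_shorter_commutator {q : ℕ} {a g : UnitQuotient M hW}
    (ha : a ∈ quotSubgroup M hW (hW.shorter 1)) (hg : g ∈ quotSubgroup M hW (hW.shorter q)) :
    a⁻¹ * (g⁻¹ * a * g) ∈ quotSubgroup M hW (hW.shorter (q + 1)) := by
  obtain ⟨x, hx, rfl⟩ := ha
  obtain ⟨y, hy, rfl⟩ := hg
  change ((x⁻¹ * (y⁻¹ * x * y) : (NCSeries (Fin n))ˣ) : UnitQuotient M hW) ∈ _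
  rw [show x⁻¹ * (y⁻¹ * x * y) = (y * x)⁻¹ * (x * y) by group]
  refine ⟨_, ?_, rfl⟩
  rw [SetLike.mem_coe, inv_mul_mem_congSubgroup]
  have e : ((x * y : (NCSeries (Fin n))ˣ) : NCSeries (Fin n)) - (y * x : (NCSeries (Fin n))ˣ) =
      ((x : NCSeries (Fin n)) - 1) * ((y : NCSeries (Fin n)) - 1) -
        ((y : NCSeries (Fin n)) - 1) * ((x : NCSeries (Fin n)) - 1) := by
    push_cast; noncomm_ring
  rw [e]
  refine (Vanish.mul hx hy fun c hc k => ?_).sub (Vanish.mul hy hx fun c hc k => ?_)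
  · have h1 := hc.2
    by_cases hk : (c.take k).length < 1
    · exact Or.inl ⟨(hW c hc.1 k).1, hk⟩
    · refine Or.inr ⟨(hW c hc.1 k).2, ?_⟩
      simp only [List.length_take, List.length_drop] at hk ⊢
      omega
  · have h1 := hc.2
    by_cases hk : (c.drop k).length < 1
    · exact Or.inr ⟨(hW c hc.1 k).2, hk⟩
    · refine Or.inl ⟨(hW c hc.1 k).1, ?_⟩
      simp only [List.length_take, List.length_drop] at hk ⊢
      omega

end Quotient

theorem map_wordVal {G H : Type*} [Group G] [Group H] (f : G →* H) {L : Type*} (E : L → G)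
    (l : List (L × Bool)) : f (wordVal E l) = wordVal (fun D => f (E D)) l := by
  induction l with
  | nil => simp
  | cons a l ih =>
    rw [wordVal_cons, wordVal_cons, map_mul, ih]
    cases a.2 <;> simp

theorem val_wordVal_letterUnit {n : ℕ} (l : List (Fin n × Bool)) :
    ((wordVal letterUnit l : (NCSeries (Fin n))ˣ) : NCSeries (Fin n)) = magnusPhi l := by
  induction l with
  | nil => rfl
  | cons a l ih =>
    rw [wordVal_cons, Units.val_mul, ih, show a :: l = [a] ++ l from rfl, magnusPhi_append]
    congr 1
    obtain ⟨h, b⟩ := a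
    cases b <;> simp [magnusPhi, letterUnit]

/-- The unit `1 + κ_j`, for an index `j`. -/
noncomputable def meridianUnit (n : ℕ) (j : ℕ) : (NCSeries (Fin n))ˣ :=
  if h : j < n then letterUnit ⟨j, h⟩ else 1

theorem meridianUnit_val {n : ℕ} (h : Fin n) : meridianUnit n h = letterUnit h := by
  simp [meridianUnit]

theorem meridianUnit_sub_one (n j : ℕ) : ∀ c : List (Fin n), (∀ h ∈ c, (h : ℕ) ≠ j) →
    ((meridianUnit n j : NCSeries (Fin n)) - 1).coeff c = 0 := by
  intro c hc
  unfold meridianUnit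
  split_ifs with h
  · have e : ((letterUnit (⟨j, h⟩ : Fin n) : (NCSeries (Fin n))ˣ) : NCSeries (Fin n)) - 1 =
        X ⟨j, h⟩ := by simp [letterUnit]
    rw [e, coeff_X, if_neg]
    rintro rfl
    exact hc ⟨j, h⟩ (by simp) rfl
  · simp [coeff_zero]

/-! ### Cyclic permutations of subsequences -/

/-- The cut that defines the rotation of the list also cuts the subsequence into two parts, which
are interchanged. -/
theorem List.Sublist.exists_isRotated {α : Type*} {e d d' : List α} (h : e.Sublist d)
    (hd : d.IsRotated d') : ∃ e', e'.Sublist d' ∧ e.IsRotated e' := by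
  obtain ⟨k, hk, rfl⟩ := List.isRotated_iff_mod.1 hd
  rw [List.rotate_eq_drop_append_take hk]
  rw [← List.take_append_drop k d] at h
  obtain ⟨e₁, e₂, rfl, h₁, h₂⟩ := List.sublist_append_iff.1 h
  exact ⟨e₂ ++ e₁, h₂.append h₁, List.isRotated_append⟩

/-- The cyclic permutations of the proper subsequences of `s`. -/
def lowerWords {α : Type*} (s : List α) : Set (List α) :=
  {d | ∃ d', d'.Sublist s ∧ d'.length < s.length ∧ d.IsRotated d'}

section LowerWords

variable {α : Type*} {s : List α}

theorem lowerWords_of_sublist {d e : List α} (hd : d ∈ lowerWords s) (h : e.Sublist d) :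
    e ∈ lowerWords s := by
  obtain ⟨d', h1, h2, h3⟩ := hd
  obtain ⟨e', h4, h5⟩ := h.exists_isRotated h3
  exact ⟨e', h4.trans h1, h4.length_le.trans_lt h2, h5⟩

theorem lowerWords_of_isRotated {d e : List α} (hd : d ∈ lowerWords s) (h : e.IsRotated d) :
    e ∈ lowerWords s := by
  obtain ⟨d', h1, h2, h3⟩ := hd
  exact ⟨d', h1, h2, h.trans h3⟩

theorem factorClosed_lowerWords (s : List α) : FactorClosed (lowerWords s) :=
  fun _ hc k => ⟨lowerWords_of_sublist hc (List.take_sublist k _),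
    lowerWords_of_sublist hc (List.drop_sublist k _)⟩

theorem nodup_of_mem_lowerWords (hs : s.Nodup) {d : List α} (hd : d ∈ lowerWords s) : d.Nodup := by
  obtain ⟨d', h1, h2, h3⟩ := hd
  exact h3.nodup_iff.2 (hs.sublist h1)

theorem length_of_mem_lowerWords {d : List α} (hd : d ∈ lowerWords s) : d.length < s.length := by
  obtain ⟨d', h1, h2, h3⟩ := hd
  rwa [h3.perm.length_eq]

end LowerWords

/-! ### Invariance of μ modulo the lower numbers -/

namespace Nanophrase

variable {n : ℕ}

theorem mem_lowerSeqs {s d : List (Fin n)} :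
    d ∈ lowerSeqs s ↔ d ∈ lowerWords s ∧ 2 ≤ d.length := by
  simp only [lowerSeqs, Finset.mem_biUnion, Finset.mem_filter, List.mem_toFinset,
    List.mem_sublists, List.mem_cyclicPermutations_iff, lowerWords, Set.mem_ofPred_eq]
  constructor
  · rintro ⟨d', ⟨h1, h2, h3⟩, h4⟩
    exact ⟨⟨d', h1, h3, h4⟩, by rwa [h4.perm.length_eq]⟩
  · rintro ⟨⟨d', h1, h3, h4⟩, h2⟩
    exact ⟨d', ⟨h1, by rwa [← h4.perm.length_eq], h3⟩, h4⟩

theorem muSeq_append (p : Nanophrase AlphaV n) (c : List (Fin n)) (i : Fin n) :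
    p.muSeq (c ++ [i]) = p.mu c i := by
  simp [muSeq]

/-- Conjugation by a unit does not change the coefficients of a monomial modulo those of its proper
subwords. -/
theorem coeff_conj_unit {M : ℕ} {c : List (Fin n)} {f : NCSeries (Fin n)}
    (hf : ∀ d, d.Sublist c → d ≠ c → (f.coeff d : ZMod M) = 0) (g : (NCSeries (Fin n))ˣ) :
    ∀ d, d.Sublist c →
      ((((g⁻¹ : (NCSeries (Fin n))ˣ) : NCSeries (Fin n)) * f * g).coeff d : ZMod M) =
        f.coeff d := by
  have hV : FactorClosed {d : List (Fin n) | d.Sublist c ∧ d ≠ c} := by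
    intro d hd k
    have key : ∀ e : List (Fin n), e.Sublist d → e.Sublist c ∧ e ≠ c := by
      intro e he
      refine ⟨he.trans hd.1, ?_⟩
      rintro rfl
      exact hd.2 (hd.1.eq_of_length_le he.length_le)
    exact ⟨key _ (List.take_sublist k d), key _ (List.drop_sublist k d)⟩
  have hf' : Vanish M {d : List (Fin n) | d.Sublist c ∧ d ≠ c} f := fun d hd => hf d hd.1 hd.2
  have hgf := hf'.mul_left hV ((g⁻¹ : (NCSeries (Fin n))ˣ) : NCSeries (Fin n))
  intro d hd
  by_cases hdc : d = c
  · subst hdc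
    have h1 : ∀ u v : NCSeries (Fin n), Vanish M {e : List (Fin n) | e.Sublist d ∧ e ≠ d} u →
        ((u * v).coeff d : ZMod M) = u.coeff d * v.coeff [] := by
      intro u v hu
      rw [coeff_mul, Int.cast_sum, Finset.sum_eq_single d.length]
      · simp
      · intro k hk hkd
        rw [Finset.mem_range] at hk
        rw [Int.cast_mul, hu _ ⟨List.take_sublist k d, ?_⟩, zero_mul]
        intro he
        have := congrArg List.length he
        simp only [List.length_take] at this
        omega
      · simp
    have h2 : ∀ u v : NCSeries (Fin n), Vanish M {e : List (Fin n) | e.Sublist d ∧ e ≠ d} u →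
        ((v * u).coeff d : ZMod M) = v.coeff [] * u.coeff d := by
      intro u v hu
      rw [coeff_mul, Int.cast_sum, Finset.sum_eq_single 0]
      · simp
      · intro k hk hk0
        rw [Finset.mem_range] at hk
        rw [Int.cast_mul, hu _ ⟨List.drop_sublist k d, ?_⟩, mul_zero]
        intro he
        have := congrArg List.length he
        simp only [List.length_drop] at this
        omega
      · simp
    -- Only the splittings in which `f` receives the whole monomial survive. The conjugating units
    -- contribute their constant terms, whose product is 1.
    rw [h1 _ _ hgf, h2 _ _ hf']
    have h3 := coeff_nil_unit g
    have h4 : ((((g⁻¹ : (NCSeries (Fin n))ˣ) : NCSeries (Fin n)).coeff [] : ℤ) : ZMod M) *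
        ((g : NCSeries (Fin n)).coeff [] : ℤ) = 1 := by
      rw [← Int.cast_mul, h3, Int.cast_one]
    rw [mul_right_comm, h4, one_mul]
  · rw [(hgf.mul_right hV g) d ⟨hd, hdc⟩, hf d hd hdc]

theorem coeff_magnusPhi_nil (l : List (Fin n × Bool)) : (magnusPhi l).coeff [] = 1 := by
  induction l with
  | nil => rfl
  | cons a l ih =>
    rw [show a :: l = [a] ++ l from rfl, magnusPhi_append, coeff_mul_nil, ih, mul_one]
    obtain ⟨h, b⟩ := a
    cases b
    · simpa [magnusPhi] using altGeom_nil h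
    · simp [magnusPhi, coeff_add, coeff_one, coeff_X]

/-- The expansion of the longitude of the `j`th component. -/
noncomputable def longitude (p : Nanophrase AlphaV n) (q j : ℕ) : (NCSeries (Fin n))ˣ :=
  if h : j < n then wordVal letterUnit (p.eta (p.rho q (p.signedWord ⟨j, h⟩))) else 1

theorem longitude_val (p : Nanophrase AlphaV n) (q : ℕ) (i : Fin n) :
    (p.longitude q i : NCSeries (Fin n)) = magnusPhi (p.eta (p.rho q (p.signedWord i))) := by
  rw [← val_wordVal_letterUnit]
  simp [longitude]

/-- The longitudes commute with the meridians modulo the lower numbers. -/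
theorem meridian_longitude_comm (p : Nanophrase AlphaV n) {s : List (Fin n)} {M : ℕ}
    (hM : ∀ d ∈ lowerSeqs s, (p.muSeq d : ZMod M) = 0) (j : ℕ) :
    ((meridianUnit n j * p.longitude s.length j : (NCSeries (Fin n))ˣ) :
        UnitQuotient M (factorClosed_lowerWords s)) =
      (p.longitude s.length j * meridianUnit n j : (NCSeries (Fin n))ˣ) := by
  by_cases hj : j < n
  · obtain ⟨h, rfl⟩ : ∃ h : Fin n, j = h := ⟨⟨j, hj⟩, rfl⟩
    rw [mk_eq_mk, meridianUnit_val]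
    set f : NCSeries (Fin n) := (p.longitude s.length h : NCSeries (Fin n)) - 1 with hf
    have hfc : ∀ e, e ++ [h] ∈ lowerWords s → (f.coeff e : ZMod M) = 0 := by
      intro e he
      by_cases h0 : e = []
      · rw [h0, hf, coeff_sub, longitude_val, coeff_magnusPhi_nil, coeff_one]
        simp
      · have hpos := List.length_pos_iff.mpr h0
        have hlen := length_of_mem_lowerWords he
        rw [List.length_append, List.length_singleton] at hlen
        have h1 := hM (e ++ [h]) (mem_lowerSeqs.2 ⟨he, by simp; omega⟩)
        rw [muSeq_append] at h1
        rw [hf, coeff_sub, longitude_val, mu_eq p e h (by omega), coeff_one,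
          if_neg (by simpa using h0), sub_zero, h1]
    have e : ((p.longitude s.length h * letterUnit h : (NCSeries (Fin n))ˣ) : NCSeries (Fin n)) -
        (letterUnit h * p.longitude s.length h : (NCSeries (Fin n))ˣ) = f * X h - X h * f := by
      have : ((letterUnit h : (NCSeries (Fin n))ˣ) : NCSeries (Fin n)) = 1 + X h := rfl
      push_cast
      rw [this, hf]
      noncomm_ring
    rw [e]
    intro c hc
    have h1 : ((f * X h).coeff c : ZMod M) = 0 := by
      rw [coeff_mul, Int.cast_sum]
      refine Finset.sum_eq_zero fun k _ => ?_
      rw [Int.cast_mul, coeff_X]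
      split_ifs with hk
      · rw [hfc, zero_mul]
        rwa [← hk, List.take_append_drop]
      · simp
    have h2 : ((X h * f).coeff c : ZMod M) = 0 := by
      rw [coeff_mul, Int.cast_sum]
      refine Finset.sum_eq_zero fun k _ => ?_
      rw [Int.cast_mul, coeff_X]
      split_ifs with hk
      · rw [hfc, mul_zero]
        -- Here `h` is the first variable of the monomial, and a rotation brings it to the end,
        -- where the coefficient is one of the lower numbers.
        refine lowerWords_of_isRotated hc ?_
        have hcc : c = [h] ++ c.drop k := by rw [← hk, List.take_append_drop]
        conv_rhs => rw [hcc]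
        exact List.isRotated_append
      · simp
    rw [coeff_sub, Int.cast_sub, h1, h2, sub_zero]
  · simp [meridianUnit, longitude, hj]

/-- A conjugate of `1 + κ_j` differs from `1` by terms that contain `κ_j`. -/
theorem conj_meridianUnit_sub_one (j : ℕ) (u : (NCSeries (Fin n))ˣ) (c : List (Fin n))
    (hc : ∀ h ∈ c, (h : ℕ) ≠ j) :
    (((u⁻¹ * meridianUnit n j * u : (NCSeries (Fin n))ˣ) : NCSeries (Fin n)) - 1).coeff c = 0 := by
  have hV : FactorClosed {c : List (Fin n) | ∀ h ∈ c, (h : ℕ) ≠ j} := fun c hc k =>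
    ⟨fun h hh => hc h (List.mem_of_mem_take hh), fun h hh => hc h (List.mem_of_mem_drop hh)⟩
  -- A congruence modulo 0 is an equality of integers, so exact vanishing follows from the normality
  -- of a congruence subgroup.
  have hm : meridianUnit n j ∈ congSubgroup 0 _ hV := fun c hc => by
    rw [meridianUnit_sub_one n j c hc, Int.cast_zero]
  have h := (congSubgroup_normal 0 _ hV).conj_mem _ hm u⁻¹
  rw [inv_inv] at h
  exact Int.cast_eq_zero.1 (h c hc)

/-- The linear term of a conjugate of `1 + κ_h`. -/
theorem coeff_conj_meridianUnit (h : Fin n) (u : (NCSeries (Fin n))ˣ) :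
    (((u⁻¹ * meridianUnit n h * u : (NCSeries (Fin n))ˣ) : NCSeries (Fin n)) - 1).coeff [h] =
      1 := by
  have e : ((u⁻¹ * meridianUnit n h * u : (NCSeries (Fin n))ˣ) : NCSeries (Fin n)) - 1 =
      ((u⁻¹ : (NCSeries (Fin n))ˣ) : NCSeries (Fin n)) * X h * u := by
    rw [meridianUnit_val]
    have : ((letterUnit h : (NCSeries (Fin n))ˣ) : NCSeries (Fin n)) = 1 + X h := rfl
    push_cast
    rw [this, mul_add, add_mul, mul_one, Units.inv_mul, add_sub_cancel_left]
  have h1 := coeff_conj_unit (M := 0) (c := [h]) (f := X h)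
    (fun d _ hd => by rw [coeff_X, if_neg hd, Int.cast_zero]) u [h] (List.Sublist.refl _)
  rw [e]
  rw [coeff_X, if_pos rfl] at h1
  exact Int.cast_injective h1

/-- If a series is congruent to the value of a word at conjugates of the `1 + κ_h`, and its
coefficients at the proper subwords of `c` vanish, then its coefficient at `c` is that of the
expansion of the word. -/
theorem coeff_eq_of_wordVal {M : ℕ} {c : List (Fin n)} {mm : Fin n → (NCSeries (Fin n))ˣ}
    (hκ : ∀ h c, h ∉ c → ((mm h : NCSeries (Fin n)) - 1).coeff c = 0)
    (hκ1 : ∀ h, ((mm h : NCSeries (Fin n)) - 1).coeff [h] = 1)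
    {u : NCSeries (Fin n)} {l : List (Fin n × Bool)}
    (hu : ∀ d, d.Sublist c → d ≠ c → ((u - 1).coeff d : ZMod M) = 0)
    (hul : ∀ d, d.Sublist c → (u.coeff d : ZMod M) =
      ((wordVal mm l : (NCSeries (Fin n))ˣ) : NCSeries (Fin n)).coeff d) :
    (u.coeff c : ZMod M) = (magnusPhi l).coeff c := by
  set κ : Fin n → NCSeries (Fin n) := fun h => (mm h : NCSeries (Fin n)) - 1 with hκdef
  set f : NCSeries (Fin n) := magnusPhi l - 1 with hf
  have hfu : ∀ d, d.Sublist c → ((subst κ c.length f).coeff d : ZMod M) = (u - 1).coeff d := by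
    intro d hd
    have h1 := subst_wordVal (mm := mm) (fun h => hκ h [] (by simp)) c.length l d hd.length_le
    have h2 := subst_add (κ := κ) c.length f 1
    rw [hf, sub_add_cancel, subst_one, ← hf] at h2
    rw [val_wordVal_letterUnit, h2, coeff_add] at h1
    rw [coeff_sub, Int.cast_sub, hul d hd, ← h1]
    push_cast
    ring
  -- Undoing the substitution degree by degree: once the coefficients of `f` at the shorter subwords
  -- are known to vanish, the substitution does not change the next one.
  have key : ∀ k, ∀ d : List (Fin n), d.length = k → d.Sublist c →
      (f.coeff d : ZMod M) = (u - 1).coeff d := by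
    intro k
    induction k using Nat.strong_induction_on with
    | _ k ih =>
      intro d hdk hd
      rw [← hfu d hd]
      refine (coeff_subst hκ hκ1 c.length f d hd.length_le fun e he hne => ?_).symm
      have hlt : e.length < k := by
        rw [← hdk]
        exact lt_of_le_of_ne he.length_le fun h => hne (he.eq_of_length h)
      rw [ih _ hlt e rfl (he.trans hd)]
      refine hu e (he.trans hd) ?_
      rintro rfl
      have := hd.length_le
      omega
  have h := key _ c rfl (List.Sublist.refl c)
  rw [hf, coeff_sub, coeff_sub, Int.cast_sub, Int.cast_sub] at h
  exact (sub_left_injective h).symm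

/-- A move changes the number `μ` only by a multiple of a common divisor of the lower ones. -/
theorem mu_of_mMove {p q : Nanophrase AlphaV n} (hpq : MMove virtualData p q)
    {c : List (Fin n)} {i : Fin n} (hci : (c ++ [i]).Nodup) {M : ℕ}
    (hM : ∀ d ∈ lowerSeqs (c ++ [i]), (p.muSeq d : ZMod M) = 0) :
    (p.mu c i : ZMod M) = q.mu c i := by
  by_cases hc0 : c = []
  · subst hc0
    rw [← mu_eq p [] i (d := 0) (by simp), ← mu_eq q [] i (d := 0) (by simp),
      coeff_magnusPhi_nil, coeff_magnusPhi_nil]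
  set s := c ++ [i] with hs
  -- All monomials of `lowerWords s` have degree less than `Q`, so on them the expansions are stable
  -- from index `Q` on.
  set Q := s.length with hQ
  have hcQ : c.length < Q := by simp [hQ, hs]
  have hsub : ∀ d, d.Sublist c → d ∈ lowerWords s := fun d hd =>
    ⟨d, hd.trans (List.sublist_append_left c [i]), hd.length_le.trans_lt hcQ, List.IsRotated.refl d⟩
  have hic : i ∉ c := by
    intro hic
    rw [hs, List.nodup_append] at hci
    exact hci.2.2 i hic i (by simp) rfl
  set hW := factorClosed_lowerWords s
  let N : ℕ → Subgroup (UnitQuotient M hW) := fun j => quotSubgroup M hW (hW.avoiding j)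
  let Γ : ℕ → Subgroup (UnitQuotient M hW) := fun k => quotSubgroup M hW (hW.shorter k)
  let m : ℕ → UnitQuotient M hW := fun j => meridianUnit n j
  let lam : ℕ → UnitQuotient M hW := fun j => p.longitude Q j
  have hNc : ∀ j, ∀ a ∈ N j, ∀ b ∈ N j, a * b = b * a :=
    quotSubgroup_avoiding_comm fun c hc => nodup_of_mem_lowerWords hci hc
  have hmN : ∀ j, m j ∈ N j := fun j => (mk_mem_quotSubgroup fun c hc => hc.1).2 fun c hc => by
    rw [meridianUnit_sub_one n j c hc.2, Int.cast_zero]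
  have hcomm : ∀ j, m j * lam j = lam j * m j := fun j => meridian_longitude_comm p hM j
  have hmk : ∀ (mm : ℕ → (NCSeries (Fin n))ˣ) (l : List (Fin n × Bool)),
      wordVal (fun h : Fin n => ((mm h : (NCSeries (Fin n))ˣ) : UnitQuotient M hW)) l =
        ((wordVal (fun h : Fin n => mm h) l : (NCSeries (Fin n))ˣ) : UnitQuotient M hW) :=
    fun mm l => (map_wordVal (QuotientGroup.mk' (congSubgroup M (lowerWords s) hW)) _ l).symm
  have hml : (fun h : Fin n => meridianUnit n h) = letterUnit := funext meridianUnit_val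
  have : ∀ j, (N j).Normal := fun j => quotSubgroup_normal M hW (hW.avoiding j)
  have : ∀ k, (Γ k).Normal := fun k => quotSubgroup_normal M hW (hW.shorter k)
  have hsol : p.Solves N m lam
      (fun D => wordVal (fun h : Fin n => m h) (p.eta (p.rho Q [(D, true)]))) := by
    refine solves_rho (d := Q) (fun D => ?_) fun j => ?_
    · simp only [m]
      rw [hmk, hmk, hml, mk_eq_mk, val_wordVal_letterUnit, val_wordVal_letterUnit]
      intro c hc
      rw [coeff_sub, p.expansion_agree Q _ c (length_of_mem_lowerWords hc).le, sub_self,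
        Int.cast_zero]
    · simp only [m, lam]
      rw [hmk, hml]
      simp [longitude]
  obtain ⟨k, g, E', hE'⟩ := hsol.of_mMove hNc hmN hcomm hpq
  obtain ⟨u, rfl⟩ := QuotientGroup.mk_surjective g
  -- All indices are treated uniformly: at an index different from `k` the conjugating unit is 1.
  have hconj : ∀ (a : ℕ → (NCSeries (Fin n))ˣ) (j : ℕ), Function.update a k (u⁻¹ * a k * u) j =
      (if j = k then u else 1)⁻¹ * a j * (if j = k then u else 1) := by
    intro a j
    by_cases hj : j = k
    · subst hj; simp
    · simp [hj]
  have hupd : ∀ a : ℕ → (NCSeries (Fin n))ˣ,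
      Function.update (fun j => (a j : UnitQuotient M hW)) k
        ((u : UnitQuotient M hW)⁻¹ * (a k : UnitQuotient M hW) * (u : UnitQuotient M hW)) =
      fun j => ((Function.update a k (u⁻¹ * a k * u) j : (NCSeries (Fin n))ˣ) :
        UnitQuotient M hW) := by
    intro a
    funext j
    by_cases hj : j = k
    · subst hj; simp
    · simp [hj]
  set mU := Function.update (meridianUnit n) k (u⁻¹ * meridianUnit n k * u) with hmU
  set lU := Function.update (p.longitude Q) k (u⁻¹ * p.longitude Q k * u) with hlU
  have hmm : Function.update m k ((u : UnitQuotient M hW)⁻¹ * m k * (u : UnitQuotient M hW)) =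
      fun j => ((mU j : (NCSeries (Fin n))ˣ) : UnitQuotient M hW) := hupd _
  have hll : Function.update lam k ((u : UnitQuotient M hW)⁻¹ * lam k * (u : UnitQuotient M hW)) =
      fun j => ((lU j : (NCSeries (Fin n))ˣ) : UnitQuotient M hW) := hupd _
  rw [hmm, hll] at hE'
  have hmU0 : ∀ (j : ℕ) (c : List (Fin n)), (∀ h ∈ c, (h : ℕ) ≠ j) →
      ((mU j : NCSeries (Fin n)) - 1).coeff c = 0 := fun j c hc => by
    rw [hmU, hconj]
    exact conj_meridianUnit_sub_one j _ c hc
  have hmU1 : ∀ h : Fin n, ((mU h : NCSeries (Fin n)) - 1).coeff [h] = 1 := fun h => by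
    rw [hmU, hconj]
    exact coeff_conj_meridianUnit h _
  -- The solution obtained for `q` is compared with the words ρ^q of `q` at the new meridians. The
  -- error lies in `Γ (Q + 1)`, which is trivial because of the degrees in `W`.
  have happ := hE'.approx Γ quotSubgroup_shorter_zero (fun r j g hg =>
    quotSubgroup_shorter_commutator ((mk_mem_quotSubgroup fun c hc => hc.1).2 fun c hc => by
      rw [List.length_eq_zero_iff.1 (Nat.lt_one_iff.1 hc.2), hmU0 j [] (by simp),
        Int.cast_zero]) hg) Q (l := q.signedWord i) q.isMixed_of_mem_signedWord
  have hbot : Γ (Q + 1) = ⊥ := quotSubgroup_shorter_eq_bot fun c hc =>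
    (length_of_mem_lowerWords hc).trans (Nat.lt_succ_self _)
  rw [QuotientGroup.eq, hbot, Subgroup.mem_bot, inv_mul_eq_one, hmk] at happ
  have hlast := (solves_iff_truncWord.1 hE').2 i
  rw [← happ] at hlast
  set l' := q.eta (q.rho Q (q.signedWord i)) with hl'
  -- The longitude is known only modulo `N i`. This suffices, because `c` does not contain `i`.
  have hvan : Vanish M (avoiding (lowerWords s) i)
      ((lU i : NCSeries (Fin n)) - (wordVal (fun h : Fin n => mU h) l' : (NCSeries (Fin n))ˣ)) :=
    (inv_mul_mem_congSubgroup (hV := hW.avoiding i)).1 ((mk_mem_quotSubgroup fun c hc => hc.1).1 hlast)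
  have hf : ∀ d, d.Sublist c → d ≠ c →
      (((p.longitude Q i : NCSeries (Fin n)) - 1).coeff d : ZMod M) = 0 := by
    intro d hd hdc
    rw [coeff_sub, longitude_val, coeff_one]
    by_cases h0 : d = []
    · rw [h0, coeff_magnusPhi_nil]
      simp
    · have hlt : d.length < c.length := lt_of_le_of_ne hd.length_le fun h =>
        hdc (hd.eq_of_length h)
      have hpos := List.length_pos_iff.mpr h0
      have h1 := hM (d ++ [i]) (mem_lowerSeqs.2 ⟨⟨d ++ [i], hd.append (List.Sublist.refl _),
        by simp [hs, hlt], List.IsRotated.refl _⟩, by simp; omega⟩)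
      rw [muSeq_append] at h1
      rw [mu_eq p d i (by omega), if_neg (by simpa using h0), sub_zero, h1]
  have hlf : ∀ d, d.Sublist c → (((lU i : NCSeries (Fin n)) - 1).coeff d : ZMod M) =
      ((p.longitude Q i : NCSeries (Fin n)) - 1).coeff d := by
    intro d hd
    rw [hlU, hconj, ← coeff_conj_unit hf (if (i : ℕ) = k then u else 1) d hd]
    congr 2
    push_cast
    rw [mul_sub, sub_mul, mul_one, Units.inv_mul]
  have hres := coeff_eq_of_wordVal (M := M) (c := c) (mm := fun h : Fin n => mU h)
    (fun h c hc => hmU0 h c fun a ha hah => hc (Fin.ext hah ▸ ha)) hmU1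
    (u := (lU i : NCSeries (Fin n))) (l := l') (fun d hd hdc => by rw [hlf d hd, hf d hd hdc])
    (fun d hd => by
      have h1 := hvan d ⟨hsub d hd, fun h hh hhi => hic (hd.subset (Fin.ext hhi ▸ hh))⟩
      rw [coeff_sub, Int.cast_sub] at h1
      exact sub_eq_zero.1 h1)
  have h2 := hlf c (List.Sublist.refl c)
  rw [coeff_sub, coeff_sub, Int.cast_sub, Int.cast_sub] at h2
  rw [sub_left_injective h2, longitude_val, mu_eq p c i hcQ.le, hl', mu_eq q c i hcQ.le] at hres
  exact hres

end Nanophrase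

/-! ### Invariance of Δ and of the residue classes -/

namespace Nanophrase

variable {n : ℕ}

/-- Consequently Δ of a sequence divides Δ of each of its lower sequences, so congruences modulo the
latter can be used modulo the former. -/
theorem lowerSeqs_subset {s d : List (Fin n)} (hd : d ∈ lowerSeqs s) :
    lowerSeqs d ⊆ lowerSeqs s := by
  intro e he
  rw [mem_lowerSeqs] at hd he ⊢
  obtain ⟨⟨e', h1, _, h3⟩, h4⟩ := he
  exact ⟨lowerWords_of_isRotated (lowerWords_of_sublist hd.1 h1) h3, h4⟩

theorem Delta_dvd_muSeq (p : Nanophrase AlphaV n) (c : List (Fin n)) (i : Fin n)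
    {d : List (Fin n)} (hd : d ∈ lowerSeqs (c ++ [i])) : (p.Delta c i : ℤ) ∣ p.muSeq d :=
  Int.natAbs_dvd.2 (Finset.gcd_dvd hd)

theorem dvd_Delta {p : Nanophrase AlphaV n} {c : List (Fin n)} {i : Fin n} {M : ℕ}
    (h : ∀ d ∈ lowerSeqs (c ++ [i]), (M : ℤ) ∣ p.muSeq d) : M ∣ p.Delta c i :=
  Int.natCast_dvd.1 (Finset.dvd_gcd h)

theorem mu_intCast_eq_of_mMove {p q : Nanophrase AlphaV n} (hpq : MMove virtualData p q)
    {c : List (Fin n)} {i : Fin n} (hci : (c ++ [i]).Nodup) :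
    (p.mu c i : ZMod (p.Delta c i)) = q.mu c i :=
  mu_of_mMove hpq hci fun _ hd =>
    (ZMod.intCast_zmod_eq_zero_iff_dvd _ _).2 (p.Delta_dvd_muSeq c i hd)

/-- The moves preserve `Δ`. -/
theorem Delta_eq_of_mMove {p q : Nanophrase AlphaV n} (hpq : MMove virtualData p q) :
    ∀ (k : ℕ) (c : List (Fin n)) (i : Fin n), c.length = k → (c ++ [i]).Nodup →
      p.Delta c i = q.Delta c i := by
  intro k
  induction k using Nat.strong_induction_on with
  | _ k ih =>
    intro c i hck hci
    have key : ∀ d ∈ lowerSeqs (c ++ [i]),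
        ((p.Delta c i : ℤ) ∣ p.muSeq d → (p.Delta c i : ℤ) ∣ q.muSeq d) ∧
          ((q.Delta c i : ℤ) ∣ q.muSeq d → (q.Delta c i : ℤ) ∣ p.muSeq d) := by
      intro d hd
      have hd' := mem_lowerSeqs.1 hd
      have hne : d ≠ [] := by
        rintro rfl
        simp at hd'
      obtain ⟨e, j, rfl⟩ : ∃ e j, d = e ++ [j] :=
        ⟨d.dropLast, d.getLast hne, (List.dropLast_append_getLast hne).symm⟩
      have hnd := nodup_of_mem_lowerWords hci hd'.1
      have hlt : e.length < k := by
        simpa [hck] using length_of_mem_lowerWords hd'.1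
      have hΔ := ih _ hlt e j rfl hnd
      -- A lower number changes by a multiple of its own modulus. By the induction hypothesis this
      -- modulus is common to `p` and `q`, hence divisible by the larger sequence's Δ for either
      -- phrase; so one direction of the move gives both divisibilities.
      have hmu : (p.Delta e j : ℤ) ∣ q.mu e j - p.mu e j :=
        (ZMod.intCast_eq_intCast_iff_dvd_sub _ _ _).1 (mu_intCast_eq_of_mMove hpq hnd)
      have hp : (p.Delta c i : ℤ) ∣ p.Delta e j := Int.natCast_dvd_natCast.2
        (dvd_Delta fun d' hd' => p.Delta_dvd_muSeq c i (lowerSeqs_subset hd hd'))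
      have hq : (q.Delta c i : ℤ) ∣ q.Delta e j := Int.natCast_dvd_natCast.2
        (dvd_Delta fun d' hd' => q.Delta_dvd_muSeq c i (lowerSeqs_subset hd hd'))
      rw [muSeq_append, muSeq_append]
      exact ⟨fun h => (dvd_iff_dvd_of_dvd_sub (hp.trans hmu)).2 h,
        fun h => (dvd_iff_dvd_of_dvd_sub ((hΔ ▸ hq).trans hmu)).1 h⟩
    exact Nat.dvd_antisymm (dvd_Delta fun d hd => (key d hd).1 (p.Delta_dvd_muSeq c i hd))
      (dvd_Delta fun d hd => (key d hd).2 (q.Delta_dvd_muSeq c i hd))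

/-- The moves preserve `μ̄`. -/
theorem muBar_eq_of_mMove {p q : Nanophrase AlphaV n} (hpq : MMove virtualData p q)
    {c : List (Fin n)} {i : Fin n} (hci : (c ++ [i]).Nodup) : p.muBar c i = q.muBar c i := by
  have h := mu_intCast_eq_of_mMove hpq hci
  -- The classes are identified while the modulus on the left is still that of `p`; the moduli are
  -- exchanged afterwards.
  rw [muBar, muBar, h, Delta_eq_of_mMove hpq _ c i rfl hci]

end Nanophrase

/-- The pair `muBar` contains its modulus, so this equality includes that of Δ. Being an equality,
it passes from single moves to the generated equivalence relation. -/
theorem theorem3p1 {n : ℕ} (p p' : Nanophrase AlphaV n) (h : MHomotopic virtualData p p')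
    (c : List (Fin n)) (i : Fin n) (hci : (c ++ [i]).Nodup) :
    p.muBar c i = p'.muBar c i := by
  induction h with
  | rel p q hpq => exact Nanophrase.muBar_eq_of_mMove hpq hci
  | refl p => rfl
  | symm p q _ ih => exact ih.symm
  | trans p q r _ _ ih₁ ih₂ => exact ih₁.trans ih₂
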